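/- Let $M$ be a (possibly incomplete) $n$-dimensional Riemannian manifold without boundary (smooth, nonempty, Hausdorff, second countable), with volume element $dV$ and Levi-Civita connection $\nabla$. Let $E\to M$ be a smooth Riemannian or Hermitian vector bundle of finite positive rank with a smooth metric connection $\nabla^E$ and a smooth Clifford multiplication $TM\otimes E\to E$, $X\otimes\phi\mapsto X\cdot\phi$ (complex linear in $\phi$ in the Hermitian case, as is $\nabla^E$), such that $$X\cdot Y\cdot\phi+Y\cdot X\cdot\phi+2\langle X,Y\rangle\phi=0,\qquad \langle X\cdot\phi,\psi\rangle=-\langle\phi,X\cdot\psi\rangle,\qquad \nabla^E_X(Y\cdot\phi)=(\nabla_XY)\cdot\phi+Y\cdot\nabla^E_X\phi .$$ Let $D\phi=\sum_{i=1}^n e_i\cdot\nabla^E_{e_i}\phi$ be the associated generalized Dirac operator and $\mathcal K=\frac12\sum_{i,j=1}^n e_i\cdot e_j\cdot R^E(e_i,e_j)$ its curvature endomorphism, where $e_1,\dots,e_n$ is any orthonormal tangent basis and $R^E(X,Y)=\nabla^E_X\nabla^E_Y-\nabla^E_Y\nabla^E_X-\nabla^E_{[X,Y]}$. Let $L^2(M,E)$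 be the completion of the space $C_c^\infty(M,E)$ of smooth compactly supported sections for $(\phi,\psi)=\int_M\langle\phi,\psi\rangle\,dV$, and let $H^1_D(M,E)\subset L^2(M,E)$ be the closure of $C_c^\infty(M,E)$ with respect to the norm of $(\phi,\psi)+(D\phi,D\psi)$. The spectrum $\sigma(D^2)$ is the spectrum of the Friedrichs extension of $D^2$ on $C_c^\infty(M,E)$, i.e. of the restriction of the adjoint of $D^2|_{C_c^\infty(M,E)}$ to those elements of its domain that lie in $H^1_D(M,E)$. Suppose that there is a constant $\kappa>0$ with $\mathcal K\ge\kappa$, i.e. $\langle\mathcal K v,v\rangle\ge\kappa|v|^2$ for all $x\in M$ and $v\in E_x$ (this forces $n\ge2$). Then $\sigma(D^2)\subset\mathbb R$ has a minimum $\lambda_*(D^2)=\min\sigma(D^2)$, the Dirac fundamental tone, and $$\lambda_*(D^2)\ \ge\ \frac{n\kappa}{n-1}.$$ -/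

import Mathlib

open Bundle Set MeasureTheory
open scoped Manifold ContDiff Topology

set_option linter.unusedSectionVars false

noncomputable section

namespace GenDirac

section Volume

variable {n : ℕ} {M : Type*} [TopologicalSpace M] [ChartedSpace (EuclideanSpace ℝ (Fin n)) M]
  [RiemannianBundle (fun x : M ↦ TangentSpace (𝓡 n) x)]

/-- The `i`-th coordinate vector of the chart at `p`, at the point with coordinates `y`. -/
def coordVector (p : M) (y : EuclideanSpace ℝ (Fin n)) (i : Fin n) :
    TangentSpace (𝓡 n) ((extChartAt (𝓡 n) p).symm y) :=
  mfderiv (𝓡 n) (𝓡 n) (extChartAt (𝓡 n) p).symm y (EuclideanSpace.basisFun (Fin n) ℝ i)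

/-- `√(det (g_ij))` in the chart at `p`, at the point with coordinates `y`. -/
def volumeDensity (p : M) (y : EuclideanSpace ℝ (Fin n)) : ℝ :=
  √(Matrix.det (Matrix.of fun i j ↦ inner ℝ (coordVector p y i) (coordVector p y j)))

variable (n) in
/-- The Riemannian volume of the domain of the chart at `p`, as a measure on `M`:
`√(det (g_ij)) dx` in the chart. -/
def chartVolume [MeasurableSpace M] (p : M) : Measure M :=
  ((volume.restrict (extChartAt (𝓡 n) p).target).withDensity
    fun y ↦ ENNReal.ofReal (volumeDensity p y)).map (extChartAt (𝓡 n) p).symm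

variable [T2Space M] [SigmaCompactSpace M] [IsManifold (𝓡 n) ∞ M]

variable (n M) in
/-- A smooth partition of unity subordinate to the chart domains. -/
def volumePartition : SmoothPartitionOfUnity M (𝓡 n) M univ :=
  Classical.choose (SmoothPartitionOfUnity.exists_isSubordinate_chartAt_source (𝓡 n) M)

variable (n M) in
lemma volumePartition_isSubordinate : (volumePartition n M).IsSubordinate
    fun p ↦ (chartAt (EuclideanSpace ℝ (Fin n)) p).source :=
  Classical.choose_spec (SmoothPartitionOfUnity.exists_isSubordinate_chartAt_source (𝓡 n) M)

variable (n M) in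
/-- The Riemannian volume measure `dV`: it is `√(det (g_ij)) dx` in every chart, and the local
measures are glued with a partition of unity. -/
def riemannianVolume [MeasurableSpace M] : Measure M :=
  Measure.sum fun p : M ↦
    (chartVolume n p).withDensity fun x ↦ ENNReal.ofReal (volumePartition n M p x)

variable [IsContMDiffRiemannianBundle (𝓡 n) ∞ (EuclideanSpace ℝ (Fin n))
    (fun x : M ↦ TangentSpace (𝓡 n) x)]

lemma coordVector_eq (p : M) {y : EuclideanSpace ℝ (Fin n)} (hy : y ∈ (extChartAt (𝓡 n) p).target)
    (i : Fin n) : coordVector p y i =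
      (trivializationAt (EuclideanSpace ℝ (Fin n)) (fun x : M ↦ TangentSpace (𝓡 n) x) p).localFrame
        (EuclideanSpace.basisFun (Fin n) ℝ).toBasis i ((extChartAt (𝓡 n) p).symm y) := by
  have hx : (extChartAt (𝓡 n) p).symm y ∈ (chartAt (EuclideanSpace ℝ (Fin n)) p).source := by
    rw [← extChartAt_source (𝓡 n)]
    exact (extChartAt (𝓡 n) p).map_target hy
  have hb : (extChartAt (𝓡 n) p).symm y ∈ (trivializationAt (EuclideanSpace ℝ (Fin n))
      (fun x : M ↦ TangentSpace (𝓡 n) x) p).baseSet := by simpa using hx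
  rw [Trivialization.localFrame_apply_of_mem_baseSet _ _ hb]
  have h := TangentBundle.symmL_trivializationAt (I := 𝓡 n) hx
  rw [(extChartAt (𝓡 n) p).right_inv hy] at h
  have h2 := congrArg (fun f ↦ f (EuclideanSpace.basisFun (Fin n) ℝ i)) h
  simp only [ModelWithCorners.range_eq_univ, mfderivWithin_univ] at h2
  refine h2.symm.trans ?_
  rw [Trivialization.basisAt, Module.Basis.map_apply, OrthonormalBasis.coe_toBasis]
  erw [Trivialization.symmL_apply, Trivialization.linearEquivAt_symm_apply]
  exact hb

lemma continuousOn_volumeDensity (p : M) :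
    ContinuousOn (volumeDensity (n := n) p) (extChartAt (𝓡 n) p).target := by
  have key : ∀ i j, ContinuousOn (fun y ↦ inner ℝ (coordVector p y i) (coordVector p y j))
      (extChartAt (𝓡 n) p).target := by
    intro i j
    set e := trivializationAt (EuclideanSpace ℝ (Fin n)) (fun x : M ↦ TangentSpace (𝓡 n) x) p
    set b := (EuclideanSpace.basisFun (Fin n) ℝ).toBasis
    have h (i) := e.contMDiffOn_localFrame_baseSet (I := 𝓡 n) ∞ b i
    have h2 := ((h i).inner_bundle (h j)).continuousOn
    have h3 : ContinuousOn (fun y ↦ inner ℝ (e.localFrame b i ((extChartAt (𝓡 n) p).symm y))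
        (e.localFrame b j ((extChartAt (𝓡 n) p).symm y))) (extChartAt (𝓡 n) p).target :=
      h2.comp (continuousOn_extChartAt_symm p) fun y hy ↦ by
        simpa [e] using (extChartAt (𝓡 n) p).map_target hy
    refine h3.congr fun y hy ↦ ?_
    simp only [coordVector_eq p hy]
    rfl
  refine Real.continuous_sqrt.comp_continuousOn ?_
  simp only [Matrix.det_apply, Matrix.of_apply]
  refine continuousOn_finsetSum _ fun σ _ ↦ ?_
  exact (continuousOn_finsetProd _ fun i _ ↦ key _ _).const_smul _

variable [MeasurableSpace M] [BorelSpace M]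

lemma chartVolume_lt_top (p : M) {K : Set M} (hK : IsCompact K)
    (hp : K ⊆ (chartAt (EuclideanSpace ℝ (Fin n)) p).source) : chartVolume n p K < ⊤ := by
  set φ := extChartAt (𝓡 n) p
  have hp' : K ⊆ φ.source := by rwa [extChartAt_source]
  have ht : MeasurableSet φ.target := (isOpen_extChartAt_target p).measurableSet
  have hC : IsCompact (φ '' K) := hK.image_of_continuousOn ((continuousOn_extChartAt p).mono hp')
  have hCt : φ '' K ⊆ φ.target := by
    rintro _ ⟨x, hx, rfl⟩
    exact φ.map_source (hp' hx)
  have hm : AEMeasurable φ.symm ((volume.restrict φ.target).withDensity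
      fun y ↦ ENNReal.ofReal (volumeDensity p y)) :=
    ((continuousOn_extChartAt_symm p).aemeasurable ht).mono_ac (withDensity_absolutelyContinuous _ _)
  have hae : (φ.symm ⁻¹' K : Set _) =ᵐ[(volume.restrict φ.target).withDensity
      fun y ↦ ENNReal.ofReal (volumeDensity p y)] (φ '' K : Set _) := by
    refine (withDensity_absolutelyContinuous _ _).ae_le ?_
    filter_upwards [ae_restrict_mem ht] with y hy
    apply propext
    constructor
    · intro h
      exact ⟨_, h, φ.right_inv hy⟩
    · rintro ⟨x, hx, rfl⟩
      change φ.symm (φ x) ∈ K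
      rwa [φ.left_inv (hp' hx)]
  obtain ⟨C, hCb⟩ := hC.exists_bound_of_continuousOn ((continuousOn_volumeDensity p).mono hCt)
  rw [chartVolume, Measure.map_apply_of_aemeasurable hm hK.measurableSet, measure_congr hae,
    withDensity_apply _ hC.measurableSet]
  calc _ ≤ ∫⁻ y in φ '' K, ENNReal.ofReal C ∂(volume.restrict φ.target) := by
        refine setLIntegral_mono measurable_const fun y hy ↦ ?_
        exact ENNReal.ofReal_le_ofReal ((le_abs_self _).trans (hCb y hy))
    _ < ⊤ := by
        rw [setLIntegral_const]
        refine ENNReal.mul_lt_top ENNReal.ofReal_lt_top ?_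
        exact (Measure.restrict_apply_le _ _).trans_lt hC.measure_lt_top

instance isFiniteMeasureOnCompacts_riemannianVolume :
    IsFiniteMeasureOnCompacts (riemannianVolume n M) := by
  refine ⟨fun K hK ↦ ?_⟩
  have hfin := (volumePartition n M).locallyFinite.finite_nonempty_inter_compact hK
  rw [riemannianVolume, Measure.sum_apply _ hK.measurableSet]
  rw [tsum_eq_sum (s := hfin.toFinset)]
  · refine ENNReal.sum_lt_top.2 fun p _ ↦ ?_
    rw [withDensity_apply _ hK.measurableSet]
    have hc : IsCompact (K ∩ tsupport (volumePartition n M p)) :=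
      hK.inter_right (isClosed_tsupport _)
    calc _ ≤ ∫⁻ x in K, (tsupport (volumePartition n M p)).indicator 1 x ∂(chartVolume n p) := by
          refine lintegral_mono fun x ↦ ?_
          by_cases hx : x ∈ tsupport (volumePartition n M p)
          · simp only [hx, indicator_of_mem, Pi.one_apply, ENNReal.ofReal_le_one]
            exact (volumePartition n M).le_one p x
          · simp [image_eq_zero_of_notMem_tsupport hx]
      _ = chartVolume n p (K ∩ tsupport (volumePartition n M p)) := by
          rw [lintegral_indicator_one (isClosed_tsupport _).measurableSet,
            Measure.restrict_apply (isClosed_tsupport _).measurableSet, inter_comm]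
      _ < ⊤ := chartVolume_lt_top p hc (inter_subset_right.trans
          (volumePartition_isSubordinate n M p))
  · intro p hp
    rw [withDensity_apply _ hK.measurableSet]
    rw [setLIntegral_congr_fun (g := fun _ ↦ 0) hK.measurableSet]
    · simp
    · intro x hx
      by_contra h
      apply hp
      simp only [Finite.mem_toFinset, mem_ofPred_eq]
      refine ⟨x, ?_, hx⟩
      intro h0
      simp [h0] at h

end Volume

section LeviCivita

variable {E : Type*} [NormedAddCommGroup E] [NormedSpace ℝ E] [FiniteDimensional ℝ E]
  {H : Type*} [TopologicalSpace H] {I : ModelWithCorners ℝ E H}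
  {M : Type*} [TopologicalSpace M] [ChartedSpace H M]

instance finiteDimensional_tangentSpace (x : M) : FiniteDimensional ℝ (TangentSpace I x) :=
  inferInstanceAs (FiniteDimensional ℝ E)

variable [IsManifold I ∞ M] [RiemannianBundle (fun x : M ↦ TangentSpace I x)]

/-- The right-hand side of the Koszul formula for `2 ⟨∇_X Y, Z⟩`. -/
def koszul (Y X Z : Π x : M, TangentSpace I x) (x : M) : ℝ :=
  mvfderiv I (fun y ↦ inner ℝ (Y y) (Z y)) x (X x)
    + mvfderiv I (fun y ↦ inner ℝ (X y) (Z y)) x (Y x)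
    - mvfderiv I (fun y ↦ inner ℝ (X y) (Y y)) x (Z x)
    + inner ℝ (VectorField.mlieBracket I X Y x) (Z x)
    - inner ℝ (VectorField.mlieBracket I X Z x) (Y x)
    - inner ℝ (VectorField.mlieBracket I Y Z x) (X x)

variable [IsContMDiffRiemannianBundle I ∞ E
    (fun x : M ↦ TangentSpace I x)]

lemma mdifferentiableAt_inner {x : M} {X Y : Π x : M, TangentSpace I x}
    (hX : MDiffAt (T% X) x) (hY : MDiffAt (T% Y) x) :
    MDiffAt (fun y ↦ inner ℝ (X y) (Y y)) x :=
  MDifferentiableAt.inner_bundle (IB := I) (F := E) (E := fun x : M ↦ TangentSpace I x)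
    (b := fun y ↦ y) hX hY

lemma koszul_tensorial_left {x : M} {Y Z : Π x : M, TangentSpace I x}
    (hY : MDiffAt (T% Y) x) (hZ : MDiffAt (T% Z) x) :
    TensorialAt I E (fun X ↦ koszul Y X Z x) x where
  smul {f X} hf hX := by
    have h1 := mvfderiv_fun_mul hf (mdifferentiableAt_inner hX hZ)
    have h2 := mvfderiv_fun_mul hf (mdifferentiableAt_inner hX hY)
    simp only [koszul, Pi.smul_apply', inner_smul_left, RCLike.conj_to_real, h1, h2,
      VectorField.mlieBracket_smul_left hf hX, inner_add_left, inner_smul_right, map_smul,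
      smul_eq_mul, _root_.add_apply, _root_.smul_apply]
    ring
  add {X X'} hX hX' := by
    have h1 := mvfderiv_fun_add (mdifferentiableAt_inner hX hZ) (mdifferentiableAt_inner hX' hZ)
    have h2 := mvfderiv_fun_add (mdifferentiableAt_inner hX hY) (mdifferentiableAt_inner hX' hY)
    simp only [koszul, Pi.add_apply, inner_add_left, inner_add_right, map_add, h1, h2,
      VectorField.mlieBracket_add_left hX hX', _root_.add_apply]
    ring

lemma koszul_tensorial_right {x : M} {Y X : Π x : M, TangentSpace I x}
    (hY : MDiffAt (T% Y) x) (hX : MDiffAt (T% X) x) :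
    TensorialAt I E (fun Z ↦ koszul Y X Z x) x where
  smul {f Z} hf hZ := by
    have h1 := mvfderiv_fun_mul hf (mdifferentiableAt_inner hX hZ)
    have h2 := mvfderiv_fun_mul hf (mdifferentiableAt_inner hY hZ)
    simp only [koszul, Pi.smul_apply', inner_smul_right, RCLike.conj_to_real, h1, h2,
      VectorField.mlieBracket_smul_right hf hZ, inner_add_left, inner_smul_left, map_smul,
      smul_eq_mul, _root_.add_apply, _root_.smul_apply]
    rw [real_inner_comm (X x) (Z x), real_inner_comm (Y x) (Z x)]
    ring
  add {Z Z'} hZ hZ' := by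
    have h1 := mvfderiv_fun_add (mdifferentiableAt_inner hX hZ) (mdifferentiableAt_inner hX hZ')
    have h2 := mvfderiv_fun_add (mdifferentiableAt_inner hY hZ) (mdifferentiableAt_inner hY hZ')
    simp only [koszul, Pi.add_apply, inner_add_left, inner_add_right, map_add, h1, h2,
      VectorField.mlieBracket_add_right hZ hZ', _root_.add_apply]
    ring

open Classical in
/-- The Levi-Civita connection as a function, characterized by the Koszul formula. -/
def leviCivitaFun (Y : Π x : M, TangentSpace I x) (x : M) :
    TangentSpace I x →L[ℝ] TangentSpace I x :=
  if hY : MDiffAt (T% Y) x then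
    ∑ i, (((1 / 2 : ℝ) • (TensorialAt.mkHom₂ (fun X Z ↦ koszul Y X Z x) x
      (fun _ hZ ↦ koszul_tensorial_left hY hZ) (fun _ hX ↦ koszul_tensorial_right hY hX)).flip
        (stdOrthonormalBasis ℝ (TangentSpace I x) i)).smulRight
          (stdOrthonormalBasis ℝ (TangentSpace I x) i))
  else 0

lemma inner_leviCivitaFun {x : M} {X Y Z : Π x : M, TangentSpace I x}
    (hY : MDiffAt (T% Y) x) (hX : MDiffAt (T% X) x) (hZ : MDiffAt (T% Z) x) :
    inner ℝ (leviCivitaFun Y x (X x)) (Z x) = (1 / 2) * koszul Y X Z x := by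
  set B := TensorialAt.mkHom₂ (fun X Z ↦ koszul Y X Z x) x
      (fun _ hZ ↦ koszul_tensorial_left hY hZ) (fun _ hX ↦ koszul_tensorial_right hY hX) with hB
  have h : B (X x) (Z x) = koszul Y X Z x := TensorialAt.mkHom₂_apply _ _ hX hZ
  rw [← h]
  have h2 : B (X x) (Z x) = ∑ i, inner ℝ (stdOrthonormalBasis ℝ (TangentSpace I x) i) (Z x) *
      B (X x) (stdOrthonormalBasis ℝ (TangentSpace I x) i) := by
    conv_lhs => rw [← (stdOrthonormalBasis ℝ (TangentSpace I x)).sum_repr' (Z x)]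
    simp
  rw [h2, leviCivitaFun, dif_pos hY]
  simp only [_root_.sum_apply, ContinuousLinearMap.smulRight_apply, sum_inner,
    inner_smul_left, _root_.smul_apply, ContinuousLinearMap.flip_apply,
    Finset.mul_sum, RCLike.conj_to_real, smul_eq_mul]
  exact Finset.sum_congr rfl fun i _ ↦ by ring

lemma leviCivitaFun_ext {x : M} {v w : TangentSpace I x →L[ℝ] TangentSpace I x}
    (h : ∀ X Z : Π x : M, TangentSpace I x, MDiffAt (T% X) x → MDiffAt (T% Z) x →
      inner ℝ (v (X x)) (Z x) = inner ℝ (w (X x)) (Z x)) : v = w := by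
  ext1 X
  refine ext_inner_right ℝ fun Z ↦ ?_
  have := h (FiberBundle.extend E X)
    (FiberBundle.extend E Z)
    (FiberBundle.mdifferentiableAt_extend ..) (FiberBundle.mdifferentiableAt_extend ..)
  simpa using this

variable (I M) in
/-- The Levi-Civita connection of a Riemannian manifold. -/
def leviCivita : CovariantDerivative I E
    (fun x : M ↦ TangentSpace I x) where
  toFun := leviCivitaFun
  isCovariantDerivativeOnUniv :=
    { add := by
        intro Y Y' x hY hY' _
        refine leviCivitaFun_ext fun X Z hX hZ ↦ ?_
        have hs : MDiffAt (T% (Y + Y')) x := mdifferentiableAt_add_section hY hY'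
        have h1 := mvfderiv_fun_add (mdifferentiableAt_inner hX hY) (mdifferentiableAt_inner hX hY')
        have h2 := mvfderiv_fun_add (mdifferentiableAt_inner hY hZ) (mdifferentiableAt_inner hY' hZ)
        simp only [_root_.add_apply, inner_add_left]
        rw [inner_leviCivitaFun hs hX hZ, inner_leviCivitaFun hY hX hZ,
          inner_leviCivitaFun hY' hX hZ]
        simp only [koszul, Pi.add_apply, inner_add_left, inner_add_right, map_add, h1, h2,
          VectorField.mlieBracket_add_right hY hY', VectorField.mlieBracket_add_left hY hY',
          _root_.add_apply]
        ring
      leibniz := by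
        intro Y f x hY hf _
        refine leviCivitaFun_ext fun X Z hX hZ ↦ ?_
        have hs : MDiffAt (T% (f • Y)) x := hf.smul_section hY
        have h1 := mvfderiv_fun_mul hf (mdifferentiableAt_inner hX hY)
        have h2 := mvfderiv_fun_mul hf (mdifferentiableAt_inner hY hZ)
        simp only [_root_.add_apply, inner_add_left, _root_.smul_apply,
          inner_smul_left, ContinuousLinearMap.smulRight_apply, RCLike.conj_to_real]
        rw [inner_leviCivitaFun hs hX hZ, inner_leviCivitaFun hY hX hZ]
        simp only [koszul, Pi.smul_apply', inner_smul_left, inner_smul_right, h1, h2, map_smul,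
          VectorField.mlieBracket_smul_right hf hY, VectorField.mlieBracket_smul_left hf hY,
          inner_add_left, RCLike.conj_to_real, smul_eq_mul,
          _root_.add_apply, _root_.smul_apply]
        rw [real_inner_comm (X x) (Y x)]
        ring }

lemma leviCivita_metric {x : M} {X Y Z : Π x : M, TangentSpace I x}
    (hX : MDiffAt (T% X) x) (hY : MDiffAt (T% Y) x) (hZ : MDiffAt (T% Z) x) :
    mvfderiv I (fun y ↦ inner ℝ (Y y) (Z y)) x (X x)
      = inner ℝ (leviCivita I M Y x (X x)) (Z x) + inner ℝ (Y x) (leviCivita I M Z x (X x)) := by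
  have h1 := inner_leviCivitaFun hY hX hZ
  have h2 := inner_leviCivitaFun hZ hX hY
  change _ = inner ℝ (leviCivitaFun Y x (X x)) (Z x) + inner ℝ (Y x) (leviCivitaFun Z x (X x))
  rw [real_inner_comm _ (Y x), h1, h2]
  have e1 : (fun y ↦ inner ℝ (Z y) (Y y)) = fun y ↦ inner ℝ (Y y) (Z y) :=
    funext fun y ↦ real_inner_comm _ _
  have e2 : VectorField.mlieBracket I Z Y x = -VectorField.mlieBracket I Y Z x :=
    VectorField.mlieBracket_swap_apply
  simp only [koszul, e1, e2, inner_neg_left]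
  ring

lemma leviCivita_torsion : (leviCivita I M).torsion = 0 := by
  rw [CovariantDerivative.torsion_eq_zero_iff]
  intro X Y x hX hY
  refine ext_inner_right ℝ fun Z ↦ ?_
  have hZ := FiberBundle.mdifferentiableAt_extend (V := fun x : M ↦ TangentSpace I x) I E Z
  have h1 := inner_leviCivitaFun hY hX hZ
  have h2 := inner_leviCivitaFun hX hY hZ
  change inner ℝ (leviCivitaFun Y x (X x) - leviCivitaFun X x (Y x)) Z = _
  rw [FiberBundle.extend_apply_self] at h1 h2
  rw [inner_sub_left, h1, h2]
  have e1 : (fun y ↦ inner ℝ (Y y) (X y)) = fun y ↦ inner ℝ (X y) (Y y) :=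
    funext fun y ↦ real_inner_comm _ _
  have e2 : VectorField.mlieBracket I Y X x = -VectorField.mlieBracket I X Y x :=
    VectorField.mlieBracket_swap_apply
  simp only [koszul, e1, e2, inner_neg_left, FiberBundle.extend_apply_self]
  ring

end LeviCivita

section Frame

lemma sum_orthonormalBasis_eq {W U ι κ : Type*} [NormedAddCommGroup W] [InnerProductSpace ℝ W]
    [AddCommGroup U] [Module ℝ U] [Fintype ι] [Fintype κ] (b : OrthonormalBasis ι ℝ W)
    (c : OrthonormalBasis κ ℝ W) (B : W →ₗ[ℝ] W →ₗ[ℝ] U) :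
    ∑ i, B (b i) (b i) = ∑ j, B (c j) (c j) := by
  have h (i) : B (b i) (b i) = ∑ j, inner ℝ (c j) (b i) • B (c j) (b i) := by
    calc B (b i) (b i) = B (∑ j, inner ℝ (c j) (b i) • c j) (b i) := by rw [c.sum_repr' (b i)]
      _ = _ := by simp only [map_sum, map_smul, LinearMap.sum_apply, LinearMap.smul_apply]
  have h2 (j) : B (c j) (c j) = ∑ i, inner ℝ (b i) (c j) • B (c j) (b i) := by
    calc B (c j) (c j) = B (c j) (∑ i, inner ℝ (b i) (c j) • b i) := by rw [b.sum_repr' (c j)]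
      _ = _ := by simp only [map_sum, map_smul]
  simp only [h, h2]
  rw [Finset.sum_comm]
  simp only [real_inner_comm]

variable {E : Type*} [NormedAddCommGroup E] [NormedSpace ℝ E] [FiniteDimensional ℝ E]
  {H : Type*} [TopologicalSpace H] {I : ModelWithCorners ℝ E H}
  {M : Type*} [TopologicalSpace M] [ChartedSpace H M] [IsManifold I ∞ M]
  [RiemannianBundle (fun x : M ↦ TangentSpace I x)]
  [IsContMDiffRiemannianBundle I ∞ E (fun x : M ↦ TangentSpace I x)]

lemma contMDiffAt_inner {x : M} {X Y : Π x : M, TangentSpace I x}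
    (hX : CMDiffAt ∞ (T% X) x) (hY : CMDiffAt ∞ (T% Y) x) :
    CMDiffAt ∞ (fun y ↦ inner ℝ (X y) (Y y)) x :=
  ContMDiffAt.inner_bundle (IB := I) (F := E) (E := fun x : M ↦ TangentSpace I x)
    (b := fun y ↦ y) hX hY

open InnerProductSpace in
lemma contMDiffAt_gramSchmidt {d : ℕ} {x₀ : M} {s : Fin d → Π x : M, TangentSpace I x}
    (hs : ∀ i, CMDiffAt ∞ (T% (s i)) x₀) (hl : LinearIndependent ℝ fun i ↦ s i x₀) (k : Fin d) :
    CMDiffAt ∞ (T% (fun x ↦ gramSchmidt ℝ (fun i ↦ s i x) k)) x₀ := by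
  induction k using WellFoundedLT.induction with
  | _ k ih =>
  have h1 : (fun x ↦ gramSchmidt ℝ (fun i ↦ s i x) k) = s k - fun x ↦ ∑ i ∈ Finset.Iio k,
      (inner ℝ (gramSchmidt ℝ (fun i ↦ s i x) i) (s k x) *
        (inner ℝ (gramSchmidt ℝ (fun i ↦ s i x) i) (gramSchmidt ℝ (fun i ↦ s i x) i))⁻¹) •
          gramSchmidt ℝ (fun i ↦ s i x) i := by
    funext x
    rw [gramSchmidt_def]
    simp only [Submodule.starProjection_singleton, Pi.sub_apply, real_inner_self_eq_norm_sq,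
      div_eq_mul_inv, RCLike.ofReal_real_eq_id, id]
  refine ((hs k).sub_section (ContMDiffAt.sum_section fun i hi ↦ ?_)).congr_of_eventuallyEq
    (.of_forall fun x ↦ congrArg (TotalSpace.mk x) (congrFun h1 x))
  have hi' := ih i (Finset.mem_Iio.1 hi)
  refine ContMDiffAt.smul_section ?_ hi'
  refine (contMDiffAt_inner hi' (hs k)).mul ?_
  refine ContMDiffAt.inv₀ (contMDiffAt_inner hi' hi') ?_
  exact inner_self_ne_zero.2 (gramSchmidt_ne_zero _ hl)

end Frame

section Bundle

variable {𝕜 : Type*} [RCLike 𝕜]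
  {E : Type*} [NormedAddCommGroup E] [NormedSpace ℝ E] [FiniteDimensional ℝ E]
  {H : Type*} [TopologicalSpace H] {I : ModelWithCorners ℝ E H}
  {M : Type*} [TopologicalSpace M] [ChartedSpace H M] [IsManifold I ∞ M]
  [RiemannianBundle (fun x : M ↦ TangentSpace I x)]
  [IsContMDiffRiemannianBundle I ∞ E (fun x : M ↦ TangentSpace I x)]
  {F : Type*} [NormedAddCommGroup F] [NormedSpace ℝ F] [NormedSpace 𝕜 F] [FiniteDimensional ℝ F]
  {V : M → Type*} [∀ x, NormedAddCommGroup (V x)] [∀ x, InnerProductSpace ℝ (V x)]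
  [∀ x, InnerProductSpace 𝕜 (V x)] [TopologicalSpace (TotalSpace F V)] [FiberBundle F V]
  [VectorBundle ℝ F V] [VectorBundle 𝕜 F V] [ContMDiffVectorBundle ∞ F V I]
  [IsContMDiffRiemannianBundle I ∞ F V]

variable (𝕜 I F V) in
/-- The data defining a generalized Dirac operator on the Riemannian manifold `M`: a Clifford
multiplication and a metric connection on the vector bundle `V` with scalar products on its fibres.
The bundle is Riemannian for `𝕜 = ℝ` and Hermitian for `𝕜 = ℂ`. The norm of a fibre determines its
scalar product, so `inner ℝ` is the real part of `inner 𝕜` on the fibres. -/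
structure DiracBundle where
  /-- Clifford multiplication: `clifford x X v` is `X · v`. -/
  clifford : Π x : M, TangentSpace I x →L[ℝ] V x →L[ℝ] V x
  contMDiff_clifford : ContMDiff I (I.prod 𝓘(ℝ, E →L[ℝ] F →L[ℝ] F)) ∞
    (fun x ↦ TotalSpace.mk' (E →L[ℝ] F →L[ℝ] F)
      (E := fun x : M ↦ (TangentSpace I x →L[ℝ] V x →L[ℝ] V x)) x (clifford x))
  clifford_smul : ∀ (x : M) (X : TangentSpace I x) (a : 𝕜) (v : V x),
    clifford x X (a • v) = a • clifford x X v
  clifford_relation : ∀ (x : M) (X Y : TangentSpace I x) (v : V x),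
    clifford x X (clifford x Y v) + clifford x Y (clifford x X v) + (2 * inner ℝ X Y : ℝ) • v = 0
  clifford_skew : ∀ (x : M) (X : TangentSpace I x) (v w : V x),
    inner 𝕜 (clifford x X v) w = -inner 𝕜 v (clifford x X w)
  /-- The connection `∇^E`; `conn σ x X` is `∇^E_X σ` at `x`. -/
  conn : CovariantDerivative I F V
  contMDiff_conn : conn.ContMDiffCovariantDerivative ∞
  conn_smul : ∀ (a : 𝕜) (σ : Π x : M, V x) (x : M) (X : TangentSpace I x), MDiffAt (T% σ) x →
    conn (a • σ) x X = a • conn σ x X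
  conn_metric : ∀ (σ τ : Π x : M, V x) (x : M) (X : TangentSpace I x),
    MDiffAt (T% σ) x → MDiffAt (T% τ) x →
    mvfderiv I (fun y ↦ inner 𝕜 (σ y) (τ y)) x X
      = inner 𝕜 (conn σ x X) (τ x) + inner 𝕜 (σ x) (conn τ x X)
  product_rule : ∀ (Y : Π x : M, TangentSpace I x) (σ : Π x : M, V x) (x : M)
    (X : TangentSpace I x), MDiffAt (T% Y) x → MDiffAt (T% σ) x →
    conn (fun y ↦ clifford y (Y y) (σ y)) x X
      = clifford x (leviCivita I M Y x X) (σ x) + clifford x (Y x) (conn σ x X)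

namespace DiracBundle

variable (S : DiracBundle 𝕜 I F V)

/-- The Dirac operator `D φ = ∑ i, e_i · ∇_{e_i} φ`, for an orthonormal basis `e_i`. -/
def dirac (φ : Π x : M, V x) (x : M) : V x :=
  ∑ i, S.clifford x (stdOrthonormalBasis ℝ (TangentSpace I x) i)
    (S.conn φ x (stdOrthonormalBasis ℝ (TangentSpace I x) i))

/-- `R^E(X, Y) φ = ∇_X ∇_Y φ - ∇_Y ∇_X φ - ∇_[X, Y] φ`. -/
def curvature (X Y : Π x : M, TangentSpace I x) (φ : Π x : M, V x) (x : M) : V x :=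
  S.conn (fun y ↦ S.conn φ y (Y y)) x (X x) - S.conn (fun y ↦ S.conn φ y (X y)) x (Y x)
    - S.conn φ x (VectorField.mlieBracket I X Y x)

/-- The curvature endomorphism `𝒦 = 1/2 ∑ i j, e_i · e_j · R^E(e_i, e_j)`, where the tensor
`R^E` is evaluated on extensions of the vectors to sections that are smooth near `x`. -/
def curvatureEndomorphism (x : M) (v : V x) : V x :=
  (1 / 2 : ℝ) • ∑ i, ∑ j,
    S.clifford x (stdOrthonormalBasis ℝ (TangentSpace I x) i)
      (S.clifford x (stdOrthonormalBasis ℝ (TangentSpace I x) j)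
        (S.curvature (FiberBundle.extend E (stdOrthonormalBasis ℝ (TangentSpace I x) i))
          (FiberBundle.extend E (stdOrthonormalBasis ℝ (TangentSpace I x) j))
          (FiberBundle.extend F v) x))

variable {S}

lemma contMDiff_conn_section {φ : Π x : M, V x} (hφ : CMDiff ∞ (T% φ)) :
    ContMDiff I (I.prod 𝓘(ℝ, E →L[ℝ] F)) ∞ (fun x ↦ TotalSpace.mk' (E →L[ℝ] F)
      (E := fun x : M ↦ (TangentSpace I x →L[ℝ] V x)) x (S.conn φ x)) := by
  have h := S.contMDiff_conn.contMDiff.contMDiff (σ := φ)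
    (by simpa using hφ.contMDiffOn)
  exact contMDiffOn_univ.1 h

variable (S) in
lemma dirac_eq_of_orthonormalBasis {ι : Type*} [Fintype ι] {x : M}
    (b : OrthonormalBasis ι ℝ (TangentSpace I x)) (φ : Π x : M, V x) :
    S.dirac φ x = ∑ i, S.clifford x (b i) (S.conn φ x (b i)) :=
  sum_orthonormalBasis_eq (stdOrthonormalBasis ℝ (TangentSpace I x)) b
    (LinearMap.mk₂ ℝ (fun X Y ↦ S.clifford x X (S.conn φ x Y)) (by simp) (by simp) (by simp)
      (by simp))

open InnerProductSpace in
lemma contMDiff_dirac {φ : Π x : M, V x} (hφ : CMDiff ∞ (T% φ)) :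
    CMDiff ∞ (T% (S.dirac φ)) := by
  intro x₀
  set e := trivializationAt E (fun x : M ↦ TangentSpace I x) x₀
  set s := e.localFrame (Module.finBasis ℝ E)
  have hs (i) : CMDiffAt ∞ (T% (s i)) x₀ :=
    contMDiffAt_localFrame_of_mem ∞ e _ i (FiberBundle.mem_baseSet_trivializationAt' x₀)
  have hl (x) (hx : x ∈ e.baseSet) : LinearIndependent ℝ fun i ↦ s i x :=
    (e.isLocalFrameOn_localFrame_baseSet I ∞ (Module.finBasis ℝ E)).linearIndependent hx
  have hg := contMDiffAt_gramSchmidt hs (hl x₀ (FiberBundle.mem_baseSet_trivializationAt' x₀))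
  have key : CMDiffAt ∞ (T% (fun x ↦ ∑ i,
      (inner ℝ (gramSchmidt ℝ (fun i ↦ s i x) i) (gramSchmidt ℝ (fun i ↦ s i x) i))⁻¹ •
        S.clifford x (gramSchmidt ℝ (fun i ↦ s i x) i)
          (S.conn φ x (gramSchmidt ℝ (fun i ↦ s i x) i)))) x₀ := by
    refine ContMDiffAt.sum_section fun i _ ↦ ContMDiffAt.smul_section ?_ ?_
    · refine ContMDiffAt.inv₀ (contMDiffAt_inner (hg i) (hg i)) ?_
      exact inner_self_ne_zero.2
        (gramSchmidt_ne_zero _ (hl x₀ (FiberBundle.mem_baseSet_trivializationAt' x₀)))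
    · exact ((S.contMDiff_clifford x₀).clm_bundle_apply (hg i)).clm_bundle_apply
        ((contMDiff_conn_section hφ x₀).clm_bundle_apply (hg i))
  refine key.congr_of_eventuallyEq ?_
  filter_upwards [e.open_baseSet.mem_nhds (FiberBundle.mem_baseSet_trivializationAt' x₀)] with x hx
  refine congrArg (TotalSpace.mk x) ?_
  have hfr : Module.finrank ℝ (TangentSpace I x) = Fintype.card (Fin (Module.finrank ℝ E)) := by
    rw [Fintype.card_fin]; rfl
  rw [S.dirac_eq_of_orthonormalBasis (gramSchmidtOrthonormalBasis hfr (fun i ↦ s i x)) φ]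
  refine Finset.sum_congr rfl fun i _ ↦ ?_
  have hne := gramSchmidt_ne_zero i (hl x hx)
  rw [gramSchmidtOrthonormalBasis_apply hfr (by simpa [gramSchmidtNormed] using hne),
    gramSchmidtNormed]
  simp only [map_smul, _root_.smul_apply, smul_smul, RCLike.ofReal_real_eq_id, id,
    real_inner_self_eq_norm_sq]
  congr 1
  rw [sq, mul_inv]

lemma dirac_add {φ ψ : Π x : M, V x} (hφ : CMDiff ∞ (T% φ)) (hψ : CMDiff ∞ (T% ψ)) :
    S.dirac (φ + ψ) = S.dirac φ + S.dirac ψ := by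
  funext x
  have h := S.conn.isCovariantDerivativeOnUniv.add
    ((hφ x).mdifferentiableAt (by simp)) ((hψ x).mdifferentiableAt (by simp))
  change S.conn (φ + ψ) x = S.conn φ x + S.conn ψ x at h
  simp only [dirac, h, Pi.add_apply, _root_.add_apply, map_add, Finset.sum_add_distrib]

lemma dirac_smul {φ : Π x : M, V x} (a : 𝕜) (hφ : CMDiff ∞ (T% φ)) :
    S.dirac (a • φ) = a • S.dirac φ := by
  funext x
  have h := fun X ↦ S.conn_smul a φ x X ((hφ x).mdifferentiableAt (by simp))
  simp only [dirac, h, S.clifford_smul, Pi.smul_apply, Finset.smul_sum]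

lemma dirac_eq_zero {φ : Π x : M, V x} (hφ : CMDiff ∞ (T% φ)) {x : M}
    (hx : ∀ᶠ y in 𝓝 x, φ y = 0) : S.dirac φ x = 0 := by
  have h := S.conn.isCovariantDerivativeOnUniv.congr_of_eventuallyEq (σ := φ) (σ' := 0) (x := x)
    ((hφ x).mdifferentiableAt (by simp)) (mdifferentiable_zeroSection _ _ x) (by simp) hx
  have h0 : S.conn φ x = 0 := h.trans (congrFun S.conn.zero x)
  simp [dirac, h0]

end DiracBundle

end Bundle


section Friedrichs

open UniformSpace

variable {𝕜 : Type*} [RCLike 𝕜]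

/-- The complement of the spectrum of an unbounded operator `A`: the `z` for which `A - z` is a
bijection from the domain of `A` onto the whole space with a bounded inverse. -/
def resolventSet {H : Type*} [NormedAddCommGroup H] [InnerProductSpace 𝕜 H] (A : H →ₗ.[𝕜] H) :
    Set 𝕜 :=
  {z | ∃ R : H →L[𝕜] H, (∀ u : A.domain, R (A u - z • (u : H)) = u) ∧
    ∀ f : H, ∃ u : A.domain, (u : H) = R f ∧ A u - z • (u : H) = f}

/-- The spectrum of an unbounded operator. -/
def operatorSpectrum {H : Type*} [NormedAddCommGroup H] [InnerProductSpace 𝕜 H]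
    (A : H →ₗ.[𝕜] H) : Set 𝕜 :=
  (resolventSet A)ᶜ

variable {X : Type*} [SeminormedAddCommGroup X] [InnerProductSpace 𝕜 X] (D : X →ₗ[𝕜] X)

/-- The closure of the graph of `D` in the square of the completion. -/
def closedGraph : Submodule 𝕜 (Completion X × Completion X) :=
  ((Completion.toComplL (𝕜 := 𝕜) (E := X)).toLinearMap.prod
    ((Completion.toComplL (𝕜 := 𝕜) (E := X)).toLinearMap ∘ₗ D)).range.topologicalClosure

/-- The space `H¹_D`: the closure of `X` for `(φ, ψ) + (D φ, D ψ)`, seen inside the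
completion of `X` for `(φ, ψ)`. -/
def energySpace : Submodule 𝕜 (Completion X) :=
  (closedGraph D).map (LinearMap.fst 𝕜 _ _)

/-- The graph of the Friedrichs extension of `D²`: the pairs `(u, f)` with `u ∈ H¹_D` and
`(f, φ) = (u, D² φ)` for all `φ`. -/
def friedrichsGraph : Submodule 𝕜 (Completion X × Completion X) where
  carrier := {p | p.1 ∈ energySpace D ∧
    ∀ φ : X, inner 𝕜 p.2 (φ : Completion X) = inner 𝕜 p.1 (D (D φ) : Completion X)}
  add_mem' := by
    rintro p q ⟨hp, hp'⟩ ⟨hq, hq'⟩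
    exact ⟨add_mem hp hq, fun φ ↦ by
      simp only [Prod.fst_add, Prod.snd_add, inner_add_left, hp', hq']⟩
  zero_mem' := ⟨zero_mem _, fun φ ↦ by simp⟩
  smul_mem' := by
    rintro a p ⟨hp, hp'⟩
    exact ⟨Submodule.smul_mem _ a hp, fun φ ↦ by
      simp only [Prod.smul_fst, Prod.smul_snd, inner_smul_left, hp']⟩

/-- The Friedrichs extension of `D²` for a symmetric operator `D`: the restriction of the adjoint
of `D²` to the form domain `H¹_D`. -/
def friedrichs : Completion X →ₗ.[𝕜] Completion X :=
  (friedrichsGraph D).toLinearPMap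

lemma friedrichsGraph_singleValued (p : Completion X × Completion X)
    (hp : p ∈ friedrichsGraph D) (h : p.1 = 0) : p.2 = 0 := by
  obtain ⟨-, h2⟩ := hp
  have h3 : ∀ v : Completion X, inner 𝕜 p.2 v = 0 := fun v ↦
    Completion.induction_on v (isClosed_eq (by fun_prop) continuous_const)
      fun φ ↦ by rw [h2, h, inner_zero_left]
  exact inner_self_eq_zero.1 (h3 p.2)

lemma friedrichs_graph : (friedrichs D).graph = friedrichsGraph D :=
  Submodule.toLinearPMap_graph_eq _ (friedrichsGraph_singleValued D)

end Friedrichs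

section TestSection

lemma re_inner_eq_real_inner {𝕜 W : Type*} [RCLike 𝕜] [NormedAddCommGroup W]
    [InnerProductSpace ℝ W] [InnerProductSpace 𝕜 W] (v w : W) :
    RCLike.re (inner 𝕜 v w) = inner ℝ v w := by
  rw [re_inner_eq_norm_add_mul_self_sub_norm_mul_self_sub_norm_mul_self_div_two,
    real_inner_eq_norm_add_mul_self_sub_norm_mul_self_sub_norm_mul_self_div_two]

variable {𝕜 : Type*} [RCLike 𝕜]
  {E : Type*} [NormedAddCommGroup E] [NormedSpace ℝ E] [FiniteDimensional ℝ E]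
  {H : Type*} [TopologicalSpace H] {I : ModelWithCorners ℝ E H}
  {M : Type*} [TopologicalSpace M] [ChartedSpace H M] [IsManifold I ∞ M]
  {F : Type*} [NormedAddCommGroup F] [NormedSpace ℝ F] [NormedSpace 𝕜 F] [FiniteDimensional ℝ F]
  {V : M → Type*} [∀ x, NormedAddCommGroup (V x)] [∀ x, InnerProductSpace ℝ (V x)]
  [∀ x, InnerProductSpace 𝕜 (V x)] [TopologicalSpace (TotalSpace F V)] [FiberBundle F V]
  [VectorBundle ℝ F V] [VectorBundle 𝕜 F V] [ContMDiffVectorBundle ∞ F V I]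
  [IsContMDiffRiemannianBundle I ∞ F V]

lemma contMDiff_smul {φ : Π x : M, V x} (a : 𝕜) (hφ : CMDiff ∞ (T% φ)) :
    CMDiff ∞ (T% (a • φ)) := by
  intro x
  have h := (Bundle.contMDiffAt_section x).1 (hφ x)
  refine (Bundle.contMDiffAt_section x).2 ?_
  have hl : ContMDiff 𝓘(ℝ, F) 𝓘(ℝ, F) ∞
      ((a • ContinuousLinearMap.id 𝕜 F).restrictScalars ℝ : F →L[ℝ] F) :=
    ContinuousLinearMap.contMDiff _
  refine (hl.contMDiffAt.comp x h).congr_of_eventuallyEq ?_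
  filter_upwards [(trivializationAt F V x).open_baseSet.mem_nhds
    (FiberBundle.mem_baseSet_trivializationAt' x)] with y hy
  exact ((trivializationAt F V x).linear 𝕜 hy).map_smul a (φ y)

lemma continuous_inner_section {φ ψ : Π x : M, V x} (hφ : CMDiff ∞ (T% φ))
    (hψ : CMDiff ∞ (T% ψ)) : Continuous fun x ↦ inner 𝕜 (φ x) (ψ x) := by
  have key (σ : Π x : M, V x) (hσ : CMDiff ∞ (T% σ)) : Continuous fun x ↦ ‖σ x‖ := by
    have h1 : ContMDiff I 𝓘(ℝ, ℝ) ∞ fun x ↦ inner ℝ (σ x) (σ x) :=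
      ContMDiff.inner_bundle (IB := I) (F := F) (E := V) (b := fun y ↦ y) hσ hσ
    have h2 := Real.continuous_sqrt.comp h1.continuous
    refine h2.congr fun x ↦ ?_
    simp
  have k1 := key _ (hφ.add_section hψ)
  have k2 := key _ (hφ.sub_section hψ)
  have k3 := key _ (hφ.sub_section (contMDiff_smul (RCLike.I : 𝕜) hψ))
  have k4 := key _ (hφ.add_section (contMDiff_smul (RCLike.I : 𝕜) hψ))
  simp only [inner_eq_sum_norm_sq_div_four]
  simp only [Pi.add_apply, Pi.sub_apply, Pi.smul_apply] at k1 k2 k3 k4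
  fun_prop

variable (𝕜 I F V) in
/-- The space of smooth sections with compact support. -/
def testSections : Submodule 𝕜 (Π x : M, V x) where
  carrier := {φ | CMDiff ∞ (T% φ) ∧ IsCompact (closure {x | φ x ≠ 0})}
  add_mem' := by
    rintro φ ψ ⟨hφ, hφ'⟩ ⟨hψ, hψ'⟩
    refine ⟨hφ.add_section hψ, (hφ'.union hψ').of_isClosed_subset isClosed_closure ?_⟩
    rw [← closure_union]
    refine closure_mono fun x hx ↦ ?_
    by_contra h
    simp only [mem_union, mem_ofPred_eq, not_or, not_not] at h
    exact hx (by simp [h.1, h.2])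
  zero_mem' := ⟨contMDiff_zeroSection _ _, by simp⟩
  smul_mem' := by
    rintro a φ ⟨hφ, hφ'⟩
    refine ⟨contMDiff_smul a hφ, hφ'.of_isClosed_subset isClosed_closure (closure_mono ?_)⟩
    intro x hx h
    exact hx (by simp [h])

variable [MeasurableSpace M]

variable (𝕜 I F V) in
/-- The space of smooth sections with compact support, with the `L²` inner product of the
measure `μ`. -/
def TestSection (_μ : Measure M) : Type _ := testSections 𝕜 I F V

variable {μ : Measure M}

instance : AddCommGroup (TestSection 𝕜 I F V μ) :=
  inferInstanceAs (AddCommGroup (testSections 𝕜 I F V))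

instance : Module 𝕜 (TestSection 𝕜 I F V μ) :=
  inferInstanceAs (Module 𝕜 (testSections 𝕜 I F V))

instance : CoeFun (TestSection 𝕜 I F V μ) fun _ ↦ Π x : M, V x := ⟨fun φ ↦ φ.1⟩

variable [BorelSpace M] [IsFiniteMeasureOnCompacts μ]

lemma integrable_inner (φ ψ : TestSection 𝕜 I F V μ) :
    Integrable (fun x ↦ inner 𝕜 (φ x) (ψ x)) μ := by
  refine (continuous_inner_section φ.2.1 ψ.2.1).integrable_of_hasCompactSupport ?_
  refine φ.2.2.of_isClosed_subset isClosed_closure (closure_mono fun x hx h ↦ hx ?_)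
  simp only [h, inner_zero_left]

instance testSectionCore : PreInnerProductSpace.Core 𝕜 (TestSection 𝕜 I F V μ) where
  inner φ ψ := ∫ x, inner 𝕜 (φ x) (ψ x) ∂μ
  conj_inner_symm φ ψ := by
    rw [← integral_conj]
    simp only [inner_conj_symm]
  re_inner_nonneg φ := by
    rw [← integral_re (integrable_inner φ φ)]
    exact integral_nonneg fun x ↦ inner_self_nonneg
  add_left φ ψ χ := by
    rw [← integral_add (integrable_inner φ χ) (integrable_inner ψ χ)]
    exact integral_congr_ae (.of_forall fun x ↦ inner_add_left _ _ _)
  smul_left φ ψ a := by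
    rw [← integral_const_mul]
    exact integral_congr_ae (.of_forall fun x ↦ inner_smul_left _ _ _)

instance : SeminormedAddCommGroup (TestSection 𝕜 I F V μ) :=
  InnerProductSpace.Core.toSeminormedAddCommGroup (𝕜 := 𝕜)

instance : InnerProductSpace 𝕜 (TestSection 𝕜 I F V μ) :=
  InnerProductSpace.ofCore testSectionCore

end TestSection

namespace DiracBundle

section Spectrum

variable {𝕜 : Type*} [RCLike 𝕜]
  {E : Type*} [NormedAddCommGroup E] [NormedSpace ℝ E] [FiniteDimensional ℝ E]
  {H : Type*} [TopologicalSpace H] {I : ModelWithCorners ℝ E H}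
  {M : Type*} [TopologicalSpace M] [ChartedSpace H M] [IsManifold I ∞ M]
  [RiemannianBundle (fun x : M ↦ TangentSpace I x)]
  [IsContMDiffRiemannianBundle I ∞ E (fun x : M ↦ TangentSpace I x)]
  {F : Type*} [NormedAddCommGroup F] [NormedSpace ℝ F] [NormedSpace 𝕜 F] [FiniteDimensional ℝ F]
  {V : M → Type*} [∀ x, NormedAddCommGroup (V x)] [∀ x, InnerProductSpace ℝ (V x)]
  [∀ x, InnerProductSpace 𝕜 (V x)] [TopologicalSpace (TotalSpace F V)] [FiberBundle F V]
  [VectorBundle ℝ F V] [VectorBundle 𝕜 F V] [ContMDiffVectorBundle ∞ F V I]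
  [IsContMDiffRiemannianBundle I ∞ F V]
  [MeasurableSpace M]
  (S : DiracBundle 𝕜 I F V) (μ : Measure M)

/-- The Dirac operator on smooth sections with compact support. -/
def diracTest : TestSection 𝕜 I F V μ →ₗ[𝕜] TestSection 𝕜 I F V μ where
  toFun φ := ⟨S.dirac φ, contMDiff_dirac φ.2.1, by
    refine φ.2.2.of_isClosed_subset isClosed_closure (closure_minimal ?_ isClosed_closure)
    intro x hx
    by_contra h
    refine hx (dirac_eq_zero φ.2.1 ?_)
    filter_upwards [isClosed_closure.isOpen_compl.mem_nhds h] with y hy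
    by_contra h'
    exact hy (subset_closure h')⟩
  map_add' φ ψ := Subtype.ext (dirac_add φ.2.1 ψ.2.1)
  map_smul' a φ := Subtype.ext (dirac_smul a φ.2.1)

variable [BorelSpace M] [IsFiniteMeasureOnCompacts μ]

/-- The spectrum of `D²`, i.e. of the Friedrichs extension of `D²` in the completion of the
space of smooth sections with compact support with respect to the `L²` inner product of `μ`. -/
def spectrumDiracSq : Set 𝕜 := operatorSpectrum (friedrichs (S.diracTest μ))

/-- The Dirac fundamental tone, i.e. the minimum of the spectrum of `D²`. -/
def fundamentalTone : ℝ := sInf {t : ℝ | (t : 𝕜) ∈ S.spectrumDiracSq μ}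

end Spectrum

end DiracBundle

end GenDirac

end

/-!
The proof has an analytic half and a geometric half.

The analytic half is an abstract statement (`friedrichs_spectrum_of_gap`): if `D` is symmetric on
`X` and `c ‖φ‖² ≤ ‖D φ‖²` with `c > 0`, then the closure of `D` is bounded below by `√c`, hence
injective with closed range, and it has a bounded inverse `B` on its range. The Friedrichs extension
of `D²` is then the inverse of the bounded positive operator `T = B B*`. The spectrum of `T` is real
and contains its maximum `‖T‖`, so that the spectrum of `D²` is real with minimum `‖T‖⁻¹ ≥ c`.

The geometric half provides this inequality for `c = n κ / (n - 1)`. The Weitzenböck formula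
`D² = ∇*∇ + 𝒦` (`DiracBundle.dirac_dirac`) gives, up to the divergence of a vector field with
compact support, `⟨D² φ, φ⟩ = ⟨𝒦 φ, φ⟩ + |∇φ|²`. The Cauchy-Schwarz inequality `|D φ|² ≤ n |∇φ|²`
turns this into `n ⟨D² φ, φ⟩ ≥ n κ |φ|² + |D φ|²` (`DiracBundle.inner_dirac_dirac_ge`), and integration
yields `(n - 1) ‖D φ‖² ≥ n κ ‖φ‖²` (`DiracBundle.norm_diracTest_ge`). For `n = 1` this is impossible
for `φ ≠ 0`, and for `n = 0` the endomorphism `𝒦` vanishes, so the hypothesis forces `n ≥ 2`.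

Both the integration and the symmetry of `D` rest on the divergence theorem `integral_divergence`.
It is reduced to a chart by a partition of unity; in a chart, `√g div X = ∑ k, ∂_k (√g X^k)` by the
Koszul formula for the commuting coordinate fields and Jacobi's formula for the derivative of a
determinant (`divergence_mul_sqrt_det`). The local expressions `√g dx` of the volume agree by the
change of variables formula (`riemannianVolume_apply_of_subset`).

The curvature in the definition of `𝒦` is evaluated on sections that are only smooth near a point.
It is compared with the curvature of a global section in `DiracBundle.curvature_extend`, where
tensoriality comes from the skew-symmetry of the curvature (`DiracBundle.curvature_skew`).
-/

noncomputable section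

namespace GenDirac

/-! ### Operators with a bounded positive inverse -/

section Resolvent

variable {𝕜 : Type*} [RCLike 𝕜] {H : Type*} [NormedAddCommGroup H] [InnerProductSpace 𝕜 H]

open ContinuousLinearMap in
lemma mem_resolventSet_of_isUnit {A : H →ₗ.[𝕜] H} {T : H →L[𝕜] H}
    (hT : ∀ u f : H, (u, f) ∈ A.graph ↔ u = T f) {z : 𝕜} (hz : IsUnit (1 - z • T)) :
    z ∈ resolventSet A := by
  obtain ⟨S, hS⟩ := hz
  have h1 (f : H) : (S⁻¹).1 (f - z • T f) = f := by
    have := congrArg (fun L : H →L[𝕜] H ↦ L f) S.inv_mul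
    simpa [hS] using this
  have h2 (f : H) : (S⁻¹).1 f - z • T ((S⁻¹).1 f) = f := by
    have := congrArg (fun L : H →L[𝕜] H ↦ L f) S.mul_inv
    simpa [hS] using this
  refine ⟨T ∘L (S⁻¹).1, fun u ↦ ?_, fun f ↦ ?_⟩
  · have hu : (u : H) = T (A u) := (hT _ _).1 (A.mem_graph u)
    have h := h1 (A u)
    rw [← hu] at h
    rw [comp_apply, h, ← hu]
  · obtain ⟨u, hu1, hu2⟩ := (LinearPMap.mem_graph_iff A).1 ((hT _ _).2 (rfl : T ((S⁻¹).1 f) = _))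
    exact ⟨u, hu1, by rw [hu2, hu1]; exact h2 f⟩

/-- At a point of the resolvent set, `1 - z T` is bounded below. -/
lemma exists_norm_le_of_mem_resolventSet {A : H →ₗ.[𝕜] H} {T : H →L[𝕜] H}
    (hT : ∀ u f : H, (u, f) ∈ A.graph ↔ u = T f) {z : 𝕜} (hz : z ∈ resolventSet A) :
    ∃ C : ℝ, 0 < C ∧ ∀ g : H, ‖g‖ ≤ C * ‖g - z • T g‖ := by
  obtain ⟨R, hR, -⟩ := hz
  refine ⟨1 + ‖z‖ * ‖R‖, by positivity, fun g ↦ ?_⟩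
  obtain ⟨u, hu1, hu2⟩ := (LinearPMap.mem_graph_iff A).1 ((hT _ _).2 (rfl : T g = _))
  have h := hR u
  rw [hu2, hu1] at h
  have e : g = (g - z • T g) + z • R (g - z • T g) := by rw [h]; abel
  calc ‖g‖ ≤ ‖g - z • T g‖ + ‖z • R (g - z • T g)‖ := by
        conv_lhs => rw [e]
        exact norm_add_le _ _
    _ ≤ ‖g - z • T g‖ + ‖z‖ * (‖R‖ * ‖g - z • T g‖) := by
        rw [norm_smul]
        gcongr
        exact R.le_opNorm _
    _ = _ := by ring

variable [CompleteSpace H] {K : Type*} [NormedAddCommGroup K] [InnerProductSpace 𝕜 K]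
  [CompleteSpace K]

open ContinuousLinearMap

/-- Off the half line `[1 / ‖T‖, ∞)`, the operator `1 - z T` with `T = B B*` is coercive, because
`⟨T g, g⟩ / ‖g‖²` stays in the compact interval `[0, ‖T‖]`, on which `1 - z t` has no zero. -/
lemma isUnit_one_sub_smul {B : K →L[𝕜] H} {z : 𝕜}
    (hz : ∀ t : ℝ, 0 ≤ t → t ≤ ‖B ∘L adjoint B‖ → (1 : 𝕜) - z * t ≠ 0) :
    IsUnit (1 - z • (B ∘L adjoint B)) := by
  set T := B ∘L adjoint B
  have hc : ContinuousOn (fun t : ℝ ↦ ‖(1 : 𝕜) - z * t‖) (Icc 0 ‖T‖) := by fun_prop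
  obtain ⟨t₀, ht₀, hmin⟩ := isCompact_Icc.exists_isMinOn ⟨0, by simp⟩ hc
  have hpos : 0 < ‖(1 : 𝕜) - z * t₀‖ := norm_pos_iff.2 (hz t₀ ht₀.1 ht₀.2)
  refine isUnit_of_forall_le_norm_inner_map (𝕜 := 𝕜) _ (c := ⟨_, hpos.le⟩) hpos fun g ↦ ?_
  rcases eq_or_ne g 0 with rfl | hg
  · simp
  have hg' : 0 < ‖g‖ ^ 2 := by positivity
  have hT : inner 𝕜 g (T g) = ((‖adjoint B g‖ ^ 2 : ℝ) : 𝕜) := by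
    change inner 𝕜 g (B (adjoint B g)) = _
    rw [← adjoint_inner_left, inner_self_eq_norm_sq_to_K]
    push_cast
    rfl
  have hle : ‖adjoint B g‖ ^ 2 ≤ ‖T‖ * ‖g‖ ^ 2 := by
    have h1 : ‖inner 𝕜 g (T g)‖ = ‖adjoint B g‖ ^ 2 := by
      rw [hT, RCLike.norm_ofReal, abs_of_nonneg (by positivity)]
    rw [← h1]
    refine (norm_inner_le_norm _ _).trans ?_
    nlinarith [T.le_opNorm g, norm_nonneg g]
  have hm : ‖(1 : 𝕜) - z * t₀‖ ≤ ‖(1 : 𝕜) - z * ((‖adjoint B g‖ ^ 2 / ‖g‖ ^ 2 : ℝ) : 𝕜)‖ :=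
    hmin ⟨by positivity, by rwa [div_le_iff₀ hg']⟩
  have hin : ‖inner 𝕜 ((1 - z • T) g) g‖ =
      ‖g‖ ^ 2 * ‖(1 : 𝕜) - z * ((‖adjoint B g‖ ^ 2 / ‖g‖ ^ 2 : ℝ) : 𝕜)‖ := by
    rw [norm_inner_symm]
    have : inner 𝕜 g ((1 - z • T) g) =
        ((‖g‖ ^ 2 : ℝ) : 𝕜) * ((1 : 𝕜) - z * ((‖adjoint B g‖ ^ 2 / ‖g‖ ^ 2 : ℝ) : 𝕜)) := by
      have hne : ((‖g‖ : ℝ) : 𝕜) ≠ 0 := by simpa using hg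
      have h1 : (1 - z • T) g = g - z • T g := rfl
      rw [h1, inner_sub_right, inner_smul_right, hT, inner_self_eq_norm_sq_to_K]
      push_cast
      field_simp
    rw [this, norm_mul, RCLike.norm_ofReal, abs_of_pos hg']
  rw [hin]
  exact mul_le_mul_of_nonneg_left hm hg'.le

/-- `1 / ‖T‖` is a spectral value of the inverse of `T = B B*`: vectors that almost realize the norm
of `B*` are approximate eigenvectors. -/
lemma inv_norm_notMem_resolventSet {A : H →ₗ.[𝕜] H} {B : K →L[𝕜] H}
    (hT : ∀ u f : H, (u, f) ∈ A.graph ↔ u = (B ∘L adjoint B) f) (h0 : B ∘L adjoint B ≠ 0) :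
    (((‖B ∘L adjoint B‖⁻¹ : ℝ)) : 𝕜) ∉ resolventSet A := by
  intro hz
  obtain ⟨C, hC, hb⟩ := exists_norm_le_of_mem_resolventSet hT hz
  set T := B ∘L adjoint B with hTdef
  have hN : ‖T‖ = ‖adjoint B‖ ^ 2 := by
    have := norm_adjoint_comp_self (adjoint B)
    rw [adjoint_adjoint] at this
    rw [hTdef, this, sq]
  have hNpos : 0 < ‖T‖ := norm_pos_iff.2 h0
  set N := ‖T‖
  have key (g : H) : ‖adjoint B g‖ ^ 2 ≤ (N - N / (2 * C ^ 2)) * ‖g‖ ^ 2 := by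
    have h1 := hb g
    have h2 : ‖g - (((N⁻¹ : ℝ)) : 𝕜) • T g‖ ^ 2 ≤
        2 * ‖g‖ ^ 2 - 2 * N⁻¹ * ‖adjoint B g‖ ^ 2 := by
      have hre : RCLike.re (inner 𝕜 g ((((N⁻¹ : ℝ)) : 𝕜) • T g)) = N⁻¹ * ‖adjoint B g‖ ^ 2 := by
        rw [inner_smul_right, RCLike.re_ofReal_mul]
        change _ * RCLike.re (inner 𝕜 g (B (adjoint B g))) = _
        rw [← adjoint_inner_left, inner_self_eq_norm_sq]
      have hn : ‖(((N⁻¹ : ℝ)) : 𝕜) • T g‖ ≤ ‖g‖ := by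
        rw [norm_smul, RCLike.norm_ofReal, abs_of_pos (inv_pos.2 hNpos), inv_mul_le_iff₀ hNpos]
        exact T.le_opNorm g
      rw [norm_sub_sq (𝕜 := 𝕜), hre]
      have := pow_le_pow_left₀ (norm_nonneg _) hn 2
      linarith
    have h3 : ‖g‖ ^ 2 ≤ C ^ 2 * (2 * ‖g‖ ^ 2 - 2 * N⁻¹ * ‖adjoint B g‖ ^ 2) := by
      calc ‖g‖ ^ 2 ≤ (C * ‖g - (((N⁻¹ : ℝ)) : 𝕜) • T g‖) ^ 2 :=
            pow_le_pow_left₀ (norm_nonneg _) h1 2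
        _ = C ^ 2 * ‖g - (((N⁻¹ : ℝ)) : 𝕜) • T g‖ ^ 2 := by ring
        _ ≤ _ := by gcongr
    have h4 : ‖adjoint B g‖ ^ 2 = N / (2 * C ^ 2) *
        (C ^ 2 * (2 * ‖g‖ ^ 2) - C ^ 2 * (2 * ‖g‖ ^ 2 - 2 * N⁻¹ * ‖adjoint B g‖ ^ 2)) := by
      field_simp
      ring
    rw [h4]
    calc _ ≤ N / (2 * C ^ 2) * (C ^ 2 * (2 * ‖g‖ ^ 2) - ‖g‖ ^ 2) := by gcongr
      _ = _ := by field_simp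
  have hnn : 0 ≤ N - N / (2 * C ^ 2) := by
    obtain ⟨g, hg⟩ : ∃ g : H, g ≠ 0 := by
      by_contra! h
      exact h0 (ContinuousLinearMap.ext fun g ↦ by simp [h g])
    have := (sq_nonneg _).trans (key g)
    exact nonneg_of_mul_nonneg_left this (by positivity)
  have hle : ‖adjoint B‖ ≤ √(N - N / (2 * C ^ 2)) := by
    refine opNorm_le_bound _ (Real.sqrt_nonneg _) fun g ↦ ?_
    refine (Real.le_sqrt (norm_nonneg _) (by positivity)).2 (key g) |>.trans ?_
    rw [Real.sqrt_mul hnn, Real.sqrt_sq (norm_nonneg _)]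
  have h5 : N ≤ N - N / (2 * C ^ 2) := by
    rw [← Real.sq_sqrt hnn]
    conv_lhs => rw [hN]
    exact pow_le_pow_left₀ (norm_nonneg _) hle 2
  have : 0 < N / (2 * C ^ 2) := by positivity
  linarith

/-- The spectrum of an operator with inverse `B B* ≠ 0` lies in `[1 / ‖B B*‖, ∞)` and contains the
end point. -/
lemma isLeast_spectrum_of_inverse {A : H →ₗ.[𝕜] H} {B : K →L[𝕜] H}
    (hT : ∀ u f : H, (u, f) ∈ A.graph ↔ u = (B ∘L adjoint B) f) (h0 : B ∘L adjoint B ≠ 0) :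
    (((‖B ∘L adjoint B‖⁻¹ : ℝ)) : 𝕜) ∈ operatorSpectrum A ∧
      ∀ z ∈ operatorSpectrum A, ∃ t : ℝ, z = t ∧ ‖B ∘L adjoint B‖⁻¹ ≤ t := by
  refine ⟨inv_norm_notMem_resolventSet hT h0, fun z hz ↦ ?_⟩
  by_contra! hcon
  refine hz (mem_resolventSet_of_isUnit hT (isUnit_one_sub_smul fun t ht0 ht1 h ↦ ?_))
  have ht : t ≠ 0 := by
    rintro rfl
    simp at h
  have ht' : 0 < t := lt_of_le_of_ne ht0 ht.symm
  have hzt : z = ((t⁻¹ : ℝ) : 𝕜) := by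
    have : (t : 𝕜) ≠ 0 := by exact_mod_cast ht
    push_cast
    refine eq_inv_of_mul_eq_one_left ?_
    exact (sub_eq_zero.1 h).symm
  exact (hcon _ hzt).not_ge (inv_anti₀ ht' ht1)

end Resolvent

/-! ### The Friedrichs extension of the square of a symmetric operator with a spectral gap -/

section FriedrichsGap

open UniformSpace ContinuousLinearMap

variable {𝕜 : Type*} [RCLike 𝕜] {X : Type*} [SeminormedAddCommGroup X] [InnerProductSpace 𝕜 X]
  {D : X →ₗ[𝕜] X} {c : ℝ}

lemma mem_closedGraph (φ : X) :
    ((φ : Completion X), (D φ : Completion X)) ∈ closedGraph D :=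
  Submodule.le_topologicalClosure _ ⟨φ, rfl⟩

/-- A closed condition on `H × H` holds on the closed graph once it holds on the graph of `D`. -/
lemma closedGraph_induction {P : Completion X × Completion X → Prop} (hP : IsClosed {p | P p})
    (h : ∀ φ : X, P ((φ : Completion X), (D φ : Completion X))) {p : Completion X × Completion X}
    (hp : p ∈ closedGraph D) : P p := by
  have hp' : p ∈ closure (((Completion.toComplL (𝕜 := 𝕜) (E := X)).toLinearMap.prod
    ((Completion.toComplL (𝕜 := 𝕜) (E := X)).toLinearMap ∘ₗ D)).range : Set _) := hp
  refine closure_minimal ?_ hP hp'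
  rintro _ ⟨φ, rfl⟩
  exact h φ

lemma isClosed_closedGraph : IsClosed (closedGraph D : Set (Completion X × Completion X)) :=
  Submodule.isClosed_topologicalClosure _

lemma closedGraph_inner (hD : ∀ φ ψ : X, inner 𝕜 (D φ) ψ = inner 𝕜 φ (D ψ))
    {p : Completion X × Completion X} (hp : p ∈ closedGraph D) (ψ : X) :
    inner 𝕜 p.1 (D ψ : Completion X) = inner 𝕜 p.2 (ψ : Completion X) := by
  refine closedGraph_induction (P := fun p ↦ inner 𝕜 p.1 (D ψ : Completion X) =
    inner 𝕜 p.2 (ψ : Completion X)) ?_ (fun φ ↦ ?_) hp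
  · exact isClosed_eq (by fun_prop) (by fun_prop)
  · simp only [Completion.inner_coe]
    exact (hD φ ψ).symm

lemma closedGraph_norm_le (hgap : ∀ φ : X, c * ‖φ‖ ^ 2 ≤ ‖D φ‖ ^ 2)
    {p : Completion X × Completion X} (hp : p ∈ closedGraph D) :
    c * ‖p.1‖ ^ 2 ≤ ‖p.2‖ ^ 2 := by
  refine closedGraph_induction (P := fun p ↦ c * ‖p.1‖ ^ 2 ≤ ‖p.2‖ ^ 2) ?_ (fun φ ↦ ?_) hp
  · exact isClosed_le (by fun_prop) (by fun_prop)
  · simpa using hgap φ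

/-- The range of the closure of `D` is closed, and the closure of `D` has a bounded inverse on
it. -/
lemma exists_inverse_on_range (hc : 0 < c) (hgap : ∀ φ : X, c * ‖φ‖ ^ 2 ≤ ‖D φ‖ ^ 2) :
    ∃ (K : Submodule 𝕜 (Completion X)) (_ : CompleteSpace K) (B : K →L[𝕜] Completion X),
      (∀ p ∈ closedGraph D, ∃ h : p.2 ∈ K, B ⟨p.2, h⟩ = p.1) ∧
      ∀ k : K, (B k, (k : Completion X)) ∈ closedGraph D := by
  have hcl := isClosed_closedGraph (D := D)
  have : CompleteSpace (closedGraph D) := hcl.completeSpace_coe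
  let π₂ : closedGraph D →L[𝕜] Completion X := snd 𝕜 _ _ ∘L (closedGraph D).subtypeL
  let π₁ : closedGraph D →L[𝕜] Completion X := fst 𝕜 _ _ ∘L (closedGraph D).subtypeL
  have hb (p : closedGraph D) : ‖p‖ ≤ max 1 (√c)⁻¹ * ‖π₂ p‖ := by
    have h1 : ‖p.1.1‖ ≤ (√c)⁻¹ * ‖p.1.2‖ := by
      rw [le_inv_mul_iff₀ (Real.sqrt_pos.2 hc)]
      refine le_of_sq_le_sq ?_ (norm_nonneg _)
      rw [mul_pow, Real.sq_sqrt hc.le]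
      exact closedGraph_norm_le hgap p.2
    change max ‖p.1.1‖ ‖p.1.2‖ ≤ _ * ‖p.1.2‖
    refine max_le (h1.trans ?_) ?_
    · gcongr
      exact le_max_right _ _
    · exact le_mul_of_one_le_left (norm_nonneg _) (le_max_left _ _)
  have hanti : AntilipschitzWith ⟨max 1 (√c)⁻¹, by positivity⟩ π₂ :=
    π₂.antilipschitz_of_bound hb
  have hclr : IsClosed (range π₂) := hanti.isClosed_range π₂.uniformContinuous
  let e := equivRange (f := π₂) hanti.injective hclr
  have hek (p : closedGraph D) : ((e p : _) : Completion X) = p.1.2 := rfl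
  have : CompleteSpace π₂.range := IsClosed.completeSpace_coe (s := (range π₂)) (hs := hclr)
  refine ⟨π₂.range, inferInstance, π₁ ∘L (e.symm : _ →L[𝕜] closedGraph D),
    fun p hp ↦ ?_, fun k ↦ ?_⟩
  · refine ⟨⟨⟨p, hp⟩, rfl⟩, ?_⟩
    have : (⟨p.2, ⟨⟨p, hp⟩, rfl⟩⟩ : π₂.range) = e ⟨p, hp⟩ := rfl
    change π₁ (e.symm _) = _
    rw [this, e.symm_apply_apply]
    rfl
  · have h := hek (e.symm k)
    rw [e.apply_symm_apply] at h
    rw [h]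
    exact (e.symm k).2

/-- The Friedrichs extension of the square of a symmetric operator with `c ‖φ‖² ≤ ‖D φ‖²` is the
inverse of `B B*`, where `B` inverts the closure of `D` on its range. -/
lemma exists_friedrichs_inverse (hD : ∀ φ ψ : X, inner 𝕜 (D φ) ψ = inner 𝕜 φ (D ψ)) (hc : 0 < c)
    (hgap : ∀ φ : X, c * ‖φ‖ ^ 2 ≤ ‖D φ‖ ^ 2) (hne : ∃ φ : X, ‖φ‖ ≠ 0) :
    ∃ (K : Submodule 𝕜 (Completion X)) (_ : CompleteSpace K) (B : K →L[𝕜] Completion X),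
      (∀ u f, (u, f) ∈ (friedrichs D).graph ↔ u = (B ∘L adjoint B) f) ∧
      B ∘L adjoint B ≠ 0 ∧ ‖B ∘L adjoint B‖ ≤ c⁻¹ := by
  obtain ⟨K, hK, B, hB1, hB2⟩ := exists_inverse_on_range hc hgap
  have hadj (f : Completion X) {p : Completion X × Completion X} (hp : p ∈ closedGraph D) :
      inner 𝕜 ((adjoint B f : K) : Completion X) p.2 = inner 𝕜 f p.1 := by
    obtain ⟨h, h'⟩ := hB1 p hp
    rw [← h', ← adjoint_inner_left]
    rfl
  refine ⟨K, hK, B, fun u f ↦ ?_, ?_, ?_⟩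
  · rw [friedrichs_graph]
    constructor
    · rintro ⟨⟨p, hp, rfl⟩, hf⟩
      obtain ⟨h, h'⟩ := hB1 p hp
      have hq : ∀ q ∈ closedGraph D, inner 𝕜 p.2 q.2 = inner 𝕜 f q.1 := by
        intro q hq
        refine closedGraph_induction (P := fun q ↦ inner 𝕜 p.2 q.2 = inner 𝕜 f q.1)
          (isClosed_eq (by fun_prop) (by fun_prop)) (fun φ ↦ ?_) hq
        rw [hf φ]
        exact (closedGraph_inner hD hp (D φ)).symm
      have hk : adjoint B f = ⟨p.2, h⟩ := by
        refine ext_inner_right 𝕜 fun k ↦ ?_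
        change inner 𝕜 ((adjoint B f : K) : Completion X) (k : Completion X) = inner 𝕜 p.2 k
        rw [hadj f (hB2 k), hq _ (hB2 k)]
      change p.1 = B (adjoint B f)
      rw [hk, h']
    · rintro rfl
      have hG := hB2 (adjoint B f)
      refine ⟨⟨_, hG, rfl⟩, fun φ ↦ ?_⟩
      refine Eq.trans ?_ (closedGraph_inner hD hG (D φ)).symm
      exact (hadj f (mem_closedGraph φ)).symm
  · intro h0
    obtain ⟨φ, hφ⟩ := hne
    have hz (f : Completion X) : adjoint B f = 0 := by
      have h1 : inner 𝕜 f ((B ∘L adjoint B) f) = 0 := by simp [h0]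
      rw [comp_apply, ← adjoint_inner_left] at h1
      exact inner_self_eq_zero.1 h1
    have h2 := hadj (φ : Completion X) (mem_closedGraph (D := D) φ)
    rw [hz] at h2
    simp only [ZeroMemClass.coe_zero, inner_zero_left] at h2
    have h3 := inner_self_eq_zero.1 h2.symm
    exact hφ (by rw [← Completion.norm_coe, h3, norm_zero])
  · refine opNorm_le_bound _ (inv_nonneg.2 hc.le) fun f ↦ ?_
    rw [le_inv_mul_iff₀ hc, comp_apply]
    set u := B (adjoint B f) with hu
    rcases eq_or_ne u 0 with h | h
    · simp [h]
    have h1 : c * ‖u‖ ^ 2 ≤ ‖adjoint B f‖ ^ 2 := closedGraph_norm_le hgap (hB2 (adjoint B f))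
    have h2 : ‖adjoint B f‖ ^ 2 ≤ ‖f‖ * ‖u‖ := by
      rw [← inner_self_eq_norm_sq (𝕜 := 𝕜), adjoint_inner_left]
      exact (RCLike.re_le_norm _).trans (norm_inner_le_norm _ _)
    refine le_of_mul_le_mul_right ?_ (norm_pos_iff.2 h)
    nlinarith

/-- A symmetric operator `D` with `c ‖φ‖² ≤ ‖D φ‖²` for some `c > 0`: the spectrum of the Friedrichs
extension of `D²` is real, has a minimum, and this minimum is at least `c`. -/
theorem friedrichs_spectrum_of_gap (hD : ∀ φ ψ : X, inner 𝕜 (D φ) ψ = inner 𝕜 φ (D ψ)) (hc : 0 < c)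
    (hgap : ∀ φ : X, c * ‖φ‖ ^ 2 ≤ ‖D φ‖ ^ 2) (hne : ∃ φ : X, ‖φ‖ ≠ 0) :
    ((sInf {t : ℝ | (t : 𝕜) ∈ operatorSpectrum (friedrichs D)} : ℝ) : 𝕜) ∈
        operatorSpectrum (friedrichs D) ∧
      (∀ z ∈ operatorSpectrum (friedrichs D), ∃ t : ℝ, z = t ∧
        sInf {t : ℝ | (t : 𝕜) ∈ operatorSpectrum (friedrichs D)} ≤ t) ∧
      c ≤ sInf {t : ℝ | (t : 𝕜) ∈ operatorSpectrum (friedrichs D)} := by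
  obtain ⟨K, hK, B, hT, h0, hle⟩ := exists_friedrichs_inverse hD hc hgap hne
  obtain ⟨h1, h2⟩ := isLeast_spectrum_of_inverse hT h0
  have hl : IsLeast {t : ℝ | (t : 𝕜) ∈ operatorSpectrum (friedrichs D)} ‖B ∘L adjoint B‖⁻¹ := by
    refine ⟨h1, fun t ht ↦ ?_⟩
    obtain ⟨s, hs, hs'⟩ := h2 _ ht
    rwa [RCLike.ofReal_inj.1 hs]
  rw [hl.csInf_eq]
  exact ⟨h1, h2, (le_inv_comm₀ hc (norm_pos_iff.2 h0)).2 hle⟩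

end FriedrichsGap

/-! ### Functions and vector fields in charts -/

lemma mvfderiv_congr {E : Type*} [NormedAddCommGroup E] [NormedSpace ℝ E]
    {H : Type*} [TopologicalSpace H] {I : ModelWithCorners ℝ E H}
    {M : Type*} [TopologicalSpace M] [ChartedSpace H M]
    {G : Type*} [NormedAddCommGroup G] [NormedSpace ℝ G] {f g : M → G} {x : M}
    (h : f =ᶠ[𝓝 x] g) : mvfderiv I f x = mvfderiv I g x := by
  ext v
  change (mfderiv I 𝓘(ℝ, G) f x v : G) = mfderiv I 𝓘(ℝ, G) g x v
  exact congrArg (fun L : TangentSpace I x →L[ℝ] G ↦ L v) h.mfderiv_eq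

section Charts

open VectorField

variable {E : Type*} [NormedAddCommGroup E] [NormedSpace ℝ E] [FiniteDimensional ℝ E]
  {H : Type*} [TopologicalSpace H] {I : ModelWithCorners ℝ E H} [I.Boundaryless]
  {M : Type*} [TopologicalSpace M] [ChartedSpace H M] [IsManifold I ∞ M]
  {G : Type*} [NormedAddCommGroup G] [NormedSpace ℝ G]

lemma mdifferentiableAt_extChartAt_symm {p : M} {z : E}
    (hz : z ∈ (extChartAt I p).target) :
    MDiffAt (extChartAt I p).symm z := by
  have h := mdifferentiableWithinAt_extChartAt_symm (I := I) hz
  rwa [ModelWithCorners.range_eq_univ, mdifferentiableWithinAt_univ] at h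

lemma differentiableAt_comp_extChartAt_symm {p : M} {g : M → G} {z : E}
    (hz : z ∈ (extChartAt I p).target) (hg : MDiffAt g ((extChartAt I p).symm z)) :
    DifferentiableAt ℝ (fun y ↦ g ((extChartAt I p).symm y)) z :=
  (hg.comp z (mdifferentiableAt_extChartAt_symm hz)).differentiableAt

lemma fderiv_comp_extChartAt_symm {p : M} {g : M → G} {z : E}
    (hz : z ∈ (extChartAt I p).target) (hg : MDiffAt g ((extChartAt I p).symm z)) (v : E) :
    fderiv ℝ (fun y ↦ g ((extChartAt I p).symm y)) z v =
      mvfderiv I g ((extChartAt I p).symm z) (mfderiv 𝓘(ℝ, E) I (extChartAt I p).symm z v) := by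
  have h := mfderiv_comp_apply z hg (mdifferentiableAt_extChartAt_symm hz) v
  rw [mfderiv_eq_fderiv] at h
  exact h

lemma mdifferentiableAt_of_comp_extChartAt_symm {p x : M} {g : M → G}
    (hx : x ∈ (extChartAt I p).source)
    (hg : DifferentiableAt ℝ (fun y ↦ g ((extChartAt I p).symm y)) (extChartAt I p x)) :
    MDiffAt g x := by
  have h1 := hg.mdifferentiableAt.comp x
    (mdifferentiableAt_extChartAt (I := I) (by rwa [extChartAt_source] at hx))
  refine h1.congr_of_eventuallyEq ?_
  filter_upwards [(isOpen_extChartAt_source p).mem_nhds hx] with y hy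
  exact congrArg g ((extChartAt I p).left_inv hy).symm

/-- The Lie bracket acts on functions as the commutator of derivations. -/
lemma mvfderiv_mlieBracket {x : M} {f : M → G} {X Y : Π x : M, TangentSpace I x}
    (hf : CMDiffAt 2 f x) (hX : MDiffAt (T% X) x) (hY : MDiffAt (T% Y) x) :
    mvfderiv I f x (mlieBracket I X Y x) =
      mvfderiv I (fun y ↦ mvfderiv I f y (Y y)) x (X x) -
        mvfderiv I (fun y ↦ mvfderiv I f y (X y)) x (Y x) := by
  set φ := extChartAt I x with hφ
  have hxs : x ∈ φ.source := mem_extChartAt_source x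
  have hxt : φ x ∈ φ.target := mem_extChartAt_target x
  have hxx : φ.symm (φ x) = x := φ.left_inv hxs
  -- the vector fields and the function in the chart
  let P (Z : Π x : M, TangentSpace I x) : E → E :=
    mpullbackWithin 𝓘(ℝ, E) I φ.symm Z (range I)
  have hP (Z : Π x : M, TangentSpace I x) {y} (hy : y ∈ φ.target) :
      mfderiv 𝓘(ℝ, E) I φ.symm y (P Z y) = Z (φ.symm y) := by
    have h1 := isInvertible_mfderivWithin_extChartAt_symm (I := I) (x := x) hy
    have h2 := h1.self_apply_inverse (Z (φ.symm y))
    rw [← mfderivWithin_univ, ← ModelWithCorners.range_eq_univ (I := I)]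
    exact h2
  have hPd (Z : Π x : M, TangentSpace I x) (hZ : MDiffAt (T% Z) x) :
      DifferentiableAt ℝ (P Z) (φ x) := by
    have := MDifferentiableWithinAt.differentiableWithinAt_mpullbackWithin_vectorField
      (s := univ) (V := Z) (x := x) (I := I) (mdifferentiableWithinAt_univ.2 hZ)
    refine DifferentiableWithinAt.differentiableAt this ?_
    simp [ModelWithCorners.range_eq_univ]
  have hf2 : ContDiffAt ℝ 2 (fun y ↦ f (φ.symm y)) (φ x) := by
    have h1 : ContMDiffAt 𝓘(ℝ, E) I 2 φ.symm (φ x) :=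
      (contMDiffOn_extChartAt_symm (I := I) x).contMDiffAt (extChartAt_target_mem_nhds x)
    exact (ContMDiffAt.comp_of_eq hf h1 hxx).contDiffAt
  have hfe : ∀ᶠ y in 𝓝 (φ x), MDiffAt f (φ.symm y) := by
    have h1 : ∀ᶠ y in 𝓝 x, CMDiffAt 2 f y := (contMDiffAt_iff_contMDiffAt_nhds (by simp)).1 hf
    have h2 : Filter.Tendsto φ.symm (𝓝 (φ x)) (𝓝 x) := by
      have := continuousAt_extChartAt_symm (I := I) x
      rwa [ContinuousAt, extChartAt_to_inv] at this
    exact (h2.eventually h1).mono fun y hy ↦ hy.mdifferentiableAt (by simp)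
  have hdf (Z : Π x : M, TangentSpace I x) : (fun y ↦ mvfderiv I f (φ.symm y) (Z (φ.symm y)))
      =ᶠ[𝓝 (φ x)] fun y ↦ fderiv ℝ (fun y ↦ f (φ.symm y)) y (P Z y) := by
    filter_upwards [hfe, extChartAt_target_mem_nhds (I := I) x] with y hy hyt
    rw [fderiv_comp_extChartAt_symm hyt hy, hP Z hyt]
  have hfd : DifferentiableAt ℝ (fderiv ℝ (fun y ↦ f (φ.symm y))) (φ x) :=
    (hf2.fderiv_right (m := 1) (by norm_num)).differentiableAt (by simp)
  -- the iterated derivative in the chart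
  have hdd (Z W : Π x : M, TangentSpace I x) (hZ : MDiffAt (T% Z) x) :
      fderiv ℝ (fun y ↦ fderiv ℝ (fun y ↦ f (φ.symm y)) y (P Z y)) (φ x) (P W (φ x)) =
        mvfderiv I (fun y ↦ mvfderiv I f y (Z y)) x (W x) := by
    have h1 : DifferentiableAt ℝ (fun y ↦ mvfderiv I f (φ.symm y) (Z (φ.symm y))) (φ x) :=
      (hfd.clm_apply (hPd Z hZ)).congr_of_eventuallyEq (hdf Z)
    have h2 := mdifferentiableAt_of_comp_extChartAt_symm
      (g := fun y ↦ mvfderiv I f y (Z y)) hxs h1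
    rw [← (hdf Z).fderiv_eq]
    refine (fderiv_comp_extChartAt_symm (g := fun y ↦ mvfderiv I f y (Z y))
      hxt (by rwa [hxx]) _).trans ?_
    rw [hP W hxt, hxx]
  have hb : mvfderiv I f x (mlieBracket I X Y x) =
      fderiv ℝ (fun y ↦ f (φ.symm y)) (φ x) (lieBracket ℝ (P X) (P Y) (φ x)) := by
    have h0 : MDiffAt f (φ.symm (φ x)) := by
      rw [hxx]
      exact hf.mdifferentiableAt (by simp)
    have h1 : P (mlieBracket I X Y) (φ x) = lieBracket ℝ (P X) (P Y) (φ x) := by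
      have hs : ContMDiffAt 𝓘(ℝ, E) I 2 φ.symm (φ x) :=
        (contMDiffOn_extChartAt_symm (I := I) x).contMDiffAt (extChartAt_target_mem_nhds x)
      have : IsManifold I (minSmoothness ℝ 2) M := by
        rw [minSmoothness_of_isRCLikeNormedField]
        infer_instance
      have : IsManifold 𝓘(ℝ, E) (minSmoothness ℝ 2) E := by
        rw [minSmoothness_of_isRCLikeNormedField]
        infer_instance
      have h2 := mpullback_mlieBracket (V := X) (W := Y) (I := 𝓘(ℝ, E)) (I' := I)
        (by rwa [hxx]) (by rwa [hxx]) hs (by simp)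
      have h3 (Z) : P Z = mpullback 𝓘(ℝ, E) I φ.symm Z := by
        simp only [P, ModelWithCorners.range_eq_univ, mpullbackWithin_univ]
        rfl
      have h4 := congrFun (lieBracketWithin_univ (𝕜 := ℝ) (V := P X) (W := P Y)) (φ x)
      rw [h3 X, h3 Y] at h4
      rw [h3, h3 X, h3 Y]
      refine h2.trans ?_
      rw [← mlieBracketWithin_univ, mlieBracketWithin_eq_lieBracketWithin]
      exact h4
    rw [← h1, fderiv_comp_extChartAt_symm hxt h0, hP _ hxt, hxx]
  rw [hb, fderiv_apply_lieBracket hf2 (by simp) (hPd Y hY) (hPd X hX), hdd Y X hY, hdd X Y hX]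

end Charts

/-! ### Covariant derivatives -/

section Connection

variable {E : Type*} [NormedAddCommGroup E] [NormedSpace ℝ E]
  {H : Type*} [TopologicalSpace H] {I : ModelWithCorners ℝ E H}
  {M : Type*} [TopologicalSpace M] [ChartedSpace H M]
  {F : Type*} [NormedAddCommGroup F] [NormedSpace ℝ F]
  {V : M → Type*} [∀ x, AddCommGroup (V x)] [∀ x, Module ℝ (V x)] [∀ x, TopologicalSpace (V x)]
  [∀ x, IsTopologicalAddGroup (V x)] [∀ x, ContinuousSMul ℝ (V x)]
  [TopologicalSpace (TotalSpace F V)] [FiberBundle F V] [VectorBundle ℝ F V]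

variable {cov : CovariantDerivative I F V}

lemma cov_congr {σ τ : Π x : M, V x} {x : M} (hσ : MDiffAt (T% σ) x) (hτ : MDiffAt (T% τ) x)
    (h : ∀ᶠ y in 𝓝 x, σ y = τ y) : cov σ x = cov τ x :=
  cov.isCovariantDerivativeOnUniv.congr_of_eventuallyEq hσ hτ (by simp) h

lemma cov_add {σ τ : Π x : M, V x} {x : M} (hσ : MDiffAt (T% σ) x) (hτ : MDiffAt (T% τ) x) :
    cov (fun y ↦ σ y + τ y) x = cov σ x + cov τ x :=
  cov.isCovariantDerivativeOnUniv.add hσ hτ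

lemma cov_smul {σ : Π x : M, V x} {f : M → ℝ} {x : M} (hσ : MDiffAt (T% σ) x) (hf : MDiffAt f x)
    (v : TangentSpace I x) :
    cov (fun y ↦ f y • σ y) x v = f x • cov σ x v + mvfderiv I f x v • σ x := by
  have h := cov.isCovariantDerivativeOnUniv.leibniz hσ hf
  exact congrArg (fun L ↦ L v) h

lemma cov_sum {ι : Type*} {s : Finset ι} {σ : ι → Π x : M, V x} {x : M}
    (hσ : ∀ i, MDiffAt (T% (σ i)) x) :
    cov (fun y ↦ ∑ i ∈ s, σ i y) x = ∑ i ∈ s, cov (σ i) x := by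
  classical
  induction s using Finset.induction_on with
  | empty =>
    simp only [Finset.sum_empty]
    exact congrFun cov.zero x
  | insert a s ha ih =>
    simp only [Finset.sum_insert ha, ← ih]
    exact cov_add (hσ a) (.sum_section fun i _ ↦ hσ i)

end Connection

/-! ### Orthonormal frames and metric identities -/

section Weitzenbock

open VectorField

variable {𝕜 : Type*} [RCLike 𝕜]
  {E : Type*} [NormedAddCommGroup E] [NormedSpace ℝ E] [FiniteDimensional ℝ E]
  {H : Type*} [TopologicalSpace H] {I : ModelWithCorners ℝ E H}
  {M : Type*} [TopologicalSpace M] [ChartedSpace H M] [IsManifold I ∞ M]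
  [RiemannianBundle (fun x : M ↦ TangentSpace I x)]
  [IsContMDiffRiemannianBundle I ∞ E (fun x : M ↦ TangentSpace I x)]
  {F : Type*} [NormedAddCommGroup F] [NormedSpace ℝ F] [NormedSpace 𝕜 F] [FiniteDimensional ℝ F]
  {V : M → Type*} [∀ x, NormedAddCommGroup (V x)] [∀ x, InnerProductSpace ℝ (V x)]
  [∀ x, InnerProductSpace 𝕜 (V x)] [TopologicalSpace (TotalSpace F V)] [FiberBundle F V]
  [VectorBundle ℝ F V] [VectorBundle 𝕜 F V] [ContMDiffVectorBundle ∞ F V I]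
  [IsContMDiffRiemannianBundle I ∞ F V]

lemma exists_local_orthonormal_frame (x : M) :
    ∃ e : Fin (Module.finrank ℝ E) → Π x : M, TangentSpace I x,
      (∀ i, CMDiffAt ∞ (T% (e i)) x) ∧ ∀ᶠ y in 𝓝 x, Orthonormal ℝ fun i ↦ e i y := by
  set t := trivializationAt E (fun x : M ↦ TangentSpace I x) x
  set s := t.localFrame (Module.finBasis ℝ E)
  have hx : x ∈ t.baseSet := FiberBundle.mem_baseSet_trivializationAt' x
  have hs (i) : CMDiffAt ∞ (T% (s i)) x := contMDiffAt_localFrame_of_mem ∞ t _ i hx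
  have hl (y) (hy : y ∈ t.baseSet) : LinearIndependent ℝ fun i ↦ s i y :=
    (t.isLocalFrameOn_localFrame_baseSet I ∞ (Module.finBasis ℝ E)).linearIndependent hy
  have hg := contMDiffAt_gramSchmidt hs (hl x hx)
  let q (i) (y : M) : ℝ := inner ℝ (InnerProductSpace.gramSchmidt ℝ (fun i ↦ s i y) i)
    (InnerProductSpace.gramSchmidt ℝ (fun i ↦ s i y) i)
  have hq (i y) : q i y = ‖InnerProductSpace.gramSchmidt ℝ (fun i ↦ s i y) i‖ ^ 2 :=
    real_inner_self_eq_norm_sq _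
  refine ⟨fun i y ↦ (√(q i y))⁻¹ • InnerProductSpace.gramSchmidt ℝ (fun i ↦ s i y) i,
    fun i ↦ ?_, ?_⟩
  · have h4 : 0 < q i x := real_inner_self_pos.2 (InnerProductSpace.gramSchmidt_ne_zero i (hl x hx))
    have h2 : CMDiffAt ∞ (q i) x := contMDiffAt_inner (hg i) (hg i)
    have h3 : ContDiffAt ℝ ∞ (fun t : ℝ ↦ (√t)⁻¹) (q i x) :=
      (Real.contDiffAt_sqrt h4.ne').inv (Real.sqrt_pos.2 h4).ne'
    exact (h3.contMDiffAt.comp x h2).smul_section (hg i)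
  · filter_upwards [t.open_baseSet.mem_nhds hx] with y hy
    have ho : Orthonormal ℝ (InnerProductSpace.gramSchmidtNormed ℝ fun i ↦ s i y) :=
      InnerProductSpace.gramSchmidtNormed_orthonormal (hl y hy)
    convert ho using 2 with i
    rw [hq, Real.sqrt_sq (norm_nonneg _)]
    rfl

lemma exists_orthonormalBasis_eq {x : M}
    {e : Fin (Module.finrank ℝ E) → TangentSpace I x} (he : Orthonormal ℝ e) :
    ∃ b : OrthonormalBasis (Fin (Module.finrank ℝ E)) ℝ (TangentSpace I x), ∀ i, b i = e i := by
  have hfr : Module.finrank ℝ (TangentSpace I x) = Fintype.card (Fin (Module.finrank ℝ E)) := by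
    rw [Fintype.card_fin]; rfl
  obtain ⟨b, hb⟩ := Orthonormal.exists_orthonormalBasis_extension_of_card_eq
    (ι := Fin (Module.finrank ℝ E)) hfr (v := e) (s := univ) (he.comp _ Subtype.val_injective)
  exact ⟨b, fun i ↦ hb i (mem_univ i)⟩

/-- An infinitesimal rotation of an orthonormal basis does not change the trace of a bilinear
map. -/
lemma sum_skew_eq_zero {W U ι : Type*} [NormedAddCommGroup W] [InnerProductSpace ℝ W]
    [AddCommGroup U] [Module ℝ U] [Fintype ι] (b : OrthonormalBasis ι ℝ W) (w : ι → W)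
    (hw : ∀ i j, inner ℝ (w i) (b j) + inner ℝ (b i) (w j) = 0) (B : W →ₗ[ℝ] W →ₗ[ℝ] U) :
    ∑ i, (B (w i) (b i) + B (b i) (w i)) = 0 := by
  have h1 (i) : B (w i) (b i) = ∑ j, inner ℝ (b j) (w i) • B (b j) (b i) := by
    conv_lhs => rw [← b.sum_repr' (w i)]
    simp
  have h2 (i) : B (b i) (w i) = ∑ j, inner ℝ (b j) (w i) • B (b i) (b j) := by
    conv_lhs => rw [← b.sum_repr' (w i)]
    simp
  simp only [h1, h2, Finset.sum_add_distrib]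
  rw [Finset.sum_comm, ← Finset.sum_add_distrib]
  refine Finset.sum_eq_zero fun i _ ↦ ?_
  rw [← Finset.sum_add_distrib]
  refine Finset.sum_eq_zero fun j _ ↦ ?_
  rw [← add_smul]
  have := hw i j
  rw [real_inner_comm] at this
  rw [add_comm, this, zero_smul]

lemma mdifferentiableAt_inner_section {σ τ : Π x : M, V x} {x : M}
    (hσ : MDiffAt (T% σ) x) (hτ : MDiffAt (T% τ) x) :
    MDiffAt (fun y ↦ inner ℝ (σ y) (τ y)) x :=
  MDifferentiableAt.inner_bundle (IB := I) (F := F) (E := V) (b := fun y ↦ y) hσ hτ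

lemma mdifferentiableAt_smul_section (a : 𝕜) {σ : Π x : M, V x} {x : M}
    (hσ : MDiffAt (T% σ) x) : MDiffAt (T% (a • σ)) x := by
  have h := (mdifferentiableAt_section I σ).1 hσ
  refine (mdifferentiableAt_section I _).2 ?_
  have hl : MDifferentiable 𝓘(ℝ, F) 𝓘(ℝ, F)
      ((a • ContinuousLinearMap.id 𝕜 F).restrictScalars ℝ : F →L[ℝ] F) :=
    ContinuousLinearMap.mdifferentiable _
  refine ((hl _).comp x h).congr_of_eventuallyEq ?_
  filter_upwards [(trivializationAt F V x).open_baseSet.mem_nhds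
    (FiberBundle.mem_baseSet_trivializationAt' x)] with y hy
  exact ((trivializationAt F V x).linear 𝕜 hy).map_smul a (σ y)

lemma mdifferentiableAt_inner_section' {σ τ : Π x : M, V x} {x : M}
    (hσ : MDiffAt (T% σ) x) (hτ : MDiffAt (T% τ) x) :
    MDifferentiableAt I 𝓘(ℝ, 𝕜) (fun y ↦ inner 𝕜 (σ y) (τ y)) x := by
  have h1 := mdifferentiableAt_inner_section hσ hτ
  have h2 := mdifferentiableAt_inner_section
    (mdifferentiableAt_smul_section (RCLike.I : 𝕜) hσ) hτ
  have h3 : (fun y ↦ inner 𝕜 (σ y) (τ y)) = fun y ↦ inner ℝ (σ y) (τ y) • (1 : 𝕜) +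
      inner ℝ ((RCLike.I : 𝕜) • σ y) (τ y) • (RCLike.I : 𝕜) := by
    funext y
    rw [← re_inner_eq_real_inner (𝕜 := 𝕜), ← re_inner_eq_real_inner (𝕜 := 𝕜), inner_smul_left]
    simp only [RCLike.conj_I, RCLike.real_smul_eq_coe_mul]
    conv_lhs => rw [← RCLike.re_add_im (inner 𝕜 (σ y) (τ y))]
    simp
  rw [h3]
  exact (h1.smul mdifferentiableAt_const).add (h2.smul mdifferentiableAt_const)

namespace DiracBundle

variable (S : DiracBundle 𝕜 I F V)

lemma conn_metric_real {σ τ : Π x : M, V x} {x : M} (hσ : MDiffAt (T% σ) x)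
    (hτ : MDiffAt (T% τ) x) (X : TangentSpace I x) :
    mvfderiv I (fun y ↦ inner ℝ (σ y) (τ y)) x X
      = inner ℝ (S.conn σ x X) (τ x) + inner ℝ (σ x) (S.conn τ x X) := by
  have h := S.conn_metric σ τ x X hσ hτ
  have h1 : (fun y ↦ inner ℝ (σ y) (τ y)) =
      (RCLike.reCLM : 𝕜 →L[ℝ] ℝ) ∘ fun y ↦ inner 𝕜 (σ y) (τ y) := by
    funext y
    exact (re_inner_eq_real_inner (𝕜 := 𝕜) _ _).symm
  have h2 := mfderiv_comp_apply (I := I) (I' := 𝓘(ℝ, 𝕜)) (I'' := 𝓘(ℝ, ℝ)) x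
    (g := (RCLike.reCLM : 𝕜 →L[ℝ] ℝ)) (f := fun y ↦ inner 𝕜 (σ y) (τ y))
    (RCLike.reCLM : 𝕜 →L[ℝ] ℝ).differentiableAt.mdifferentiableAt
    (mdifferentiableAt_inner_section' hσ hτ) X
  rw [← re_inner_eq_real_inner (𝕜 := 𝕜), ← re_inner_eq_real_inner (𝕜 := 𝕜), ← map_add, ← h, h1]
  refine h2.trans ?_
  rw [ContinuousLinearMap.mfderiv_eq]
  rfl

lemma clifford_skew_real (x : M) (X : TangentSpace I x) (v w : V x) :
    inner ℝ (S.clifford x X v) w = -inner ℝ v (S.clifford x X w) := by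
  have h := congrArg RCLike.re (S.clifford_skew x X v w)
  rwa [map_neg, re_inner_eq_real_inner, re_inner_eq_real_inner] at h

lemma clifford_self (x : M) (X : TangentSpace I x) (v : V x) :
    S.clifford x X (S.clifford x X v) = -(‖X‖ ^ 2 • v) := by
  have h := S.clifford_relation x X X v
  rw [real_inner_self_eq_norm_sq, ← two_smul ℝ (S.clifford x X _), mul_smul, ← smul_add] at h
  exact eq_neg_of_add_eq_zero_left ((smul_eq_zero.1 h).resolve_left two_ne_zero)

end DiracBundle

end Weitzenbock

/-! ### The Weitzenböck formula -/

section Hessian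
open VectorField
variable {𝕜 : Type*} [RCLike 𝕜]
  {E : Type*} [NormedAddCommGroup E] [NormedSpace ℝ E] [FiniteDimensional ℝ E]
  {H : Type*} [TopologicalSpace H] {I : ModelWithCorners ℝ E H}
  {M : Type*} [TopologicalSpace M] [ChartedSpace H M] [IsManifold I ∞ M]
  [RiemannianBundle (fun x : M ↦ TangentSpace I x)]
  [IsContMDiffRiemannianBundle I ∞ E (fun x : M ↦ TangentSpace I x)]
  {F : Type*} [NormedAddCommGroup F] [NormedSpace ℝ F] [NormedSpace 𝕜 F] [FiniteDimensional ℝ F]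
  {V : M → Type*} [∀ x, NormedAddCommGroup (V x)] [∀ x, InnerProductSpace ℝ (V x)]
  [∀ x, InnerProductSpace 𝕜 (V x)] [TopologicalSpace (TotalSpace F V)] [FiberBundle F V]
  [VectorBundle ℝ F V] [VectorBundle 𝕜 F V] [ContMDiffVectorBundle ∞ F V I]
  [IsContMDiffRiemannianBundle I ∞ F V]

namespace DiracBundle

variable (S : DiracBundle 𝕜 I F V)

lemma mdifferentiableAt_conn {φ : Π x : M, V x} (hφ : CMDiff ∞ (T% φ)) {x : M}
    {Y : Π x : M, TangentSpace I x} (hY : MDiffAt (T% Y) x) :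
    MDiffAt (T% (fun y ↦ S.conn φ y (Y y))) x :=
  ((contMDiff_conn_section hφ x).mdifferentiableAt (by simp)).clm_bundle_apply hY

lemma mdifferentiableAt_clifford {σ : Π x : M, V x} {x : M} {Y : Π x : M, TangentSpace I x}
    (hY : MDiffAt (T% Y) x) (hσ : MDiffAt (T% σ) x) :
    MDiffAt (T% (fun y ↦ S.clifford y (Y y) (σ y))) x :=
  (((S.contMDiff_clifford x).mdifferentiableAt (by simp)).clm_bundle_apply hY).clm_bundle_apply hσ

lemma hessian_tensorial {φ : Π x : M, V x} (hφ : CMDiff ∞ (T% φ)) (x : M) (v : TangentSpace I x) :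
    TensorialAt I E (fun Y ↦ S.conn (fun y ↦ S.conn φ y (Y y)) x v -
      S.conn φ x (leviCivita I M Y x v)) x where
  smul {f Y} hf hY := by
    have h1 := cov_smul (cov := S.conn) (S.mdifferentiableAt_conn hφ hY) hf v
    have h2 := cov_smul (cov := leviCivita I M) hY hf v
    simp only [← map_smul] at h1
    have h3 : leviCivita I M (f • Y) x v =
      f x • leviCivita I M Y x v + mvfderiv I f x v • Y x := h2
    have h4 : S.conn (fun y ↦ S.conn φ y ((f • Y) y)) x v = _ := h1
    rw [h3, h4, map_add, map_smul, map_smul, smul_sub, map_smul]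
    abel
  add {Y Y'} hY hY' := by
    have h1 := cov_add (cov := S.conn) (S.mdifferentiableAt_conn hφ hY)
      (S.mdifferentiableAt_conn hφ hY')
    have h2 : leviCivita I M (Y + Y') x = leviCivita I M Y x + leviCivita I M Y' x :=
      cov_add (cov := leviCivita I M) hY hY'
    have h3 : S.conn (fun y ↦ S.conn φ y ((Y + Y') y)) x =
        S.conn (fun y ↦ S.conn φ y (Y y)) x + S.conn (fun y ↦ S.conn φ y (Y' y)) x := by
      rw [← h1]
      simp only [Pi.add_apply, map_add]
    rw [h2, h3]
    simp only [_root_.add_apply, map_add]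
    abel

/-- The second covariant derivative `∇²_{v, w} φ = ∇_v ∇_W φ - ∇_{∇_v W} φ`, where `W` is any
vector field extending `w`. -/
def hessian {φ : Π x : M, V x} (hφ : CMDiff ∞ (T% φ)) (x : M) :
    TangentSpace I x →ₗ[ℝ] TangentSpace I x →ₗ[ℝ] V x :=
  LinearMap.mk₂ ℝ (fun v w ↦ TensorialAt.mkHom _ x (S.hessian_tensorial hφ x v) w)
    (fun v v' w ↦ by
      simp only [TensorialAt.mkHom_apply_eq_extend, map_add]
      abel)
    (fun a v w ↦ by simp only [TensorialAt.mkHom_apply_eq_extend, map_smul, smul_sub])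
    (fun v w w' ↦ map_add _ _ _)
    (fun a v w ↦ map_smul _ _ _)

lemma hessian_apply {φ : Π x : M, V x} (hφ : CMDiff ∞ (T% φ)) {x : M} (v : TangentSpace I x)
    {Y : Π x : M, TangentSpace I x} (hY : MDiffAt (T% Y) x) :
    S.hessian hφ x v (Y x) =
      S.conn (fun y ↦ S.conn φ y (Y y)) x v - S.conn φ x (leviCivita I M Y x v) :=
  TensorialAt.mkHom_apply (S.hessian_tensorial hφ x v) hY

/-- The curvature is the antisymmetric part of the second covariant derivative, since the
Levi-Civita connection has no torsion. -/
lemma curvature_eq_hessian_sub {φ : Π x : M, V x} (hφ : CMDiff ∞ (T% φ)) {x : M}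
    {X Y : Π x : M, TangentSpace I x} (hX : MDiffAt (T% X) x) (hY : MDiffAt (T% Y) x) :
    S.curvature X Y φ x = S.hessian hφ x (X x) (Y x) - S.hessian hφ x (Y x) (X x) := by
  have ht : leviCivita I M Y x (X x) - leviCivita I M X x (Y x) = mlieBracket I X Y x :=
    ((leviCivita I M).torsion_eq_zero_iff).1 leviCivita_torsion hX hY
  rw [S.hessian_apply hφ _ hY, S.hessian_apply hφ _ hX, curvature, ← ht, map_sub]
  abel

/-- The curvature is skew-symmetric, because second derivatives of `⟨φ, ψ⟩` commute up to the Lie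
bracket. -/
lemma curvature_skew [I.Boundaryless] {φ ψ : Π x : M, V x} (hφ : CMDiff ∞ (T% φ))
    (hψ : CMDiff ∞ (T% ψ)) {x : M} {X Y : Π x : M, TangentSpace I x}
    (hX : MDiffAt (T% X) x) (hY : MDiffAt (T% Y) x) :
    inner ℝ (S.curvature X Y φ x) (ψ x) = -inner ℝ (φ x) (S.curvature X Y ψ x) := by
  have hφ' (y) : MDiffAt (T% φ) y := (hφ y).mdifferentiableAt (by simp)
  have hψ' (y) : MDiffAt (T% ψ) y := (hψ y).mdifferentiableAt (by simp)
  have hf : ContMDiffAt I 𝓘(ℝ, ℝ) 2 (fun y ↦ inner ℝ (φ y) (ψ y)) x :=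
    (ContMDiffAt.inner_bundle (IB := I) (F := F) (E := V) (b := fun y ↦ y) (hφ x) (hψ x)).of_le
      ENat.LEInfty.out
  have h1 (Z : Π x : M, TangentSpace I x) :
      (fun y ↦ mvfderiv I (fun y ↦ inner ℝ (φ y) (ψ y)) y (Z y)) =
        fun y ↦ inner ℝ (S.conn φ y (Z y)) (ψ y) + inner ℝ (φ y) (S.conn ψ y (Z y)) :=
    funext fun y ↦ S.conn_metric_real (hφ' y) (hψ' y) _
  have h2 (Z : Π x : M, TangentSpace I x) (hZ : MDiffAt (T% Z) x) (v : TangentSpace I x) :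
      mvfderiv I (fun y ↦ mvfderiv I (fun y ↦ inner ℝ (φ y) (ψ y)) y (Z y)) x v =
        inner ℝ (S.conn (fun y ↦ S.conn φ y (Z y)) x v) (ψ x) +
          inner ℝ (S.conn φ x (Z x)) (S.conn ψ x v) + (inner ℝ (S.conn φ x v) (S.conn ψ x (Z x)) +
            inner ℝ (φ x) (S.conn (fun y ↦ S.conn ψ y (Z y)) x v)) := by
    have k1 := S.mdifferentiableAt_conn hφ hZ
    have k2 := S.mdifferentiableAt_conn hψ hZ
    rw [h1, mvfderiv_fun_add (mdifferentiableAt_inner_section k1 (hψ' x))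
      (mdifferentiableAt_inner_section (hφ' x) k2), _root_.add_apply,
      S.conn_metric_real k1 (hψ' x), S.conn_metric_real (hφ' x) k2]
  have h3 := mvfderiv_mlieBracket hf hX hY
  rw [h2 Y hY, h2 X hX, S.conn_metric_real (hφ' x) (hψ' x)] at h3
  simp only [curvature, inner_sub_left, inner_sub_right]
  linarith

end DiracBundle

lemma exists_smooth_extension [T2Space M] {x : M} (v : V x) :
    ∃ σ : Π x : M, V x, CMDiff ∞ (T% σ) ∧ (∀ᶠ y in 𝓝 x, σ y = FiberBundle.extend F v y) ∧
      IsCompact (closure {y | σ y ≠ 0}) := by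
  obtain ⟨s, hs, hsm⟩ := FiberBundle.exists_contMDiffOn_extend (k := ∞) I F v
  obtain ⟨f, -, hf⟩ := (SmoothBumpFunction.nhds_basis_tsupport (I := I) x).mem_iff.1
    (interior_mem_nhds.2 hs)
  refine ⟨fun y ↦ f y • FiberBundle.extend F v y, ?_, ?_, ?_⟩
  · exact ContMDiffOn.smul_section_of_tsupport f.contMDiff.contMDiffOn isOpen_interior hf
      (hsm.mono interior_subset)
  · filter_upwards [f.eventuallyEq_one] with y hy
    rw [hy, Pi.one_apply, one_smul]
  · refine f.hasCompactSupport.isCompact.of_isClosed_subset isClosed_closure (closure_mono ?_)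
    intro y hy h
    exact hy (by simp only [h, zero_smul])

namespace DiracBundle

variable (S : DiracBundle 𝕜 I F V)

/-- The curvature is a local operator. -/
lemma curvature_congr {φ ψ : Π x : M, V x} (hφ : CMDiff ∞ (T% φ)) {x : M}
    (h : ∀ᶠ y in 𝓝 x, φ y = ψ y) {X Y : Π x : M, TangentSpace I x}
    (hX : MDiffAt (T% X) x) (hY : MDiffAt (T% Y) x) :
    S.curvature X Y φ x = S.curvature X Y ψ x := by
  have hφ' (y) : MDiffAt (T% φ) y := (hφ y).mdifferentiableAt (by simp)
  have hc : ∀ᶠ y in 𝓝 x, S.conn φ y = S.conn ψ y := by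
    filter_upwards [h.eventually_nhds] with y hy
    refine cov_congr (hφ' y) ((hφ' y).congr_of_eventuallyEq ?_) hy
    filter_upwards [hy] with z hz
    rw [hz]
  have hcc (Z : Π x : M, TangentSpace I x) (hZ : MDiffAt (T% Z) x) :
      S.conn (fun y ↦ S.conn φ y (Z y)) x = S.conn (fun y ↦ S.conn ψ y (Z y)) x := by
    refine cov_congr (S.mdifferentiableAt_conn hφ hZ)
      ((S.mdifferentiableAt_conn hφ hZ).congr_of_eventuallyEq ?_) ?_
    · filter_upwards [hc] with y hy
      rw [hy]
    · filter_upwards [hc] with y hy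
      rw [hy]
  rw [curvature, curvature, hcc Y hY, hcc X hX, hc.self_of_nhds]

/-- The curvature `R(X, Y) φ` at `x` only depends on the value of `φ` at `x`. -/
lemma curvature_extend [T2Space M] [I.Boundaryless] {φ : Π x : M, V x} (hφ : CMDiff ∞ (T% φ))
    {x : M} {X Y : Π x : M, TangentSpace I x} (hX : MDiffAt (T% X) x) (hY : MDiffAt (T% Y) x) :
    S.curvature X Y (FiberBundle.extend F (φ x)) x = S.curvature X Y φ x := by
  obtain ⟨σ, hσ, hσe, -⟩ := exists_smooth_extension (I := I) (F := F) (φ x)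
  rw [← S.curvature_congr hσ hσe hX hY]
  refine ext_inner_right ℝ fun w ↦ ?_
  obtain ⟨τ, hτ, hτe, -⟩ := exists_smooth_extension (I := I) (F := F) w
  have h1 : τ x = w := by rw [hτe.self_of_nhds, FiberBundle.extend_apply_self]
  have h2 : σ x = φ x := by rw [hσe.self_of_nhds, FiberBundle.extend_apply_self]
  rw [← h1, S.curvature_skew hσ hτ hX hY, S.curvature_skew hφ hτ hX hY, h2]

/-- The connection commutes with the sum over an orthonormal frame in the Dirac operator. -/
lemma conn_dirac {φ : Π x : M, V x} (hφ : CMDiff ∞ (T% φ)) {x : M} {ι : Type*} [Fintype ι]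
    (b : OrthonormalBasis ι ℝ (TangentSpace I x)) (v : TangentSpace I x) :
    S.conn (S.dirac φ) x v = ∑ j, S.clifford x (b j) (S.hessian hφ x v (b j)) := by
  obtain ⟨e, hes, heo⟩ := exists_local_orthonormal_frame (I := I) x
  have he (i) := (hes i).mdifferentiableAt (by simp)
  obtain ⟨c, hc⟩ := exists_orthonormalBasis_eq heo.self_of_nhds
  have hD : ∀ᶠ y in 𝓝 x, S.dirac φ y = ∑ i, S.clifford y (e i y) (S.conn φ y (e i y)) := by
    filter_upwards [heo] with y hy
    obtain ⟨b, hb⟩ := exists_orthonormalBasis_eq hy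
    rw [S.dirac_eq_of_orthonormalBasis b]
    simp only [hb]
  have hm (i) : MDiffAt (T% (fun y ↦ S.clifford y (e i y) (S.conn φ y (e i y)))) x :=
    S.mdifferentiableAt_clifford (he i) (S.mdifferentiableAt_conn hφ (he i))
  have hd : MDiffAt (T% (S.dirac φ)) x := (contMDiff_dirac hφ x).mdifferentiableAt (by simp)
  rw [cov_congr hd (.sum_section fun i _ ↦ hm i) hD, cov_sum hm, _root_.sum_apply]
  have hskew (i j) : inner ℝ (leviCivita I M (e i) x v) (c j) +
      inner ℝ (c i) (leviCivita I M (e j) x v) = 0 := by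
    have h1 := leviCivita_metric (FiberBundle.mdifferentiableAt_extend I E v) (he i) (he j)
    rw [FiberBundle.extend_apply_self] at h1
    rw [hc, hc, ← h1]
    have h0 : (fun y ↦ inner ℝ (e i y) (e j y)) =ᶠ[𝓝 x] fun _ ↦ if i = j then (1 : ℝ) else 0 := by
      filter_upwards [heo] with y hy
      exact orthonormal_iff_ite.1 hy i j
    rw [mvfderiv_congr h0, mvfderiv_const, _root_.zero_apply]
  have h0 := sum_skew_eq_zero c (fun i ↦ leviCivita I M (e i) x v) hskew
    (LinearMap.mk₂ ℝ (fun X Y ↦ S.clifford x X (S.conn φ x Y)) (by simp) (by simp) (by simp)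
      (by simp))
  have hB := sum_orthonormalBasis_eq b c
    (LinearMap.mk₂ ℝ (fun X Y ↦ S.clifford x X (S.hessian hφ x v Y)) (by simp) (by simp) (by simp)
      (by simp))
  simp only [LinearMap.mk₂_apply] at h0 hB
  rw [hB, ← add_zero (∑ j, S.clifford x (c j) _), ← h0, ← Finset.sum_add_distrib]
  refine Finset.sum_congr rfl fun i _ ↦ ?_
  rw [S.product_rule _ _ x v (he i) (S.mdifferentiableAt_conn hφ (he i)), hc,
    S.hessian_apply hφ v (he i), map_sub]
  abel

/-- The Weitzenböck formula `D² = ∇*∇ + 𝒦`. -/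
lemma dirac_dirac [T2Space M] [I.Boundaryless] {φ : Π x : M, V x} (hφ : CMDiff ∞ (T% φ)) (x : M) :
    S.dirac (S.dirac φ) x = S.curvatureEndomorphism x (φ x) -
      ∑ i, S.hessian hφ x (stdOrthonormalBasis ℝ (TangentSpace I x) i)
        (stdOrthonormalBasis ℝ (TangentSpace I x) i) := by
  set b := stdOrthonormalBasis ℝ (TangentSpace I x)
  set c := fun i ↦ S.clifford x (b i)
  set h := fun i j ↦ S.hessian hφ x (b i) (b j)
  have h1 : S.dirac (S.dirac φ) x = ∑ i, ∑ j, c i (c j (h i j)) := by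
    rw [S.dirac_eq_of_orthonormalBasis b]
    refine Finset.sum_congr rfl fun i _ ↦ ?_
    rw [S.conn_dirac hφ b, map_sum]
  have h2 : S.curvatureEndomorphism x (φ x) =
      (1 / 2 : ℝ) • ∑ i, ∑ j, c i (c j (h i j - h j i)) := by
    rw [curvatureEndomorphism]
    congr 1
    refine Finset.sum_congr rfl fun i _ ↦ Finset.sum_congr rfl fun j _ ↦ ?_
    have hi := FiberBundle.mdifferentiableAt_extend I E (V := fun x : M ↦ TangentSpace I x) (b i)
    have hj := FiberBundle.mdifferentiableAt_extend I E (V := fun x : M ↦ TangentSpace I x) (b j)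
    rw [S.curvature_extend hφ hi hj, S.curvature_eq_hessian_sub hφ hi hj,
      FiberBundle.extend_apply_self, FiberBundle.extend_apply_self]
  have h3 : ∑ i, ∑ j, c i (c j (h j i)) =
      -(∑ i, ∑ j, c i (c j (h i j))) - (2 : ℝ) • ∑ i, h i i := by
    rw [Finset.sum_comm, Finset.smul_sum, ← Finset.sum_neg_distrib, ← Finset.sum_sub_distrib]
    refine Finset.sum_congr rfl fun i _ ↦ ?_
    have h4 (j) : c j (c i (h i j)) = -c i (c j (h i j)) -
        (2 : ℝ) • (if i = j then h i j else 0) := by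
      have h5 : c i (c j (h i j)) + c j (c i (h i j)) +
          (2 * inner ℝ (b i) (b j) : ℝ) • h i j = 0 := S.clifford_relation x (b i) (b j) (h i j)
      rw [orthonormal_iff_ite.1 b.orthonormal i j] at h5
      have h6 : ((2 * if i = j then (1 : ℝ) else 0) • h i j) =
          (2 : ℝ) • (if i = j then h i j else 0) := by split_ifs <;> simp
      rw [h6] at h5
      rw [eq_sub_iff_add_eq, eq_neg_iff_add_eq_zero]
      refine Eq.trans ?_ h5
      abel
    simp only [h4, Finset.sum_sub_distrib, Finset.sum_neg_distrib, ← Finset.smul_sum,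
      Finset.sum_ite_eq, Finset.mem_univ, if_true]
  rw [h1, h2]
  simp only [map_sub, Finset.sum_sub_distrib, h3]
  module

end DiracBundle

end Hessian

/-! ### The divergence of a vector field -/

section Divergence

variable {𝕜 : Type*} [RCLike 𝕜]
  {E : Type*} [NormedAddCommGroup E] [NormedSpace ℝ E] [FiniteDimensional ℝ E]
  {H : Type*} [TopologicalSpace H] {I : ModelWithCorners ℝ E H}
  {M : Type*} [TopologicalSpace M] [ChartedSpace H M] [IsManifold I ∞ M]
  [RiemannianBundle (fun x : M ↦ TangentSpace I x)]
  [IsContMDiffRiemannianBundle I ∞ E (fun x : M ↦ TangentSpace I x)]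
  {F : Type*} [NormedAddCommGroup F] [NormedSpace ℝ F] [NormedSpace 𝕜 F] [FiniteDimensional ℝ F]
  {V : M → Type*} [∀ x, NormedAddCommGroup (V x)] [∀ x, InnerProductSpace ℝ (V x)]
  [∀ x, InnerProductSpace 𝕜 (V x)] [TopologicalSpace (TotalSpace F V)] [FiberBundle F V]
  [VectorBundle ℝ F V] [VectorBundle 𝕜 F V] [ContMDiffVectorBundle ∞ F V I]
  [IsContMDiffRiemannianBundle I ∞ F V]

/-- The divergence of a vector field: the trace of its covariant derivative. -/
def divergence (X : Π x : M, TangentSpace I x) (x : M) : ℝ :=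
  ∑ j, inner ℝ (leviCivita I M X x (stdOrthonormalBasis ℝ (TangentSpace I x) j))
    (stdOrthonormalBasis ℝ (TangentSpace I x) j)

/-- The vector field dual to a `1`-form with respect to the Riemannian metric. -/
def sharp (α : Π x : M, TangentSpace I x →ₗ[ℝ] ℝ) (x : M) : TangentSpace I x :=
  ∑ j, α x (stdOrthonormalBasis ℝ (TangentSpace I x) j) •
    stdOrthonormalBasis ℝ (TangentSpace I x) j

lemma inner_sharp (α : Π x : M, TangentSpace I x →ₗ[ℝ] ℝ) (x : M) (v : TangentSpace I x) :
    inner ℝ (sharp α x) v = α x v := by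
  conv_rhs => rw [← (stdOrthonormalBasis ℝ (TangentSpace I x)).sum_repr' v]
  simp only [sharp, sum_inner, inner_smul_left, RCLike.conj_to_real, map_sum, map_smul,
    smul_eq_mul, mul_comm]

/-- The dual vector field does not depend on the orthonormal basis. -/
lemma sharp_eq_of_orthonormalBasis {ι : Type*} [Fintype ι] (α : Π x : M, TangentSpace I x →ₗ[ℝ] ℝ)
    {x : M} (b : OrthonormalBasis ι ℝ (TangentSpace I x)) :
    sharp α x = ∑ j, α x (b j) • b j := by
  refine ext_inner_right ℝ fun v ↦ ?_
  rw [inner_sharp]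
  conv_lhs => rw [← b.sum_repr' v]
  simp only [sum_inner, inner_smul_left, RCLike.conj_to_real, map_sum, map_smul, smul_eq_mul,
    mul_comm]

/-- The smoothness of a `1`-form is expressed by its values on smooth vector fields. -/
lemma contMDiff_sharp {α : Π x : M, TangentSpace I x →ₗ[ℝ] ℝ}
    (hα : ∀ (x : M) (Y : Π x : M, TangentSpace I x), CMDiffAt ∞ (T% Y) x →
      CMDiffAt ∞ (fun y ↦ α y (Y y)) x) : CMDiff ∞ (T% (sharp α)) := by
  intro x
  obtain ⟨e, he, heo⟩ := exists_local_orthonormal_frame (I := I) x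
  refine (ContMDiffAt.sum_section (s := Finset.univ) fun i _ ↦
    (hα x (e i) (he i)).smul_section (he i)).congr_of_eventuallyEq ?_
  filter_upwards [heo] with y hy
  obtain ⟨b, hb⟩ := exists_orthonormalBasis_eq hy
  refine congrArg (TotalSpace.mk y) ?_
  rw [sharp_eq_of_orthonormalBasis α b]
  simp only [hb]
  rfl

/-- The divergence of the vector field dual to `α` is `∑ j, e_j (α(E_j)) - α(∇_{e_j} E_j)`, where
the `E_j` extend an orthonormal basis `e_j`. -/
lemma divergence_sharp {α : Π x : M, TangentSpace I x →ₗ[ℝ] ℝ}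
    (hα : ∀ (x : M) (Y : Π x : M, TangentSpace I x), CMDiffAt ∞ (T% Y) x →
      CMDiffAt ∞ (fun y ↦ α y (Y y)) x) (x : M) :
    divergence (sharp α) x = ∑ j,
      (mvfderiv I
        (fun y ↦ α y (FiberBundle.extend E (stdOrthonormalBasis ℝ (TangentSpace I x) j) y)) x
        (stdOrthonormalBasis ℝ (TangentSpace I x) j) -
      α x (leviCivita I M (FiberBundle.extend E (stdOrthonormalBasis ℝ (TangentSpace I x) j)) x
        (stdOrthonormalBasis ℝ (TangentSpace I x) j))) := by
  refine Finset.sum_congr rfl fun j _ ↦ ?_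
  set v := stdOrthonormalBasis ℝ (TangentSpace I x) j
  have he := FiberBundle.mdifferentiableAt_extend I E (V := fun x : M ↦ TangentSpace I x) v
  have h := leviCivita_metric he ((contMDiff_sharp hα x).mdifferentiableAt (by simp)) he
  simp only [inner_sharp, FiberBundle.extend_apply_self] at h
  linarith

lemma contMDiffAt_inner_section {σ τ : Π x : M, V x} {x : M}
    (hσ : CMDiffAt ∞ (T% σ) x) (hτ : CMDiffAt ∞ (T% τ) x) :
    CMDiffAt ∞ (fun y ↦ inner ℝ (σ y) (τ y)) x :=
  ContMDiffAt.inner_bundle (IB := I) (F := F) (E := V) (b := fun y ↦ y) hσ hτ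

namespace DiracBundle

variable (S : DiracBundle 𝕜 I F V)

/-- The `1`-form `X ↦ ⟨X · φ, ψ⟩`. -/
def cliffordForm (φ ψ : Π x : M, V x) (x : M) : TangentSpace I x →ₗ[ℝ] ℝ where
  toFun X := inner ℝ (S.clifford x X (φ x)) (ψ x)
  map_add' X Y := by simp only [map_add, _root_.add_apply, inner_add_left]
  map_smul' a X := by simp [inner_smul_left]

/-- The `1`-form `X ↦ ⟨∇_X φ, ψ⟩`. -/
def connForm (φ ψ : Π x : M, V x) (x : M) : TangentSpace I x →ₗ[ℝ] ℝ where
  toFun X := inner ℝ (S.conn φ x X) (ψ x)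
  map_add' X Y := by simp only [map_add, inner_add_left]
  map_smul' a X := by simp [inner_smul_left]

variable {S} {φ ψ : Π x : M, V x}

lemma contMDiffAt_cliffordForm (hφ : CMDiff ∞ (T% φ)) (hψ : CMDiff ∞ (T% ψ)) (x : M)
    (Y : Π x : M, TangentSpace I x) (hY : CMDiffAt ∞ (T% Y) x) :
    CMDiffAt ∞ (fun y ↦ S.cliffordForm φ ψ y (Y y)) x :=
  contMDiffAt_inner_section
    (((S.contMDiff_clifford x).clm_bundle_apply hY).clm_bundle_apply (hφ x)) (hψ x)

lemma contMDiffAt_connForm (hφ : CMDiff ∞ (T% φ)) (hψ : CMDiff ∞ (T% ψ)) (x : M)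
    (Y : Π x : M, TangentSpace I x) (hY : CMDiffAt ∞ (T% Y) x) :
    CMDiffAt ∞ (fun y ↦ S.connForm φ ψ y (Y y)) x :=
  contMDiffAt_inner_section ((contMDiff_conn_section hφ x).clm_bundle_apply hY) (hψ x)

/-- The Dirac operator is formally self-adjoint. -/
lemma divergence_cliffordForm (hφ : CMDiff ∞ (T% φ)) (hψ : CMDiff ∞ (T% ψ)) (x : M) :
    divergence (sharp (S.cliffordForm φ ψ)) x =
      inner ℝ (S.dirac φ x) (ψ x) - inner ℝ (φ x) (S.dirac ψ x) := by
  rw [divergence_sharp (contMDiffAt_cliffordForm hφ hψ), dirac, dirac, sum_inner, inner_sum,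
    ← Finset.sum_sub_distrib]
  refine Finset.sum_congr rfl fun j _ ↦ ?_
  set v := stdOrthonormalBasis ℝ (TangentSpace I x) j
  have he := FiberBundle.mdifferentiableAt_extend I E (V := fun x : M ↦ TangentSpace I x) v
  have hφ' : MDiffAt (T% φ) x := (hφ x).mdifferentiableAt (by simp)
  have hψ' : MDiffAt (T% ψ) x := (hψ x).mdifferentiableAt (by simp)
  have h := S.conn_metric_real (S.mdifferentiableAt_clifford he hφ') hψ' v
  rw [S.product_rule _ _ x v he hφ', FiberBundle.extend_apply_self, inner_add_left,
    S.clifford_skew_real x v (φ x)] at h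
  change mvfderiv I (fun y ↦ inner ℝ (S.clifford y (FiberBundle.extend E v y) (φ y)) (ψ y)) x v -
    inner ℝ (S.clifford x (leviCivita I M (FiberBundle.extend E v) x v) (φ x)) (ψ x) = _
  rw [h]
  ring

/-- The divergence of `X ↦ ⟨∇_X φ, φ⟩` is `⟨tr ∇² φ, φ⟩ + |∇ φ|²`. -/
lemma divergence_connForm (hφ : CMDiff ∞ (T% φ)) (x : M) :
    divergence (sharp (S.connForm φ φ)) x =
      ∑ j, (inner ℝ (S.hessian hφ x (stdOrthonormalBasis ℝ (TangentSpace I x) j)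
        (stdOrthonormalBasis ℝ (TangentSpace I x) j)) (φ x) +
          ‖S.conn φ x (stdOrthonormalBasis ℝ (TangentSpace I x) j)‖ ^ 2) := by
  rw [divergence_sharp (contMDiffAt_connForm hφ hφ)]
  refine Finset.sum_congr rfl fun j _ ↦ ?_
  set v := stdOrthonormalBasis ℝ (TangentSpace I x) j
  have he := FiberBundle.mdifferentiableAt_extend I E (V := fun x : M ↦ TangentSpace I x) v
  have hφ' : MDiffAt (T% φ) x := (hφ x).mdifferentiableAt (by simp)
  have h := S.conn_metric_real (S.mdifferentiableAt_conn hφ he) hφ' v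
  have h2 := S.hessian_apply hφ v he
  rw [FiberBundle.extend_apply_self] at h2
  rw [FiberBundle.extend_apply_self, real_inner_self_eq_norm_sq] at h
  change mvfderiv I (fun y ↦ inner ℝ (S.conn φ y (FiberBundle.extend E v y)) (φ y)) x v -
    inner ℝ (S.conn φ x (leviCivita I M (FiberBundle.extend E v) x v)) (φ x) = _
  rw [h, h2, inner_sub_left]
  ring

lemma norm_clifford (x : M) (X : TangentSpace I x) (v : V x) :
    ‖S.clifford x X v‖ = ‖X‖ * ‖v‖ := by
  rw [← sq_eq_sq₀ (norm_nonneg _) (by positivity), ← real_inner_self_eq_norm_sq,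
    S.clifford_skew_real, S.clifford_self, inner_neg_right, inner_smul_right,
    real_inner_self_eq_norm_sq]
  ring

lemma norm_dirac_sq_le (φ : Π x : M, V x) (x : M) :
    ‖S.dirac φ x‖ ^ 2 ≤ Module.finrank ℝ E *
      ∑ j, ‖S.conn φ x (stdOrthonormalBasis ℝ (TangentSpace I x) j)‖ ^ 2 := by
  have h1 : ‖S.dirac φ x‖ ≤ ∑ j, ‖S.conn φ x (stdOrthonormalBasis ℝ (TangentSpace I x) j)‖ := by
    refine (norm_sum_le _ _).trans (Finset.sum_le_sum fun j _ ↦ ?_)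
    rw [norm_clifford, OrthonormalBasis.norm_eq_one, one_mul]
  refine (pow_le_pow_left₀ (norm_nonneg _) h1 2).trans ?_
  refine (sq_sum_le_card_mul_sum_sq).trans (le_of_eq ?_)
  rw [Finset.card_univ, Fintype.card_fin]
  rfl

/-- Up to a divergence, `|D φ|²` is bounded below by `⟨𝒦 φ, φ⟩ + |D φ|² / n`: this combines the
Weitzenböck formula with the Cauchy-Schwarz inequality `|D φ|² ≤ n |∇ φ|²`. -/
lemma inner_dirac_dirac_ge [T2Space M] [I.Boundaryless] {κ : ℝ}
    (hK : ∀ (x : M) (v : V x), κ * ‖v‖ ^ 2 ≤ inner ℝ (S.curvatureEndomorphism x v) v)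
    (hφ : CMDiff ∞ (T% φ)) (x : M) :
    Module.finrank ℝ E * (κ * ‖φ x‖ ^ 2) + ‖S.dirac φ x‖ ^ 2 ≤ Module.finrank ℝ E *
      (inner ℝ (S.dirac (S.dirac φ) x) (φ x) + divergence (sharp (S.connForm φ φ)) x) := by
  rw [divergence_connForm hφ, S.dirac_dirac hφ, inner_sub_left, sum_inner, Finset.sum_add_distrib]
  have h1 := mul_le_mul_of_nonneg_left (hK x (φ x)) (Nat.cast_nonneg (Module.finrank ℝ E))
  have h2 := norm_dirac_sq_le (S := S) φ x
  linarith

end DiracBundle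

end Divergence

/-! ### Gram determinants -/

section Gram

/-- The trace of a bilinear map, in a basis that need not be orthonormal. -/
lemma sum_orthonormalBasis_eq_sum_gram_inv {W U ι κ : Type*} [NormedAddCommGroup W]
    [InnerProductSpace ℝ W] [AddCommGroup U] [Module ℝ U] [Fintype ι] [DecidableEq ι] [Fintype κ]
    (b : OrthonormalBasis κ ℝ W) (v : Module.Basis ι ℝ W) (B : W →ₗ[ℝ] W →ₗ[ℝ] U) :
    ∑ j, B (b j) (b j) = ∑ i, ∑ l, (Matrix.gram ℝ v)⁻¹ i l • B (v i) (v l) := by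
  have hG : IsUnit (Matrix.gram ℝ v).det :=
    (Matrix.posDef_gram_of_linearIndependent v.linearIndependent).det_pos.ne'.isUnit
  -- the dual basis
  let d (i : ι) : W := ∑ l, (Matrix.gram ℝ v)⁻¹ i l • v l
  have hd (i k) : inner ℝ (d i) (v k) = if i = k then (1 : ℝ) else 0 := by
    have h := congrFun (congrFun (Matrix.nonsing_inv_mul _ hG) i) k
    rw [Matrix.mul_apply, Matrix.one_apply] at h
    rw [← h, sum_inner]
    exact Finset.sum_congr rfl fun l _ ↦ inner_smul_left _ _ _
  have hw (w : W) : ∑ i, inner ℝ (d i) w • v i = w := by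
    have h : (∑ i, (innerₗ W (d i)).smulRight (v i)) = LinearMap.id := by
      refine v.ext fun k ↦ ?_
      simp [hd]
    have h2 := congrArg (fun L ↦ L w) h
    simpa using h2
  calc ∑ j, B (b j) (b j) = ∑ j, ∑ i, inner ℝ (d i) (b j) • B (v i) (b j) := by
        refine Finset.sum_congr rfl fun j _ ↦ ?_
        have h := congrArg (fun w ↦ B w (b j)) (hw (b j))
        simpa only [map_sum, map_smul, LinearMap.sum_apply, LinearMap.smul_apply] using h.symm
    _ = ∑ i, B (v i) (∑ j, inner ℝ (b j) (d i) • b j) := by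
        rw [Finset.sum_comm]
        simp only [map_sum, map_smul, real_inner_comm]
    _ = _ := by
        refine Finset.sum_congr rfl fun i _ ↦ ?_
        rw [b.sum_repr' (d i)]
        simp only [d, map_sum, map_smul]

variable {E ι : Type*} [NormedAddCommGroup E] [NormedSpace ℝ E] [Fintype ι] [DecidableEq ι]

lemma hasFDerivAt_det {A : E → Matrix ι ι ℝ} {y : E}
    (hA : ∀ i j, DifferentiableAt ℝ (fun z ↦ A z i j) y) :
    HasFDerivAt (fun z ↦ (A z).det)
      (∑ i, ∑ j, (A y).adjugate j i • fderiv ℝ (fun z ↦ A z i j) y) y := by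
  let D : ContinuousMultilinearMap ℝ (fun _ : ι ↦ ι → ℝ) ℝ :=
    { (Matrix.detRowAlternating (n := ι) (R := ℝ)).toMultilinearMap with
      cont := Continuous.matrix_det (A := fun M : Matrix ι ι ℝ ↦ M) continuous_id }
  have h1 : HasFDerivAt (fun z i j ↦ A z i j)
      (ContinuousLinearMap.pi fun i ↦ ContinuousLinearMap.pi fun j ↦
        fderiv ℝ (fun z ↦ A z i j) y) y :=
    hasFDerivAt_pi.2 fun i ↦ hasFDerivAt_pi.2 fun j ↦ (hA i j).hasFDerivAt
  have h2 := (D.hasFDerivAt (fun i j ↦ A y i j)).comp y h1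
  refine h2.congr_fderiv ?_
  ext w
  simp only [ContinuousLinearMap.comp_apply, ContinuousMultilinearMap.linearDeriv_apply,
    ContinuousLinearMap.coe_pi', _root_.sum_apply, _root_.smul_apply, smul_eq_mul]
  refine Finset.sum_congr rfl fun i _ ↦ ?_
  have h3 : D (Function.update (fun i j ↦ A y i j) i fun j ↦ fderiv ℝ (fun z ↦ A z i j) y w) =
      ((A y).updateRow i fun j ↦ fderiv ℝ (fun z ↦ A z i j) y w).det := rfl
  rw [h3, ← Matrix.cramer_transpose_apply, Matrix.cramer_eq_adjugate_mulVec, Matrix.mulVec,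
    dotProduct, ← Matrix.adjugate_transpose]
  rfl

/-- Jacobi's formula for the square root of a determinant. -/
lemma fderiv_sqrt_det {A : E → Matrix ι ι ℝ} {y : E}
    (hA : ∀ i j, DifferentiableAt ℝ (fun z ↦ A z i j) y) (hpos : 0 < (A y).det) (w : E) :
    fderiv ℝ (fun z ↦ √(A z).det) y w =
      (1 / 2) * (∑ i, ∑ j, (A y)⁻¹ j i * fderiv ℝ (fun z ↦ A z i j) y w) * √(A y).det := by
  rw [((hasFDerivAt_det hA).sqrt hpos.ne').fderiv]
  have h1 (i j) : (A y).adjugate j i = (A y).det * (A y)⁻¹ j i := by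
    rw [Matrix.inv_def, Ring.inverse_eq_inv', Matrix.smul_apply, smul_eq_mul,
      mul_inv_cancel_left₀ hpos.ne']
  simp only [_root_.sum_apply, _root_.smul_apply, smul_eq_mul, h1, mul_assoc, ← Finset.mul_sum]
  have h2 := Real.mul_self_sqrt hpos.le
  have h3 := (Real.sqrt_pos.2 hpos).ne'
  generalize (∑ i, ∑ j, (A y)⁻¹ j i * fderiv ℝ (fun z ↦ A z i j) y w) = s
  field_simp
  rw [sq, h2]

end Gram

/-! ### The divergence in a chart -/

section ChartFrame

open VectorField

variable {E : Type*} [NormedAddCommGroup E] [NormedSpace ℝ E] [FiniteDimensional ℝ E]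
  {H : Type*} [TopologicalSpace H] {I : ModelWithCorners ℝ E H}
  {M : Type*} [TopologicalSpace M] [ChartedSpace H M] [IsManifold I ∞ M]
  {ι : Type*} [Fintype ι] (β : Module.Basis ι ℝ E)

/-- The `i`-th coordinate vector field of the chart at `p`, for coordinates given by a basis of
the model space. -/
def chartFrame (p : M) (i : ι) : Π x : M, TangentSpace I x :=
  (trivializationAt E (fun x : M ↦ TangentSpace I x) p).localFrame β i

/-- The `i`-th coordinate of a vector field in the chart at `p`. -/
def chartCoeff (p : M) (X : Π x : M, TangentSpace I x) (i : ι) (x : M) : ℝ :=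
  (trivializationAt E (fun x : M ↦ TangentSpace I x) p).localFrameCoeff I β i x (X x)

lemma mem_baseSet_of_mem_source {p x : M} (hx : x ∈ (extChartAt I p).source) :
    x ∈ (trivializationAt E (fun x : M ↦ TangentSpace I x) p).baseSet := by
  rw [extChartAt_source] at hx
  exact hx

lemma contMDiffAt_chartFrame {p x : M} (hx : x ∈ (extChartAt I p).source) (i : ι) :
    CMDiffAt ∞ (T% (chartFrame (I := I) β p i)) x :=
  contMDiffAt_localFrame_of_mem ∞ (trivializationAt E (fun x : M ↦ TangentSpace I x) p) β i
    (mem_baseSet_of_mem_source hx)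

lemma eq_sum_chartFrame {p x : M} (hx : x ∈ (extChartAt I p).source)
    (X : Π x : M, TangentSpace I x) :
    X x = ∑ i, chartCoeff β p X i x • chartFrame β p i x :=
  Trivialization.eq_sum_localFrameCoeff_smul (mem_baseSet_of_mem_source hx)

lemma contMDiffAt_chartCoeff {p x : M} (hx : x ∈ (extChartAt I p).source)
    {X : Π x : M, TangentSpace I x} (hX : CMDiffAt ∞ (T% X) x) (i : ι) :
    CMDiffAt ∞ (chartCoeff β p X i) x :=
  contMDiffAt_localFrameCoeff β (mem_baseSet_of_mem_source hx) hX i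

lemma exists_basis_eq_chartFrame {p x : M} (hx : x ∈ (extChartAt I p).source) :
    ∃ v : Module.Basis ι ℝ (TangentSpace I x), ∀ i, v i = chartFrame β p i x :=
  ⟨Trivialization.basisAt _ β (mem_baseSet_of_mem_source hx), fun _ ↦
    (Trivialization.localFrame_apply_of_mem_baseSet _ _ (mem_baseSet_of_mem_source hx)).symm⟩

variable [I.Boundaryless]

lemma chartFrame_eq_mfderiv {p : M} {y : E} (hy : y ∈ (extChartAt I p).target) (i : ι) :
    chartFrame β p i ((extChartAt I p).symm y) =
      mfderiv 𝓘(ℝ, E) I (extChartAt I p).symm y (β i) := by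
  have hx := (extChartAt I p).map_target hy
  have hb := mem_baseSet_of_mem_source hx
  rw [extChartAt_source] at hx
  have h := TangentBundle.symmL_trivializationAt (I := I) hx
  rw [(extChartAt I p).right_inv hy] at h
  have h2 := congrArg (fun f ↦ f (β i)) h
  simp only [ModelWithCorners.range_eq_univ, mfderivWithin_univ] at h2
  refine Eq.trans ?_ h2
  rw [chartFrame, Trivialization.localFrame_apply_of_mem_baseSet _ _ hb, Trivialization.basisAt,
    Module.Basis.map_apply]
  erw [Trivialization.symmL_apply, Trivialization.linearEquivAt_symm_apply]
  exact hb

lemma mvfderiv_chartFrame {G : Type*} [NormedAddCommGroup G] [NormedSpace ℝ G] {p : M} {y : E}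
    (hy : y ∈ (extChartAt I p).target) {g : M → G}
    (hg : MDiffAt g ((extChartAt I p).symm y)) (i : ι) :
    mvfderiv I g ((extChartAt I p).symm y) (chartFrame β p i ((extChartAt I p).symm y)) =
      fderiv ℝ (fun z ↦ g ((extChartAt I p).symm z)) y (β i) := by
  rw [fderiv_comp_extChartAt_symm hy hg, chartFrame_eq_mfderiv β hy]

lemma mvfderiv_extChartAt_chartFrame {p x : M} (hx : x ∈ (extChartAt I p).source) (i : ι) :
    mvfderiv I (extChartAt I p) x (chartFrame β p i x) = β i := by
  have hy := (extChartAt I p).map_source hx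
  have hxx := (extChartAt I p).left_inv hx
  have hd : MDiffAt (extChartAt I p) ((extChartAt I p).symm (extChartAt I p x)) := by
    rw [hxx]
    exact mdifferentiableAt_extChartAt (by rwa [extChartAt_source] at hx)
  have h := mvfderiv_chartFrame β hy hd i
  rw [hxx] at h
  have h2 : (fun z ↦ extChartAt I p ((extChartAt I p).symm z)) =ᶠ[𝓝 (extChartAt I p x)] id := by
    filter_upwards [(isOpen_extChartAt_target p).mem_nhds hy] with z hz
    exact (extChartAt I p).right_inv hz
  rw [h, h2.fderiv_eq, fderiv_id]
  rfl

/-- Coordinate vector fields commute. -/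
lemma mlieBracket_chartFrame {p x : M} (hx : x ∈ (extChartAt I p).source) (i j : ι) :
    mlieBracket I (chartFrame β p i) (chartFrame β p j) x = 0 := by
  have hc (k : ι) : (fun z ↦ mvfderiv I (extChartAt I p) z (chartFrame β p k z)) =ᶠ[𝓝 x]
      fun _ ↦ β k := by
    filter_upwards [(isOpen_extChartAt_source p).mem_nhds hx] with z hz
    exact mvfderiv_extChartAt_chartFrame β hz k
  have hf : CMDiffAt 2 (extChartAt I p) x :=
    contMDiffAt_extChartAt' (by rwa [extChartAt_source] at hx)
  have h := mvfderiv_mlieBracket hf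
    ((contMDiffAt_chartFrame β hx i).mdifferentiableAt (by simp))
    ((contMDiffAt_chartFrame β hx j).mdifferentiableAt (by simp))
  rw [mvfderiv_congr (hc j), mvfderiv_congr (hc i), mvfderiv_const, mvfderiv_const] at h
  simp only [_root_.zero_apply, sub_zero] at h
  obtain ⟨v, hv⟩ := exists_basis_eq_chartFrame (I := I) β hx
  have h2 (w : TangentSpace I x) (hw : mvfderiv I (extChartAt I p) x w = 0) : w = 0 := by
    rw [← v.sum_repr w] at hw ⊢
    simp only [map_sum, map_smul, hv, mvfderiv_extChartAt_chartFrame β hx] at hw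
    have h3 := Fintype.linearIndependent_iff.1 β.linearIndependent _ hw
    simp [h3]
  exact h2 _ h

variable [RiemannianBundle (fun x : M ↦ TangentSpace I x)]
  [IsContMDiffRiemannianBundle I ∞ E (fun x : M ↦ TangentSpace I x)]

lemma divergence_congr {X Y : Π x : M, TangentSpace I x} {x : M} (hX : MDiffAt (T% X) x)
    (hY : MDiffAt (T% Y) x) (h : ∀ᶠ y in 𝓝 x, X y = Y y) : divergence X x = divergence Y x := by
  simp only [divergence, cov_congr (cov := leviCivita I M) hX hY h]

lemma divergence_sum {κ : Type*} {s : Finset κ} {X : κ → Π x : M, TangentSpace I x} {x : M}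
    (hX : ∀ i, MDiffAt (T% (X i)) x) :
    divergence (fun y ↦ ∑ i ∈ s, X i y) x = ∑ i ∈ s, divergence (X i) x := by
  simp only [divergence, cov_sum (cov := leviCivita I M) hX, _root_.sum_apply, sum_inner]
  rw [Finset.sum_comm]

lemma divergence_smul {f : M → ℝ} {X : Π x : M, TangentSpace I x} {x : M} (hf : MDiffAt f x)
    (hX : MDiffAt (T% X) x) :
    divergence (fun y ↦ f y • X y) x = f x * divergence X x + mvfderiv I f x (X x) := by
  simp only [divergence, cov_smul (cov := leviCivita I M) hX hf, inner_add_left, inner_smul_left,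
    Finset.sum_add_distrib, Finset.mul_sum, RCLike.conj_to_real]
  congr 1
  conv_rhs => rw [← (stdOrthonormalBasis ℝ (TangentSpace I x)).sum_repr' (X x)]
  simp only [map_sum, map_smul, smul_eq_mul, real_inner_comm, mul_comm]

/-- The Gram matrix of the coordinate vector fields. -/
def chartGram (p x : M) : Matrix ι ι ℝ :=
  Matrix.gram ℝ fun i ↦ chartFrame (I := I) β p i x

lemma contMDiffAt_chartGram {p x : M} (hx : x ∈ (extChartAt I p).source) (i j : ι) :
    CMDiffAt ∞ (fun z ↦ chartGram (I := I) β p z i j) x :=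
  contMDiffAt_inner (contMDiffAt_chartFrame β hx i) (contMDiffAt_chartFrame β hx j)

variable [DecidableEq ι]

lemma det_chartGram_pos {p x : M} (hx : x ∈ (extChartAt I p).source) :
    0 < (chartGram (I := I) β p x).det := by
  obtain ⟨v, hv⟩ := exists_basis_eq_chartFrame (I := I) β hx
  have h := (Matrix.posDef_gram_of_linearIndependent v.linearIndependent).det_pos
  rwa [show ⇑v = _ from funext hv] at h

/-- The divergence of a coordinate vector field is the logarithmic derivative of the volume
density. -/
lemma divergence_chartFrame {p : M} {y : E} (hy : y ∈ (extChartAt I p).target) (k : ι) :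
    divergence (chartFrame (I := I) β p k) ((extChartAt I p).symm y) *
        √(chartGram (I := I) β p ((extChartAt I p).symm y)).det =
      fderiv ℝ (fun z ↦ √(chartGram (I := I) β p ((extChartAt I p).symm z)).det) y (β k) := by
  set x := (extChartAt I p).symm y with hxy
  have hx : x ∈ (extChartAt I p).source := (extChartAt I p).map_target hy
  have hm (i) : MDiffAt (T% (chartFrame (I := I) β p i)) x :=
    (contMDiffAt_chartFrame β hx i).mdifferentiableAt (by simp)
  have hG (i j) : MDiffAt (fun z ↦ chartGram (I := I) β p z i j) x :=
    (contMDiffAt_chartGram β hx i j).mdifferentiableAt (by simp)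
  rw [fderiv_sqrt_det (A := fun z ↦ chartGram (I := I) β p ((extChartAt I p).symm z))
    (fun i j ↦ differentiableAt_comp_extChartAt_symm hy (hG i j)) (det_chartGram_pos β hx)]
  congr 1
  obtain ⟨v, hv⟩ := exists_basis_eq_chartFrame (I := I) β hx
  have h1 := sum_orthonormalBasis_eq_sum_gram_inv (stdOrthonormalBasis ℝ (TangentSpace I x)) v
    (LinearMap.mk₂ ℝ (fun X Y ↦ inner ℝ (leviCivita I M (chartFrame (I := I) β p k) x X) Y)
      (by simp [inner_add_left]) (by simp [inner_smul_left]) (by simp [inner_add_right])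
      (by simp [inner_smul_right]))
  rw [show ⇑v = _ from funext hv] at h1
  simp only [LinearMap.mk₂_apply] at h1
  set g := chartGram (I := I) β p x with hg
  set d : ι → ι → ι → ℝ := fun i j l ↦ mvfderiv I (fun z ↦ chartGram (I := I) β p z i j) x
    (chartFrame (I := I) β p l x)
  have hd (i j l) : d i j l =
      fderiv ℝ (fun z ↦ chartGram (I := I) β p ((extChartAt I p).symm z) i j) y (β l) :=
    mvfderiv_chartFrame β hy (hG i j) l
  have hd' (i j l) : d i j l = d j i l := by
    simp only [d, chartGram, Matrix.gram_apply, real_inner_comm]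
  have hg' (i l) : g⁻¹ i l = g⁻¹ l i := by
    have hs : g.transpose = g := by
      ext i j
      exact real_inner_comm (chartFrame (I := I) β p i x) (chartFrame (I := I) β p j x)
    conv_lhs => rw [← hs, ← Matrix.transpose_nonsing_inv, Matrix.transpose_apply]
  have hk (i l) : inner ℝ (leviCivita I M (chartFrame (I := I) β p k) x
      (chartFrame (I := I) β p i x)) (chartFrame (I := I) β p l x) =
        (1 / 2) * (d k l i + d i l k - d i k l) := by
    refine (inner_leviCivitaFun (hm k) (hm i) (hm l)).trans ?_
    simp only [koszul, mlieBracket_chartFrame β hx, inner_zero_left, add_zero, sub_zero]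
    rfl
  refine h1.trans ?_
  simp only [← hd]
  have h2 : ∑ i, ∑ l, g⁻¹ i l * d k l i = ∑ i, ∑ l, g⁻¹ i l * d i k l := by
    rw [Finset.sum_comm]
    refine Finset.sum_congr rfl fun i _ ↦ Finset.sum_congr rfl fun l _ ↦ ?_
    rw [hg', hd']
  calc _ = ∑ i, ∑ l, (1 / 2) * (g⁻¹ i l * d k l i + g⁻¹ i l * d i l k - g⁻¹ i l * d i k l) := by
        refine Finset.sum_congr rfl fun i _ ↦ Finset.sum_congr rfl fun l _ ↦ ?_
        rw [hk, smul_eq_mul]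
        change g⁻¹ i l * _ = _
        ring
    _ = _ := by
        simp only [← Finset.mul_sum, Finset.sum_sub_distrib, Finset.sum_add_distrib, h2]
        simp only [hg' _ _, add_sub_cancel_left]

/-- The divergence of a vector field in a chart. -/
lemma divergence_mul_sqrt_det {p : M} {y : E} (hy : y ∈ (extChartAt I p).target)
    {X : Π x : M, TangentSpace I x} (hX : CMDiff ∞ (T% X)) :
    divergence X ((extChartAt I p).symm y) *
        √(chartGram (I := I) β p ((extChartAt I p).symm y)).det =
      ∑ k, fderiv ℝ (fun z ↦ chartCoeff β p X k ((extChartAt I p).symm z) *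
        √(chartGram (I := I) β p ((extChartAt I p).symm z)).det) y (β k) := by
  set x := (extChartAt I p).symm y with hxy
  have hx : x ∈ (extChartAt I p).source := (extChartAt I p).map_target hy
  have hm (i) : MDiffAt (T% (chartFrame (I := I) β p i)) x :=
    (contMDiffAt_chartFrame β hx i).mdifferentiableAt (by simp)
  have hc (k) : MDiffAt (chartCoeff β p X k) x :=
    (contMDiffAt_chartCoeff β hx (hX x) k).mdifferentiableAt (by simp)
  have hG (i j) : MDiffAt (fun z ↦ chartGram (I := I) β p z i j) x :=
    (contMDiffAt_chartGram β hx i j).mdifferentiableAt (by simp)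
  have hsd : DifferentiableAt ℝ
      (fun z ↦ √(chartGram (I := I) β p ((extChartAt I p).symm z)).det) y :=
    ((hasFDerivAt_det (A := fun z ↦ chartGram (I := I) β p ((extChartAt I p).symm z))
      fun i j ↦ differentiableAt_comp_extChartAt_symm hy (hG i j)).differentiableAt).sqrt
      (det_chartGram_pos β hx).ne'
  have hs (k) : MDiffAt (T% (fun z ↦ chartCoeff β p X k z • chartFrame (I := I) β p k z)) x :=
    (hc k).smul_section (hm k)
  have h1 : divergence X x =
      divergence (fun z ↦ ∑ k, chartCoeff β p X k z • chartFrame (I := I) β p k z) x := by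
    refine divergence_congr ((hX x).mdifferentiableAt (by simp)) (.sum_section fun k _ ↦ hs k) ?_
    filter_upwards [(isOpen_extChartAt_source p).mem_nhds hx] with z hz
    exact eq_sum_chartFrame β hz X
  rw [h1, divergence_sum hs, Finset.sum_mul]
  refine Finset.sum_congr rfl fun k _ ↦ ?_
  rw [divergence_smul (hc k) (hm k), fderiv_fun_mul
    (differentiableAt_comp_extChartAt_symm hy (hc k)) hsd, add_mul, mul_assoc,
    divergence_chartFrame β hy k, _root_.add_apply, _root_.smul_apply, _root_.smul_apply,
    smul_eq_mul, smul_eq_mul, mvfderiv_chartFrame β hy (hc k)]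
  ring

end ChartFrame

/-! ### Change of charts -/

section ChartChange

variable {E : Type*} [NormedAddCommGroup E] [NormedSpace ℝ E] [FiniteDimensional ℝ E]
  {H : Type*} [TopologicalSpace H] {I : ModelWithCorners ℝ E H} [I.Boundaryless]
  {M : Type*} [TopologicalSpace M] [ChartedSpace H M] [IsManifold I ∞ M]
  [RiemannianBundle (fun x : M ↦ TangentSpace I x)]
  [IsContMDiffRiemannianBundle I ∞ E (fun x : M ↦ TangentSpace I x)]
  {ι : Type*} [Fintype ι] (β : Module.Basis ι ℝ E) {p q : M} {y : E}

lemma eq_sum_repr_mvfderiv_smul_chartFrame {x : M} (hx : x ∈ (extChartAt I q).source)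
    (w : TangentSpace I x) :
    w = ∑ k, β.repr (mvfderiv I (extChartAt I q) x w) k • chartFrame (I := I) β q k x := by
  obtain ⟨v, hv⟩ := exists_basis_eq_chartFrame (I := I) β hx
  have h : mvfderiv I (extChartAt I q) x w = ∑ k, v.repr w k • β k := by
    conv_lhs => rw [← v.sum_repr w]
    simp only [map_sum, map_smul, hv, mvfderiv_extChartAt_chartFrame β hx]
  conv_lhs => rw [← v.sum_repr w]
  refine Finset.sum_congr rfl fun k _ ↦ ?_
  rw [h, β.repr_sum_self, hv]

lemma differentiableAt_extChartAt_comp_symm (hy : y ∈ (extChartAt I p).target)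
    (hq : (extChartAt I p).symm y ∈ (extChartAt I q).source) :
    DifferentiableAt ℝ (fun z ↦ extChartAt I q ((extChartAt I p).symm z)) y :=
  differentiableAt_comp_extChartAt_symm hy
    (mdifferentiableAt_extChartAt (by rwa [extChartAt_source] at hq))

variable [DecidableEq ι]

/-- The volume density is multiplied with the Jacobian determinant under a change of charts. -/
lemma sqrt_det_chartGram_change (hy : y ∈ (extChartAt I p).target)
    (hq : (extChartAt I p).symm y ∈ (extChartAt I q).source) :
    √(chartGram (I := I) β p ((extChartAt I p).symm y)).det =
      |(fderiv ℝ (fun z ↦ extChartAt I q ((extChartAt I p).symm z)) y).det| *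
        √(chartGram (I := I) β q ((extChartAt I p).symm y)).det := by
  set x := (extChartAt I p).symm y
  set T := fderiv ℝ (fun z ↦ extChartAt I q ((extChartAt I p).symm z)) y with hT
  set J := LinearMap.toMatrix β β (T : E →ₗ[ℝ] E)
  have h1 (i) : chartFrame (I := I) β p i x = ∑ k, J k i • chartFrame (I := I) β q k x := by
    have hd := mvfderiv_chartFrame (g := extChartAt I q) β hy
      (mdifferentiableAt_extChartAt (by rwa [extChartAt_source] at hq)) i
    refine (eq_sum_repr_mvfderiv_smul_chartFrame β hq _).trans ?_
    refine Finset.sum_congr rfl fun k _ ↦ ?_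
    rw [hd]
    exact congrArg (· • _) (LinearMap.toMatrix_apply β β (T : E →ₗ[ℝ] E) k i).symm
  have h2 : chartGram (I := I) β p x = J.transpose * chartGram (I := I) β q x * J := by
    ext i j
    simp only [chartGram, Matrix.gram_apply, Matrix.mul_apply, Matrix.transpose_apply]
    rw [h1 i, h1 j]
    simp only [sum_inner, inner_sum, inner_smul_left, inner_smul_right, RCLike.conj_to_real,
      Finset.sum_mul, Finset.mul_sum]
    refine Finset.sum_congr rfl fun k _ ↦ Finset.sum_congr rfl fun l _ ↦ ?_
    ring
  have h3 : J.det = T.det := LinearMap.det_toMatrix β (T : E →ₗ[ℝ] E)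
  rw [h2, Matrix.det_mul, Matrix.det_mul, Matrix.det_transpose, h3, mul_right_comm, ← sq,
    Real.sqrt_mul (sq_nonneg _), Real.sqrt_sq_eq_abs]

end ChartChange

/-! ### The Riemannian volume in a chart -/

section Volume

variable {n : ℕ} {M : Type*} [TopologicalSpace M] [T2Space M] [SigmaCompactSpace M]
  [ChartedSpace (EuclideanSpace ℝ (Fin n)) M]
  [IsManifold (𝓡 n) ∞ M]
  [RiemannianBundle (fun x : M ↦ TangentSpace (𝓡 n) x)]
  [IsContMDiffRiemannianBundle (𝓡 n) ∞ (EuclideanSpace ℝ (Fin n))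
    (fun x : M ↦ TangentSpace (𝓡 n) x)]

lemma volumeDensity_eq {p : M} {y : EuclideanSpace ℝ (Fin n)}
    (hy : y ∈ (extChartAt (𝓡 n) p).target) :
    volumeDensity p y = √(chartGram (I := 𝓡 n) (EuclideanSpace.basisFun (Fin n) ℝ).toBasis p
      ((extChartAt (𝓡 n) p).symm y)).det := by
  simp only [volumeDensity, coordVector_eq p hy]
  rfl

lemma volumeDensity_pos {p : M} {y : EuclideanSpace ℝ (Fin n)}
    (hy : y ∈ (extChartAt (𝓡 n) p).target) : 0 < volumeDensity p y := by
  rw [volumeDensity_eq hy]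
  exact Real.sqrt_pos.2 (det_chartGram_pos _ ((extChartAt (𝓡 n) p).map_target hy))

variable [MeasurableSpace M] [BorelSpace M]

lemma aemeasurable_volumeDensity (p : M) : AEMeasurable (volumeDensity (n := n) p)
    (volume.restrict (extChartAt (𝓡 n) p).target) :=
  (continuousOn_volumeDensity p).aemeasurable (isOpen_extChartAt_target p).measurableSet

lemma aemeasurable_extChartAt_symm (p : M) : AEMeasurable (extChartAt (𝓡 n) p).symm
    ((volume.restrict (extChartAt (𝓡 n) p).target).withDensity
      fun y ↦ ENNReal.ofReal (volumeDensity p y)) :=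
  ((continuousOn_extChartAt_symm p).aemeasurable
    (isOpen_extChartAt_target p).measurableSet).mono_ac (withDensity_absolutelyContinuous _ _)

lemma measurableSet_target_inter_preimage (p : M) {A : Set M} (hA : MeasurableSet A) :
    MeasurableSet ((extChartAt (𝓡 n) p).target ∩ (extChartAt (𝓡 n) p).symm ⁻¹' A) := by
  have ht : MeasurableSet (extChartAt (𝓡 n) p).target := (isOpen_extChartAt_target p).measurableSet
  have h := (continuousOn_iff_continuous_domRestrict.1 (continuousOn_extChartAt_symm
    (I := 𝓡 n) p)).measurable hA
  have h2 := ht.subtype_image h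
  convert h2 using 1
  ext y
  simp [and_comm]

lemma chartVolume_apply (p : M) {A : Set M} (hA : MeasurableSet A) :
    chartVolume n p A = ∫⁻ y in (extChartAt (𝓡 n) p).target ∩ (extChartAt (𝓡 n) p).symm ⁻¹' A,
      ENNReal.ofReal (volumeDensity p y) := by
  have ht : MeasurableSet (extChartAt (𝓡 n) p).target := (isOpen_extChartAt_target p).measurableSet
  rw [chartVolume, Measure.map_apply_of_aemeasurable (aemeasurable_extChartAt_symm p) hA,
    withDensity_apply', Measure.restrict_restrict₀, inter_comm]
  exact ((continuousOn_extChartAt_symm p).aemeasurable ht).nullMeasurableSet_preimage hA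

/-- The volumes of two charts agree on the common domain, by the change of variables formula. -/
lemma chartVolume_eq_of_subset (p q : M) {A : Set M} (hA : MeasurableSet A)
    (hp : A ⊆ (extChartAt (𝓡 n) p).source) (hq : A ⊆ (extChartAt (𝓡 n) q).source) :
    chartVolume n p A = chartVolume n q A := by
  set T := fun y ↦ extChartAt (𝓡 n) q ((extChartAt (𝓡 n) p).symm y) with hT
  have him : (extChartAt (𝓡 n) q).target ∩ (extChartAt (𝓡 n) q).symm ⁻¹' A =
      T '' ((extChartAt (𝓡 n) p).target ∩ (extChartAt (𝓡 n) p).symm ⁻¹' A) := by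
    ext z
    constructor
    · rintro ⟨hz, hzA⟩
      refine ⟨extChartAt (𝓡 n) p ((extChartAt (𝓡 n) q).symm z),
        ⟨(extChartAt (𝓡 n) p).map_source (hp hzA), ?_⟩, ?_⟩
      · rw [mem_preimage, (extChartAt (𝓡 n) p).left_inv (hp hzA)]
        exact hzA
      · simp only [hT]
        rw [(extChartAt (𝓡 n) p).left_inv (hp hzA), (extChartAt (𝓡 n) q).right_inv hz]
    · rintro ⟨y, ⟨hy, hyA⟩, rfl⟩
      refine ⟨(extChartAt (𝓡 n) q).map_source (hq hyA), ?_⟩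
      rw [mem_preimage, (extChartAt (𝓡 n) q).left_inv (hq hyA)]
      exact hyA
  have hinj : InjOn T ((extChartAt (𝓡 n) p).target ∩ (extChartAt (𝓡 n) p).symm ⁻¹' A) := by
    rintro y ⟨hy, hyA⟩ z ⟨hz, hzA⟩ h
    exact (extChartAt (𝓡 n) p).symm.injOn hy hz ((extChartAt (𝓡 n) q).injOn (hq hyA) (hq hzA) h)
  have hm := measurableSet_target_inter_preimage (n := n) p hA
  rw [chartVolume_apply p hA, chartVolume_apply q hA, him,
    lintegral_image_eq_lintegral_abs_det_fderiv_mul volume hm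
      (fun y hy ↦ (differentiableAt_extChartAt_comp_symm hy.1
        (hq hy.2)).hasFDerivAt.hasFDerivWithinAt) hinj]
  refine setLIntegral_congr_fun hm fun y hy ↦ ?_
  have h1 : (extChartAt (𝓡 n) q).symm (T y) = (extChartAt (𝓡 n) p).symm y :=
    (extChartAt (𝓡 n) q).left_inv (hq hy.2)
  rw [← ENNReal.ofReal_mul (abs_nonneg _), volumeDensity_eq hy.1,
    volumeDensity_eq ((extChartAt (𝓡 n) q).map_source (hq hy.2)), h1,
    sqrt_det_chartGram_change _ hy.1 (hq hy.2)]

lemma chartVolume_compl_source (p : M) : chartVolume n p (extChartAt (𝓡 n) p).sourceᶜ = 0 := by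
  rw [chartVolume_apply p (isOpen_extChartAt_source p).measurableSet.compl]
  have h : (extChartAt (𝓡 n) p).target ∩
      (extChartAt (𝓡 n) p).symm ⁻¹' (extChartAt (𝓡 n) p).sourceᶜ = ∅ := by
    ext y
    simp only [mem_inter_iff, mem_preimage, mem_compl_iff, mem_empty_iff_false, iff_false,
      not_and, not_not]
    exact fun hy ↦ (extChartAt (𝓡 n) p).map_target hy
  rw [h]
  simp

lemma volumePartition_eq_zero {p x : M} (hx : x ∉ (extChartAt (𝓡 n) p).source) :
    volumePartition n M p x = 0 := by
  by_contra h
  apply hx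
  rw [extChartAt_source]
  exact volumePartition_isSubordinate n M p (subset_tsupport _ h)

/-- In every chart the Riemannian volume is `√(det (g_ij)) dx`. -/
lemma riemannianVolume_apply_of_subset (p : M) {A : Set M} (hA : MeasurableSet A)
    (hp : A ⊆ (extChartAt (𝓡 n) p).source) : riemannianVolume n M A = chartVolume n p A := by
  have hq (q : M) : (chartVolume n q).withDensity
      (fun x ↦ ENNReal.ofReal (volumePartition n M q x)) A =
        ∫⁻ x in A, ENNReal.ofReal (volumePartition n M q x) ∂(chartVolume n p) := by
    have hs : MeasurableSet (extChartAt (𝓡 n) q).source :=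
      (isOpen_extChartAt_source q).measurableSet
    have h0 (μ : Measure M) : ∫⁻ x in A, ENNReal.ofReal (volumePartition n M q x) ∂μ =
        ∫⁻ x in A ∩ (extChartAt (𝓡 n) q).source, ENNReal.ofReal (volumePartition n M q x) ∂μ := by
      have hz : ∫⁻ x in A \ (extChartAt (𝓡 n) q).source,
          ENNReal.ofReal (volumePartition n M q x) ∂μ = 0 := by
        rw [setLIntegral_congr_fun (g := fun _ ↦ 0) (hA.diff hs), lintegral_zero]
        intro x hx
        simp only [volumePartition_eq_zero hx.2, ENNReal.ofReal_zero]
      rw [← lintegral_inter_add_sdiff _ A hs, hz, add_zero]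
    have h1 : (chartVolume n q).restrict (A ∩ (extChartAt (𝓡 n) q).source) =
        (chartVolume n p).restrict (A ∩ (extChartAt (𝓡 n) q).source) := by
      ext B hB
      rw [Measure.restrict_apply hB, Measure.restrict_apply hB]
      exact chartVolume_eq_of_subset q p (hB.inter (hA.inter hs))
        (inter_subset_right.trans inter_subset_right)
        (inter_subset_right.trans (inter_subset_left.trans hp))
    rw [withDensity_apply _ hA, h0, h0, h1]
  rw [riemannianVolume, Measure.sum_apply _ hA]
  simp only [hq]
  -- only countably many functions of the partition of unity are nonzero
  set s := {q : M | (Function.support (volumePartition n M q)).Nonempty} with hs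
  have : Countable s := countable_univ_iff.1
    (((volumePartition n M).locallyFinite.comp_injective Subtype.val_injective).countable_univ
      fun q : s ↦ q.2)
  have hsupp (f : M → ENNReal) (hf : ∀ q, (∀ x, volumePartition n M q x = 0) → f q = 0) :
      ∑' q : s, f q = ∑' q, f q := by
    refine tsum_subtype_eq_of_support_subset fun q hq ↦ ?_
    by_contra h
    refine hq (hf q fun x ↦ ?_)
    by_contra hx
    exact h ⟨x, hx⟩
  rw [← hsupp _ fun q h ↦ by simp [h], ← lintegral_tsum]
  · have h1 (x : M) : ∑' q : s, ENNReal.ofReal (volumePartition n M q x) = 1 := by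
      have hfin := (volumePartition n M).locallyFinite.point_finite x
      rw [hsupp (fun q ↦ ENNReal.ofReal (volumePartition n M q x)) fun q h ↦ by simp [h],
        tsum_eq_sum (s := hfin.toFinset), ← ENNReal.ofReal_sum_of_nonneg,
        ← finsum_eq_sum_of_support_subset, (volumePartition n M).sum_eq_one (mem_univ x),
        ENNReal.ofReal_one]
      · intro q hq
        simpa using hq
      · exact fun q _ ↦ (volumePartition n M).nonneg q x
      · intro q hq
        have : volumePartition n M q x = 0 := by simpa using hq
        rw [this, ENNReal.ofReal_zero]
    simp only [h1, lintegral_const, Measure.restrict_apply_univ, one_mul]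
  · intro q
    exact (ENNReal.measurable_ofReal.comp
      (volumePartition n M q).contMDiff.continuous.measurable).aemeasurable

lemma riemannianVolume_restrict_source (p : M) :
    (riemannianVolume n M).restrict (extChartAt (𝓡 n) p).source = chartVolume n p := by
  have hs : MeasurableSet (extChartAt (𝓡 n) p).source := (isOpen_extChartAt_source p).measurableSet
  ext A hA
  rw [Measure.restrict_apply hA,
    riemannianVolume_apply_of_subset p (hA.inter hs) inter_subset_right,
    measure_inter_conull (chartVolume_compl_source p)]

lemma riemannianVolume_pos {U : Set M} (hU : IsOpen U) (hne : U.Nonempty) :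
    0 < riemannianVolume n M U := by
  obtain ⟨p, hp⟩ := hne
  have ho : IsOpen (U ∩ (extChartAt (𝓡 n) p).source) := hU.inter (isOpen_extChartAt_source p)
  refine lt_of_lt_of_le ?_ (measure_mono (inter_subset_left (t := (extChartAt (𝓡 n) p).source)))
  rw [riemannianVolume_apply_of_subset p ho.measurableSet inter_subset_right,
    chartVolume_apply p ho.measurableSet]
  have hop : IsOpen ((extChartAt (𝓡 n) p).target ∩
      (extChartAt (𝓡 n) p).symm ⁻¹' (U ∩ (extChartAt (𝓡 n) p).source)) :=
    (continuousOn_extChartAt_symm p).isOpen_inter_preimage (isOpen_extChartAt_target p) ho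
  set W := (extChartAt (𝓡 n) p).target ∩
    (extChartAt (𝓡 n) p).symm ⁻¹' (U ∩ (extChartAt (𝓡 n) p).source)
  have hW : W.Nonempty := by
    refine ⟨extChartAt (𝓡 n) p p, mem_extChartAt_target p, ?_⟩
    rw [mem_preimage, extChartAt_to_inv]
    exact ⟨hp, mem_extChartAt_source p⟩
  have hpos := hop.measure_pos (μ := (volume : Measure (EuclideanSpace ℝ (Fin n)))) hW
  refine pos_iff_ne_zero.2 fun h ↦ hpos.ne' ?_
  rw [lintegral_eq_zero_iff'
    ((aemeasurable_volumeDensity p).mono_set inter_subset_left).ennreal_ofReal] at h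
  rw [← Measure.restrict_eq_zero, ← ae_eq_bot, ← Filter.eventually_false_iff_eq_bot]
  filter_upwards [h, ae_restrict_mem hop.measurableSet] with y hy hyW
  exact (ENNReal.ofReal_pos.2 (volumeDensity_pos hyW.1)).ne' hy

end Volume

/-! ### The divergence theorem -/

section EuclideanIntegral

variable {E : Type*} [NormedAddCommGroup E] [NormedSpace ℝ E] [FiniteDimensional ℝ E]
  [MeasurableSpace E] [BorelSpace E] {μ : Measure E} [μ.IsAddHaarMeasure]

/-- The integral of a partial derivative over an open set vanishes for functions with compact
support in that set. -/
lemma integral_fderiv_eq_zero {U K : Set E} {h : E → ℝ} (hU : IsOpen U) (hK : IsCompact K)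
    (hKU : K ⊆ U) (hh : ∀ y ∈ U, ContDiffAt ℝ ∞ h y) (h0 : ∀ y ∈ U, y ∉ K → h y = 0) (v : E) :
    IntegrableOn (fun y ↦ fderiv ℝ h y v) U μ ∧ ∫ y in U, fderiv ℝ h y v ∂μ = 0 := by
  -- the extension of `h` by zero is smooth on the whole space
  set g := U.indicator h with hg
  have hgh (y) (hy : y ∈ U) : g =ᶠ[𝓝 y] h := by
    filter_upwards [hU.mem_nhds hy] with z hz
    exact indicator_of_mem hz h
  have hg0 (y) (hy : y ∉ K) : g y = 0 := by
    by_cases hyU : y ∈ U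
    · rw [hg, indicator_of_mem hyU, h0 y hyU hy]
    · exact indicator_of_notMem hyU h
  have hgK (y) (hy : y ∉ K) : g =ᶠ[𝓝 y] fun _ ↦ 0 := by
    filter_upwards [hK.isClosed.isOpen_compl.mem_nhds hy] with z hz
    exact hg0 z hz
  have hgs : ContDiff ℝ ∞ g := contDiff_iff_contDiffAt.2 fun y ↦ by
    by_cases hy : y ∈ K
    · exact (hh y (hKU hy)).congr_of_eventuallyEq (hgh y (hKU hy))
    · exact contDiffAt_const.congr_of_eventuallyEq (hgK y hy)
  have hc : Continuous fun y ↦ fderiv ℝ g y v :=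
    (hgs.continuous_fderiv (by simp)).clm_apply continuous_const
  have hcz (y) (hy : y ∉ K) : fderiv ℝ g y v = 0 := by
    rw [(hgK y hy).fderiv_eq]
    simp
  have hi : Integrable (fun y ↦ fderiv ℝ g y v) μ :=
    hc.integrable_of_hasCompactSupport (.of_support_subset_isCompact hK fun y hy ↦ by
      by_contra h
      exact hy (hcz y h))
  have hgi : Integrable g μ :=
    hgs.continuous.integrable_of_hasCompactSupport (.of_support_subset_isCompact hK fun y hy ↦ by
      by_contra h
      exact hy (hg0 y h))
  have he : EqOn (fun y ↦ fderiv ℝ g y v) (fun y ↦ fderiv ℝ h y v) U := fun y hy ↦ by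
    simp only [(hgh y hy).fderiv_eq]
  refine ⟨hi.integrableOn.congr_fun he hU.measurableSet, ?_⟩
  rw [← setIntegral_congr_fun hU.measurableSet he,
    setIntegral_eq_integral_of_forall_compl_eq_zero fun y hy ↦ hcz y fun h ↦ hy (hKU h)]
  -- integration by parts against the constant function `1`
  have h1 := integral_mul_fderiv_eq_neg_fderiv_mul_of_integrable (μ := μ) (f := fun _ ↦ (1 : ℝ))
    (g := g) (v := v) (by simp) (by simpa using hi) (by simpa using hgi)
    (fun _ _ ↦ differentiableAt_const _) (fun y _ ↦ hgs.differentiable (by simp) y)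
  simpa using h1

end EuclideanIntegral

section ChartDivergence

variable {E : Type*} [NormedAddCommGroup E] [NormedSpace ℝ E] [FiniteDimensional ℝ E]
  {H : Type*} [TopologicalSpace H] {I : ModelWithCorners ℝ E H} [I.Boundaryless]
  {M : Type*} [TopologicalSpace M] [ChartedSpace H M] [IsManifold I ∞ M]
  [RiemannianBundle (fun x : M ↦ TangentSpace I x)]
  [IsContMDiffRiemannianBundle I ∞ E (fun x : M ↦ TangentSpace I x)]
  {ι : Type*} [Fintype ι] [DecidableEq ι] (β : Module.Basis ι ℝ E)

lemma contMDiffAt_sqrt_det_chartGram {p x : M} (hx : x ∈ (extChartAt I p).source) :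
    CMDiffAt ∞ (fun z ↦ √(chartGram (I := I) β p z).det) x := by
  have h1 : CMDiffAt ∞ (fun z ↦ (chartGram (I := I) β p z).det) x := by
    simp only [Matrix.det_apply']
    refine ContMDiffAt.sum fun σ _ ↦ contMDiffAt_const.mul ?_
    exact contMDiffAt_finsetProd fun i _ ↦ contMDiffAt_chartGram β hx _ _
  exact (Real.contDiffAt_sqrt (det_chartGram_pos β hx).ne').contMDiffAt.comp x h1

lemma contDiffAt_comp_extChartAt_symm {p : M} {y : E} (hy : y ∈ (extChartAt I p).target)
    {g : M → ℝ} (hg : CMDiffAt ∞ g ((extChartAt I p).symm y)) :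
    ContDiffAt ℝ ∞ (fun z ↦ g ((extChartAt I p).symm z)) y := by
  have h1 : ContMDiffAt 𝓘(ℝ, E) I ∞ (extChartAt I p).symm y :=
    (contMDiffOn_extChartAt_symm (I := I) p).contMDiffAt ((isOpen_extChartAt_target p).mem_nhds hy)
  exact (ContMDiffAt.comp y hg h1).contDiffAt

lemma contDiffAt_chartCoeff_mul {p : M} {y : E} (hy : y ∈ (extChartAt I p).target)
    {X : Π x : M, TangentSpace I x} (hX : CMDiff ∞ (T% X)) (k : ι) :
    ContDiffAt ℝ ∞ (fun z ↦ chartCoeff β p X k ((extChartAt I p).symm z) *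
      √(chartGram (I := I) β p ((extChartAt I p).symm z)).det) y := by
  have hx := (extChartAt I p).map_target hy
  exact contDiffAt_comp_extChartAt_symm
    (g := fun x ↦ chartCoeff β p X k x * √(chartGram (I := I) β p x).det) hy
    ((contMDiffAt_chartCoeff β hx (hX _) k).mul (contMDiffAt_sqrt_det_chartGram β hx))

/-- The Levi-Civita connection is only given by its values, so continuity is read off from the
formula for the divergence in a chart. -/
lemma continuous_divergence {X : Π x : M, TangentSpace I x} (hX : CMDiff ∞ (T% X)) :
    Continuous (divergence X) := by
  refine continuous_iff_continuousAt.2 fun p ↦ ?_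
  set β := Module.finBasis ℝ E
  have hs := mem_extChartAt_source (I := I) p
  have hy := mem_extChartAt_target (I := I) p
  have h1 : ContinuousAt (fun x ↦ (∑ k, fderiv ℝ (fun z ↦
      chartCoeff β p X k ((extChartAt I p).symm z) *
        √(chartGram (I := I) β p ((extChartAt I p).symm z)).det) (extChartAt I p x) (β k)) /
          √(chartGram (I := I) β p x).det) p := by
    refine ContinuousAt.div ?_ (contMDiffAt_sqrt_det_chartGram β hs).continuousAt
      (Real.sqrt_pos.2 (det_chartGram_pos β hs)).ne'
    refine tendsto_finsetSum _ fun k _ ↦ ?_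
    have h2 := ((contDiffAt_chartCoeff_mul β hy hX k).fderiv_right (m := 0)
      (by simp)).continuousAt
    exact ContinuousAt.comp (g := fun y ↦ fderiv ℝ (fun z ↦
      chartCoeff β p X k ((extChartAt I p).symm z) *
        √(chartGram (I := I) β p ((extChartAt I p).symm z)).det) y (β k))
      (h2.clm_apply continuousAt_const) (continuousAt_extChartAt p)
  refine h1.congr ?_
  filter_upwards [(isOpen_extChartAt_source p).mem_nhds hs] with x hx
  have h3 := divergence_mul_sqrt_det β ((extChartAt I p).map_source hx) hX
  rw [(extChartAt I p).left_inv hx] at h3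
  rw [← h3, mul_div_cancel_right₀ _ (Real.sqrt_pos.2 (det_chartGram_pos β hx)).ne']

lemma divergence_eq_zero {X : Π x : M, TangentSpace I x} (hX : CMDiff ∞ (T% X)) {x : M}
    (h : ∀ᶠ y in 𝓝 x, X y = 0) : divergence X x = 0 := by
  have h1 := cov_congr (cov := leviCivita I M) ((hX x).mdifferentiableAt (by simp))
    (mdifferentiable_zeroSection ℝ (fun x : M ↦ TangentSpace I x) x) h
  have h2 : leviCivita I M X x = 0 := h1.trans (congrFun (leviCivita I M).zero x)
  simp [divergence, h2]

lemma divergence_eq_zero_of_notMem {X : Π x : M, TangentSpace I x} (hX : CMDiff ∞ (T% X)) {x : M}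
    (hx : x ∉ closure {y | X y ≠ 0}) : divergence X x = 0 := by
  refine divergence_eq_zero hX ?_
  filter_upwards [isClosed_closure.isOpen_compl.mem_nhds hx] with y hy
  by_contra h
  exact hy (subset_closure h)

end ChartDivergence

section DivergenceTheorem

variable {n : ℕ} {M : Type*} [TopologicalSpace M] [T2Space M] [SigmaCompactSpace M]
  [ChartedSpace (EuclideanSpace ℝ (Fin n)) M] [IsManifold (𝓡 n) ∞ M]
  [RiemannianBundle (fun x : M ↦ TangentSpace (𝓡 n) x)]
  [IsContMDiffRiemannianBundle (𝓡 n) ∞ (EuclideanSpace ℝ (Fin n))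
    (fun x : M ↦ TangentSpace (𝓡 n) x)]
  [MeasurableSpace M] [BorelSpace M]

/-- The divergence theorem for vector fields supported in a chart. -/
lemma integral_divergence_of_subset {p : M} {X : Π x : M, TangentSpace (𝓡 n) x}
    (hX : ContMDiff (𝓡 n) (𝓡 n).tangent ∞
      (fun x ↦ TotalSpace.mk' (EuclideanSpace ℝ (Fin n)) x (X x)))
    (hc : IsCompact (closure {x | X x ≠ 0}))
    (hp : closure {x | X x ≠ 0} ⊆ (extChartAt (𝓡 n) p).source) :
    ∫ x, divergence X x ∂(riemannianVolume n M) = 0 := by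
  have ht := isOpen_extChartAt_target (I := 𝓡 n) p
  rw [← setIntegral_eq_integral_of_forall_compl_eq_zero (s := (extChartAt (𝓡 n) p).source)
    fun x hx ↦ divergence_eq_zero_of_notMem hX fun h ↦ hx (hp h),
    riemannianVolume_restrict_source, chartVolume, integral_map (aemeasurable_extChartAt_symm p)
      (continuous_divergence hX).aestronglyMeasurable,
    integral_withDensity_eq_integral_toReal_smul₀ (aemeasurable_volumeDensity p).ennreal_ofReal
      (.of_forall fun y ↦ ENNReal.ofReal_lt_top)]
  set β := (EuclideanSpace.basisFun (Fin n) ℝ).toBasis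
  have h1 := fun k ↦ integral_fderiv_eq_zero (μ := (volume : Measure (EuclideanSpace ℝ (Fin n))))
    (K := extChartAt (𝓡 n) p '' closure {x | X x ≠ 0}) ht
    (hc.image_of_continuousOn ((continuousOn_extChartAt p).mono hp))
    (by
      rintro _ ⟨x, hx, rfl⟩
      exact (extChartAt (𝓡 n) p).map_source (hp hx))
    (fun y hy ↦ contDiffAt_chartCoeff_mul β hy hX k)
    (fun y hy hyK ↦ by
      have h0 : X ((extChartAt (𝓡 n) p).symm y) = 0 := by
        by_contra h
        exact hyK ⟨_, subset_closure h, (extChartAt (𝓡 n) p).right_inv hy⟩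
      simp only [chartCoeff, h0, map_zero, zero_mul]) (β k)
  rw [setIntegral_congr_fun ht.measurableSet (g := fun y ↦ ∑ k, fderiv ℝ (fun z ↦
      chartCoeff β p X k ((extChartAt (𝓡 n) p).symm z) *
        √(chartGram (I := 𝓡 n) β p ((extChartAt (𝓡 n) p).symm z)).det) y (β k)),
    integral_finsetSum _ fun k _ ↦ (h1 k).1]
  · exact Finset.sum_eq_zero fun k _ ↦ (h1 k).2
  · intro y hy
    simp only [ENNReal.toReal_ofReal (volumeDensity_pos hy).le, smul_eq_mul]
    rw [mul_comm, volumeDensity_eq hy]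
    exact divergence_mul_sqrt_det β hy hX

lemma integrable_divergence {X : Π x : M, TangentSpace (𝓡 n) x}
    (hX : ContMDiff (𝓡 n) (𝓡 n).tangent ∞
      (fun x ↦ TotalSpace.mk' (EuclideanSpace ℝ (Fin n)) x (X x)))
    (hc : IsCompact (closure {x | X x ≠ 0})) :
    Integrable (divergence X) (riemannianVolume n M) :=
  (continuous_divergence hX).integrable_of_hasCompactSupport
    (.of_support_subset_isCompact hc fun x hx ↦ by
      by_contra h
      exact hx (divergence_eq_zero_of_notMem hX h))

/-- The divergence theorem. -/
theorem integral_divergence {X : Π x : M, TangentSpace (𝓡 n) x}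
    (hX : ContMDiff (𝓡 n) (𝓡 n).tangent ∞
      (fun x ↦ TotalSpace.mk' (EuclideanSpace ℝ (Fin n)) x (X x)))
    (hc : IsCompact (closure {x | X x ≠ 0})) :
    ∫ x, divergence X x ∂(riemannianVolume n M) = 0 := by
  set ρ := volumePartition n M
  have hfin := ρ.locallyFinite.finite_nonempty_inter_compact hc
  let Y (q : M) (x : M) : TangentSpace (𝓡 n) x := ρ q x • X x
  have hY (q : M) : ContMDiff (𝓡 n) (𝓡 n).tangent ∞
      (fun x ↦ TotalSpace.mk' (EuclideanSpace ℝ (Fin n)) x (Y q x)) :=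
    (ρ q).contMDiff.smul_section hX
  have hYc (q : M) : IsCompact (closure {x | Y q x ≠ 0}) := by
    refine hc.of_isClosed_subset isClosed_closure (closure_mono fun x hx h ↦ hx ?_)
    simp only [Y, h, smul_zero]
  have hYp (q : M) : closure {x | Y q x ≠ 0} ⊆ (extChartAt (𝓡 n) q).source := by
    rw [extChartAt_source]
    have h : {x | Y q x ≠ 0} ⊆ Function.support (ρ q) := fun x hx h ↦
      hx (by simp only [Y, h, zero_smul])
    exact (closure_mono h).trans (volumePartition_isSubordinate n M q)
  have h1 : X = fun x ↦ ∑ q ∈ hfin.toFinset, Y q x := by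
    funext x
    rw [← Finset.sum_smul]
    by_cases hx : X x = 0
    · rw [hx, smul_zero]
    · rw [← finsum_eq_sum_of_support_subset, ρ.sum_eq_one (mem_univ x), one_smul]
      intro q hq
      simp only [Finite.coe_toFinset]
      exact ⟨x, hq, subset_closure hx⟩
  have h2 : divergence X = fun x ↦ ∑ q ∈ hfin.toFinset, divergence (Y q) x := by
    funext x
    conv_lhs => rw [h1]
    exact divergence_sum fun q ↦ (hY q x).mdifferentiableAt (by simp)
  rw [h2, integral_finsetSum _ fun q _ ↦ integrable_divergence (hY q) (hYc q)]
  exact Finset.sum_eq_zero fun q _ ↦ integral_divergence_of_subset (hY q) (hYc q) (hYp q)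

end DivergenceTheorem

/-! ### The spectral gap -/

namespace DiracBundle

section Gap

variable {𝕜 : Type*} [RCLike 𝕜] {n : ℕ}
  {M : Type*} [TopologicalSpace M] [T2Space M] [SigmaCompactSpace M]
  [ChartedSpace (EuclideanSpace ℝ (Fin n)) M] [IsManifold (𝓡 n) ∞ M]
  [MeasurableSpace M] [BorelSpace M]
  [RiemannianBundle (fun x : M ↦ TangentSpace (𝓡 n) x)]
  [IsContMDiffRiemannianBundle (𝓡 n) ∞ (EuclideanSpace ℝ (Fin n))
    (fun x : M ↦ TangentSpace (𝓡 n) x)]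
  {F : Type*} [NormedAddCommGroup F] [NormedSpace ℝ F] [NormedSpace 𝕜 F] [FiniteDimensional ℝ F]
  {V : M → Type*} [∀ x, NormedAddCommGroup (V x)] [∀ x, InnerProductSpace ℝ (V x)]
  [∀ x, InnerProductSpace 𝕜 (V x)] [TopologicalSpace (TotalSpace F V)] [FiberBundle F V]
  [VectorBundle ℝ F V] [VectorBundle 𝕜 F V] [ContMDiffVectorBundle ∞ F V (𝓡 n)]
  [IsContMDiffRiemannianBundle (𝓡 n) ∞ F V]

lemma re_inner_testSection (φ ψ : TestSection 𝕜 (𝓡 n) F V (riemannianVolume n M)) :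
    RCLike.re (inner 𝕜 φ ψ) = ∫ x, inner ℝ (φ x) (ψ x) ∂(riemannianVolume n M) := by
  refine (integral_re (integrable_inner φ ψ)).symm.trans ?_
  simp only [re_inner_eq_real_inner]

lemma integrable_real_inner (φ ψ : TestSection 𝕜 (𝓡 n) F V (riemannianVolume n M)) :
    Integrable (fun x ↦ inner ℝ (φ x) (ψ x)) (riemannianVolume n M) := by
  have h := (integrable_inner φ ψ).re
  simpa only [re_inner_eq_real_inner] using h

lemma norm_sq_testSection (φ : TestSection 𝕜 (𝓡 n) F V (riemannianVolume n M)) :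
    ‖φ‖ ^ 2 = ∫ x, ‖φ x‖ ^ 2 ∂(riemannianVolume n M) := by
  rw [norm_sq_eq_re_inner (𝕜 := 𝕜), re_inner_testSection]
  simp only [real_inner_self_eq_norm_sq]

lemma exists_testSection_norm_ne_zero [Nonempty M] [Nontrivial F] :
    ∃ φ : TestSection 𝕜 (𝓡 n) F V (riemannianVolume n M), ‖φ‖ ≠ 0 := by
  obtain ⟨x⟩ := ‹Nonempty M›
  obtain ⟨w, hw⟩ := exists_ne (0 : F)
  set e := (trivializationAt F V x).linearEquivAt (R := ℝ) x
    (FiberBundle.mem_baseSet_trivializationAt' x)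
  have hv : e.symm w ≠ 0 := by simpa using hw
  obtain ⟨σ, hσ, hσe, hσc⟩ := exists_smooth_extension (I := 𝓡 n) (F := F) (e.symm w)
  have hσx : σ x ≠ 0 := by rwa [hσe.self_of_nhds, FiberBundle.extend_apply_self]
  refine ⟨⟨σ, hσ, hσc⟩, fun h ↦ ?_⟩
  have h1 := norm_sq_testSection (𝕜 := 𝕜) (F := F) (⟨σ, hσ, hσc⟩ : TestSection 𝕜 (𝓡 n) F V _)
  have hcont : Continuous fun y ↦ ‖σ y‖ ^ 2 := by
    have h2 := RCLike.continuous_re.comp (continuous_inner_section (𝕜 := 𝕜) (F := F) hσ hσ)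
    refine h2.congr fun y ↦ ?_
    exact (norm_sq_eq_re_inner (𝕜 := 𝕜) (σ y)).symm
  have hint : Integrable (fun y ↦ ‖σ y‖ ^ 2) (riemannianVolume n M) := by
    have h2 := integrable_real_inner (𝕜 := 𝕜) (F := F)
      (⟨σ, hσ, hσc⟩ : TestSection 𝕜 (𝓡 n) F V (riemannianVolume n M)) ⟨σ, hσ, hσc⟩
    simpa only [real_inner_self_eq_norm_sq] using h2
  have h3 : 0 < ∫ y, ‖σ y‖ ^ 2 ∂(riemannianVolume n M) := by
    rw [integral_pos_iff_support_of_nonneg (fun y ↦ by positivity) hint]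
    exact riemannianVolume_pos hcont.isOpen_support ⟨x, by simpa using hσx⟩
  rw [h] at h1
  exact h3.ne' (by rw [← zero_pow two_ne_zero]; exact h1.symm)

variable (S : DiracBundle 𝕜 (𝓡 n) F V)

lemma integral_inner_dirac (φ ψ : TestSection 𝕜 (𝓡 n) F V (riemannianVolume n M)) :
    ∫ x, inner ℝ (S.dirac φ x) (ψ x) ∂(riemannianVolume n M) =
      ∫ x, inner ℝ (φ x) (S.dirac ψ x) ∂(riemannianVolume n M) := by
  have hα := contMDiffAt_cliffordForm (S := S) φ.2.1 ψ.2.1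
  have h1 := integral_divergence (contMDiff_sharp hα)
    (φ.2.2.of_isClosed_subset isClosed_closure (closure_mono fun x hx h ↦ hx (by
      simp [sharp, cliffordForm, h])))
  simp only [divergence_cliffordForm φ.2.1 ψ.2.1] at h1
  have h2 := integral_sub (integrable_real_inner (S.diracTest _ φ) ψ)
    (integrable_real_inner φ (S.diracTest _ ψ))
  exact sub_eq_zero.1 (h2.symm.trans h1)

/-- The Dirac operator is symmetric on smooth sections with compact support. -/
lemma inner_diracTest (φ ψ : TestSection 𝕜 (𝓡 n) F V (riemannianVolume n M)) :
    inner 𝕜 (S.diracTest (riemannianVolume n M) φ) ψ =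
      inner 𝕜 φ (S.diracTest (riemannianVolume n M) ψ) := by
  have hre (ψ : TestSection 𝕜 (𝓡 n) F V (riemannianVolume n M)) :
      RCLike.re (inner 𝕜 (S.diracTest (riemannianVolume n M) φ) ψ) =
        RCLike.re (inner 𝕜 φ (S.diracTest (riemannianVolume n M) ψ)) := by
    rw [re_inner_testSection, re_inner_testSection]
    exact S.integral_inner_dirac φ ψ
  -- the imaginary part of an inner product is the real part of another one
  refine RCLike.ext (hre ψ) ?_
  have h := hre ((RCLike.I : 𝕜) • ψ)
  rw [map_smul, inner_smul_right, inner_smul_right] at h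
  simpa using h

/-- The integrated Weitzenböck formula. -/
lemma norm_diracTest_ge {κ : ℝ}
    (hK : ∀ (x : M) (v : V x), κ * ‖v‖ ^ 2 ≤ inner ℝ (S.curvatureEndomorphism x v) v)
    (φ : TestSection 𝕜 (𝓡 n) F V (riemannianVolume n M)) :
    n * (κ * ‖φ‖ ^ 2) + ‖S.diracTest (riemannianVolume n M) φ‖ ^ 2 ≤
      n * ‖S.diracTest (riemannianVolume n M) φ‖ ^ 2 := by
  have hα := contMDiffAt_connForm (S := S) φ.2.1 φ.2.1
  have hc : IsCompact (closure {x | sharp (S.connForm φ φ) x ≠ 0}) :=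
    φ.2.2.of_isClosed_subset isClosed_closure (closure_mono fun x hx h ↦ hx (by
      simp [sharp, connForm, h]))
  have h1 := integral_divergence (contMDiff_sharp hα) hc
  have hi1 := integrable_divergence (contMDiff_sharp hα) hc
  have hsq (ψ : TestSection 𝕜 (𝓡 n) F V (riemannianVolume n M)) :
      Integrable (fun x ↦ ‖ψ x‖ ^ 2) (riemannianVolume n M) := by
    simpa only [real_inner_self_eq_norm_sq] using integrable_real_inner ψ ψ
  have hi2 : Integrable (fun x ↦ inner ℝ (S.dirac (S.dirac φ) x) (φ x)) (riemannianVolume n M) :=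
    integrable_real_inner (S.diracTest _ (S.diracTest _ φ)) φ
  have hfr : Module.finrank ℝ (EuclideanSpace ℝ (Fin n)) = n := finrank_euclideanSpace_fin
  have h2 := integral_mono (μ := riemannianVolume n M)
    ((((hsq φ).const_mul κ).const_mul (n : ℝ)).add (hsq (S.diracTest _ φ)))
    ((hi2.add hi1).const_mul (n : ℝ)) fun x ↦ by
      have h := inner_dirac_dirac_ge hK φ.2.1 x
      rw [hfr] at h
      exact h
  have h3 : ∫ x, inner ℝ (S.dirac (S.dirac φ) x) (φ x) ∂(riemannianVolume n M) =
      ‖S.diracTest (riemannianVolume n M) φ‖ ^ 2 := by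
    rw [norm_sq_eq_re_inner (𝕜 := 𝕜), ← S.inner_diracTest (S.diracTest _ φ) φ, re_inner_testSection]
    rfl
  simp only [Pi.add_apply] at h2
  rw [integral_add (((hsq φ).const_mul κ).const_mul (n : ℝ)) (hsq (S.diracTest _ φ)),
    integral_const_mul,
    integral_const_mul, integral_const_mul, integral_add hi2 hi1, h1, h3, add_zero,
    ← norm_sq_testSection, ← norm_sq_testSection] at h2
  exact h2

/-- A manifold that carries a Clifford module with positive curvature endomorphism has dimension at
least two. -/
lemma two_le_of_curvatureEndomorphism_pos [Nonempty M] [Nontrivial F] {κ : ℝ} (hκ : 0 < κ)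
    (hK : ∀ (x : M) (v : V x), κ * ‖v‖ ^ 2 ≤ inner ℝ (S.curvatureEndomorphism x v) v) :
    2 ≤ n := by
  obtain ⟨φ, hφ⟩ := exists_testSection_norm_ne_zero (𝕜 := 𝕜) (n := n) (M := M) (F := F) (V := V)
  have hpos : 0 < ‖φ‖ ^ 2 := by positivity
  by_contra! hn
  have h := S.norm_diracTest_ge hK φ
  interval_cases n
  · -- in dimension zero the curvature endomorphism is an empty sum
    have h0 (x : M) : φ x = 0 := by
      have h1 := hK x (φ x)
      have : IsEmpty (Fin (Module.finrank ℝ (TangentSpace (𝓡 0) x))) := by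
        have h2 : Module.finrank ℝ (TangentSpace (𝓡 0) x) = 0 := finrank_euclideanSpace_fin
        rw [h2]
        infer_instance
      rw [curvatureEndomorphism, Finset.univ_eq_empty, Finset.sum_empty, smul_zero,
        inner_zero_left] at h1
      have h3 : ‖φ x‖ ^ 2 ≤ 0 := by
        by_contra! h4
        exact absurd h1 (not_le.2 (mul_pos hκ h4))
      simpa using h3
    rw [norm_sq_testSection] at hpos
    simp [h0] at hpos
  · have := mul_pos hκ hpos
    norm_num at h
    linarith

end Gap

end DiracBundle

end GenDirac

end

theorem theorem3p1
    {𝕜 : Type*} [RCLike 𝕜] {n : ℕ}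
    {M : Type*} [TopologicalSpace M] [T2Space M] [SigmaCompactSpace M] [Nonempty M]
    [ChartedSpace (EuclideanSpace ℝ (Fin n)) M] [IsManifold (𝓡 n) ∞ M]
    [MeasurableSpace M] [BorelSpace M]
    [RiemannianBundle (fun x : M ↦ TangentSpace (𝓡 n) x)]
    [IsContMDiffRiemannianBundle (𝓡 n) ∞ (EuclideanSpace ℝ (Fin n))
      (fun x : M ↦ TangentSpace (𝓡 n) x)]
    {F : Type*} [NormedAddCommGroup F] [NormedSpace ℝ F] [NormedSpace 𝕜 F]
    [FiniteDimensional ℝ F] [Nontrivial F]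
    {V : M → Type*} [∀ x, NormedAddCommGroup (V x)] [∀ x, InnerProductSpace ℝ (V x)]
    [∀ x, InnerProductSpace 𝕜 (V x)] [TopologicalSpace (TotalSpace F V)] [FiberBundle F V]
    [VectorBundle ℝ F V] [VectorBundle 𝕜 F V] [ContMDiffVectorBundle ∞ F V (𝓡 n)]
    [IsContMDiffRiemannianBundle (𝓡 n) ∞ F V]
    (S : GenDirac.DiracBundle 𝕜 (𝓡 n) F V) (κ : ℝ) (hκ : 0 < κ)
    (hK : ∀ (x : M) (v : V x), κ * ‖v‖ ^ 2 ≤ inner ℝ (S.curvatureEndomorphism x v) v) :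
    ((S.fundamentalTone (GenDirac.riemannianVolume n M) : 𝕜) ∈ S.spectrumDiracSq (GenDirac.riemannianVolume n M) ∧
      ∀ z ∈ S.spectrumDiracSq (GenDirac.riemannianVolume n M),
        ∃ t : ℝ, z = t ∧ S.fundamentalTone (GenDirac.riemannianVolume n M) ≤ t) ∧
    n * κ / (n - 1) ≤ S.fundamentalTone (GenDirac.riemannianVolume n M) := by
  have hn : (2 : ℝ) ≤ n := by exact_mod_cast S.two_le_of_curvatureEndomorphism_pos hκ hK
  have h := GenDirac.friedrichs_spectrum_of_gap (c := n * κ / (n - 1)) S.inner_diracTest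
    (div_pos (by positivity) (by linarith)) (fun φ ↦ ?_)
    GenDirac.DiracBundle.exists_testSection_norm_ne_zero
  · exact ⟨⟨h.1, h.2.1⟩, h.2.2⟩
  · have h1 := S.norm_diracTest_ge hK φ
    rw [div_mul_eq_mul_div, div_le_iff₀ (by linarith)]
    linarith
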